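/- Let $n\ge 1$, $Q=2n+2$, $0<\alpha<Q$ and $\sigma=\frac{Q+\alpha}{Q-\alpha}$. Let $\mathbb H^n=\mathbb C^n\times\mathbb R$ be the Heisenberg group with group law $(z,t)(p,\tau)=(z+p,\;t+\tau+2\,\mathrm{Im}\sum_{j}z_j\bar p_j)$, Lebesgue measure $d\xi$, and norm $|(z,t)|=(|z|^4+t^2)^{1/4}$, where $|z|$ is the Euclidean length of $z$. Let $u\in L^{\sigma+1}_{loc}(\mathbb H^n)$ be a nonnegative function such that, for every $\zeta\in\mathbb H^n$, $$u(\zeta)=\int_{\mathbb H^n}|\zeta^{-1}\xi|^{-(Q-\alpha)}\,u(\xi)^{\sigma}\,d\xi ,$$ the integral being finite, and suppose that $u$ is cylindrical, i.e. $u(z,t)=u(r,t)$ depends only on $r=|z|$ and $t$. Then there exists $s>0$ such that, for all $(z,t)\ne(0,0)$, with $r=|z|$ and $\rho=(r^4+t^2)^{1/4}$, $$u(r,t)=\frac{s^{Q-\alpha}}{\rho^{Q-\alpha}}\,u\!\left(\frac{s^2r}{\rho^2},\frac{s^4t}{\rho^4}\right),$$ that is, $u$ is invariant under this CR-type inversion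 with respect to the sphere $\partial B(0,s)=\{(z,t)\in\mathbb H^n:|(z,t)|=s\}$. -/

import Mathlib

open MeasureTheory

noncomputable section

namespace Heisenberg

/-- The underlying space `ℂⁿ × ℝ` of the Heisenberg group `ℍⁿ`. Its `volume` is the Lebesgue
measure, which is the Haar measure of the group. The group law is `Heisenberg.mul`. -/
abbrev Heis (n : ℕ) : Type := (Fin n → ℂ) × ℝ

/-- The Hermitian inner product `⟨z, p⟩ = ∑ j, z_j * conj p_j` on `ℂⁿ`. -/
def herm {n : ℕ} (z p : Fin n → ℂ) : ℂ := ∑ j, z j * (starRingEnd ℂ) (p j)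

/-- The group law `(z, t) (p, s) = (z + p, t + s + 2 Im ⟨z, p⟩)`. -/
def mul {n : ℕ} (ξ η : Heis n) : Heis n :=
  (ξ.1 + η.1, ξ.2 + η.2 + 2 * (herm ξ.1 η.1).im)

/-- The group inverse `(z, t)⁻¹ = (-z, -t)`. -/
def inv {n : ℕ} (ξ : Heis n) : Heis n := (-ξ.1, -ξ.2)

/-- The Euclidean length `|z| = (∑ j, |z_j|²)^(1/2)` on `ℂⁿ`. -/
def radius {n : ℕ} (z : Fin n → ℂ) : ℝ := Real.sqrt (∑ j, ‖z j‖ ^ 2)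

/-- The Heisenberg norm `ρ = |(z, t)| = (|z|⁴ + t²)^(1/4)`. -/
def gauge {n : ℕ} (ξ : Heis n) : ℝ := (radius ξ.1 ^ 4 + ξ.2 ^ 2) ^ (1 / 4 : ℝ)

/-- The homogeneous dimension `Q = 2n + 2`. -/
def homDim (n : ℕ) : ℝ := 2 * (n : ℝ) + 2

/-- The kernel `G_α(ζ, ξ) = |ζ⁻¹ ξ|^(-(Q - α))`. (Its value at `ζ = ξ` plays no role in the
integral equation, since points are null sets.) -/
def kernel {n : ℕ} (α : ℝ) (ζ ξ : Heis n) : ℝ :=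
  gauge (mul (inv ζ) ξ) ^ (-(homDim n - α))

/-- The critical exponent `σ = (Q + α) / (Q - α)`. -/
def critExp (n : ℕ) (α : ℝ) : ℝ := (homDim n + α) / (homDim n - α)

/-- Nonnegative solutions `u ∈ L^{σ+1}_loc(ℍⁿ)` of the critical integral equation
`u(ζ) = ∫ G_α(ζ, ξ) u(ξ)^σ dξ`, the integral being finite for every `ζ`. -/
structure IsCriticalSolution {n : ℕ} (α : ℝ) (u : Heis n → ℝ) : Prop where
  nonneg : ∀ ξ, 0 ≤ u ξ
  locLp : ∀ K : Set (Heis n), IsCompact K →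
    MemLp u (ENNReal.ofReal (critExp n α + 1)) (volume.restrict K)
  integrable : ∀ ζ, Integrable (fun ξ => kernel α ζ ξ * u ξ ^ critExp n α)
  eq_integral : ∀ ζ, u ζ = ∫ ξ, kernel α ζ ξ * u ξ ^ critExp n α

/-- `u` is cylindrical: `u(z, t) = u(|z|, t)` depends on `z` only through `|z|`. -/
def IsCylindrical {n : ℕ} (u : Heis n → ℝ) : Prop :=
  ∃ f : ℝ → ℝ → ℝ, ∀ (z : Fin n → ℂ) (t : ℝ), u (z, t) = f (radius z) t

/-- The point `(s² z / ρ², s⁴ t / ρ⁴)`, where `ρ = |(z, t)|`. Its first component has length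
`s² |z| / ρ²`. -/
def sphereInv {n : ℕ} (s : ℝ) (ξ : Heis n) : Heis n :=
  (fun j => ((s ^ 2 / gauge ξ ^ 2 : ℝ) : ℂ) * ξ.1 j, s ^ 4 * ξ.2 / gauge ξ ^ 4)

end Heisenberg

end

/-! Write a nonzero point as the dilation by e^t of a point of gauge one. The inversion in the
sphere of radius s fixes the gauge-one point and becomes the reflection t ↦ 2 log s - t. With q = (Q
- α)/2, the claim is therefore that g = e^(qt) u is even in t about some c.

The Green kernel itself does not respect this reflection. However, |ζ⁻¹ξ|² is the modulus of B -
2⟨z, z'⟩ with B = |z|² + |z'|² + i(t' - t) (`gauge_mul_inv_sq`), and a cylindrical u is invariant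
under z ↦ cz with |c| = 1, so the kernel may be averaged over the circle. The average sees only |B|
and |⟨z, z'⟩|. In logarithmic coordinates it equals e^(-q(t+s)) times a kernel κ that is even and
strictly decreasing in |t - s| (`norm_baseTerm_dil`, `phaseAvg_lt`). Hence g = ∫ κ g^σ, an equation
invariant under translations and reflections in t (`isLogSolution`).

Moving planes then apply in integral form. A Hardy–Littlewood–Sobolev bound
(`lintegral_quadratic_form_le`) shows that the reflection of g at c is dominated by g above c as
soon as the relevant mass of g^(σ+1) below c is small; this holds near -∞ by local integrability of
u at the origin. Pushing c upwards, either g is symmetric about some c or g dominates all its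
reflections, and so is nondecreasing in t (`symmetric_or_reflect_le`). No continuity of u is used,
only the lower semicontinuity given by Fatou's lemma.

The monotone case is excluded unless g = 0. Monotonicity bounds the slices in L^σ
(`exists_slice_le`). The forward difference of g is a positive supersolution of the linearised
equation, which yields a stability inequality (`stability`). Testing it with g times a long cutoff
in t, and comparing with the equation itself, leaves (1 - 1/σ) ∫ g^(σ+1) over t < 0 bounded by a
cutoff error of order 1/N, so g vanishes (`eq_zero_of_monotone`). -/

open Set Filter
open scoped ENNReal Topology

/-! ### Layer-cake formulas and a diagonal Hardy–Littlewood–Sobolev inequality. -/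

/-- `∫₀ᴴ s^(r-1) ds = H^r / r` as a lower integral. -/
theorem lintegral_Ioo_rpow {r H : ℝ} (hr : 0 < r) (hH : 0 ≤ H) :
    ∫⁻ s in Ioo 0 H, ENNReal.ofReal (s ^ (r - 1)) = ENNReal.ofReal (H ^ r / r) := by
  have hi : IntervalIntegrable (fun s : ℝ => s ^ (r - 1)) volume 0 H :=
    intervalIntegral.intervalIntegrable_rpow' (by linarith)
  rw [intervalIntegrable_iff_integrableOn_Ioo_of_le hH] at hi
  rw [← ofReal_integral_eq_lintegral_ofReal hi, ← integral_Ioc_eq_integral_Ioo,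
    ← intervalIntegral.integral_of_le hH, integral_rpow (Or.inl (by linarith))]
  · simp [Real.zero_rpow hr.ne']
  · exact (ae_restrict_iff' measurableSet_Ioo).2 (.of_forall fun s hs => Real.rpow_nonneg hs.1.le _)

theorem lintegral_Ioo_indicator_lt {a : ℝ≥0∞} (ha : a ≠ ∞) {H : ℝ} :
    ∫⁻ s in Ioo 0 H, {s : ℝ | ENNReal.ofReal s < a}.indicator 1 s = min a (ENNReal.ofReal H) := by
  have hm : MeasurableSet {s : ℝ | ENNReal.ofReal s < a} :=
    measurableSet_lt ENNReal.measurable_ofReal measurable_const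
  rw [lintegral_indicator_one hm, Measure.restrict_apply hm]
  have : {s : ℝ | ENNReal.ofReal s < a} ∩ Ioo 0 H = Ioo 0 (min a.toReal H) := by
    ext s
    simp only [mem_inter_iff, mem_ofPred_eq, mem_Ioo, lt_min_iff]
    constructor
    · rintro ⟨h1, h2, h3⟩
      exact ⟨h2, (ENNReal.ofReal_lt_iff_lt_toReal h2.le ha).1 h1, h3⟩
    · rintro ⟨h2, h1, h3⟩
      exact ⟨(ENNReal.ofReal_lt_iff_lt_toReal h2.le ha).2 h1, h2, h3⟩
  rw [this, Real.volume_Ioo, sub_zero, ENNReal.ofReal_min, ENNReal.ofReal_toReal ha]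

section QuadraticForm

variable {X : Type*} [MeasurableSpace X] {m : Measure X} [SFinite m]

/-- Layer cake: min (h, H) is the integral over 0 < s < H of the indicator of {h > s}. Chebyshev
gives that set measure at most N s^(-p), with N the integral of h^p, so the weak-type bound
contributes s^(-pθ) = s^(p-2), integrable at 0 because p > 1. -/
theorem lintegral_kernel_mul_min_le {k : X → ℝ≥0∞} (hk : Measurable k) {θ p : ℝ} (hθ : 0 < θ)
    (hθ1 : θ < 1) (hp : p * (1 + θ) = 2) {C : ℝ≥0∞}
    (hball : ∀ B, MeasurableSet B → ∫⁻ y in B, k y ∂m ≤ C * m B ^ θ)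
    {h : X → ℝ≥0∞} (hh : Measurable h) (hfin : ∀ x, h x ≠ ∞) {H : ℝ} (hH : 0 ≤ H) :
    ∫⁻ y, k y * min (h y) (ENNReal.ofReal H) ∂m ≤
      C * (∫⁻ y, h y ^ p ∂m) ^ θ * ENNReal.ofReal (H ^ (p - 1) / (p - 1)) := by
  have hp0 : 1 < p := by nlinarith
  set N := ∫⁻ y, h y ^ p ∂m with hN
  have hmeas : Measurable fun q : X × ℝ =>
      k q.1 * {s : ℝ | ENNReal.ofReal s < h q.1}.indicator (1 : ℝ → ℝ≥0∞) q.2 := by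
    refine (hk.comp measurable_fst).mul ?_
    have : MeasurableSet {q : X × ℝ | ENNReal.ofReal q.2 < h q.1} :=
      measurableSet_lt (ENNReal.measurable_ofReal.comp measurable_snd) (hh.comp measurable_fst)
    exact (measurable_one.indicator this : Measurable
      ({q : X × ℝ | ENNReal.ofReal q.2 < h q.1}.indicator (1 : X × ℝ → ℝ≥0∞)))
  calc ∫⁻ y, k y * min (h y) (ENNReal.ofReal H) ∂m
      = ∫⁻ y, (∫⁻ s in Ioo 0 H, k y * {s : ℝ | ENNReal.ofReal s < h y}.indicator 1 s) ∂m := by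
        refine lintegral_congr fun y => ?_
        rw [lintegral_const_mul, lintegral_Ioo_indicator_lt (hfin y)]
        exact measurable_one.indicator
          (measurableSet_lt ENNReal.measurable_ofReal measurable_const)
    _ = ∫⁻ s in Ioo 0 H, ∫⁻ y, k y * {s : ℝ | ENNReal.ofReal s < h y}.indicator 1 s ∂m :=
        lintegral_lintegral_swap hmeas.aemeasurable
    _ ≤ ∫⁻ s in Ioo 0 H, C * N ^ θ * ENNReal.ofReal (s ^ ((p - 1) - 1)) := by
        refine setLIntegral_mono (by fun_prop) fun s hs => ?_
        have hs0 : ENNReal.ofReal s ≠ 0 := by simpa using hs.1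
        have hset : MeasurableSet {y | ENNReal.ofReal s < h y} := measurableSet_lt measurable_const hh
        have h1 : ∫⁻ y, k y * {s : ℝ | ENNReal.ofReal s < h y}.indicator 1 s ∂m =
            ∫⁻ y in {y | ENNReal.ofReal s < h y}, k y ∂m := by
          rw [← lintegral_indicator hset]
          refine lintegral_congr fun y => ?_
          by_cases hy : ENNReal.ofReal s < h y <;> simp [indicator, hy]
        have h2 : m {y | ENNReal.ofReal s < h y} ≤ N * (ENNReal.ofReal s ^ p)⁻¹ := by
          rw [← div_eq_mul_inv, ENNReal.le_div_iff_mul_le (Or.inl _) (Or.inl _), mul_comm]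
          · refine le_trans ?_ (mul_meas_ge_le_lintegral (hh.pow_const p) (ENNReal.ofReal s ^ p))
            gcongr
            intro hy
            exact ENNReal.rpow_le_rpow (le_of_lt hy) (by linarith)
          · simp [ENNReal.rpow_eq_zero_iff, hs0]
          · exact ENNReal.rpow_ne_top_of_nonneg (by linarith) ENNReal.ofReal_ne_top
        rw [h1, mul_assoc]
        refine (hball _ hset).trans ?_
        gcongr
        refine (ENNReal.rpow_le_rpow h2 hθ.le).trans_eq ?_
        rw [ENNReal.mul_rpow_of_nonneg _ _ hθ.le, ← ENNReal.rpow_neg, ← ENNReal.rpow_mul,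
          ENNReal.ofReal_rpow_of_pos hs.1]
        congr 3
        nlinarith
    _ = _ := by
        rw [lintegral_const_mul _ (by fun_prop), lintegral_Ioo_rpow (by linarith) hH]

/-- A Hardy–Littlewood–Sobolev inequality on the diagonal, for symmetric kernels of weak type. -/
theorem lintegral_quadratic_form_le {k : X → X → ℝ≥0∞} (hk : Measurable (Function.uncurry k))
    (hsymm : ∀ x y, k x y = k y x) {θ p : ℝ} (hθ : 0 < θ) (hθ1 : θ < 1) (hp : p * (1 + θ) = 2)
    {C : ℝ≥0∞} (hball : ∀ x B, MeasurableSet B → ∫⁻ y in B, k x y ∂m ≤ C * m B ^ θ)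
    {h : X → ℝ≥0∞} (hh : Measurable h) (hfin : ∀ x, h x ≠ ∞) :
    ∫⁻ x, ∫⁻ y, h x * (k x y * h y) ∂m ∂m ≤
      2 * (C * ENNReal.ofReal (1 / (p - 1))) * (∫⁻ x, h x ^ p ∂m) ^ (1 + θ) := by
  have hp0 : 1 < p := by nlinarith
  set N := ∫⁻ y, h y ^ p ∂m with hN
  have hm1 : Measurable fun z : X × X => h z.1 * (k z.1 z.2 * min (h z.2) (h z.1)) :=
    (hh.comp measurable_fst).mul
      (hk.mul ((hh.comp measurable_snd).min (hh.comp measurable_fst)))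
  -- Truncating at the height H = h x turns the factor h x * H^(p-1) into h x ^ p.
  have key : ∫⁻ x, ∫⁻ y, h x * (k x y * min (h y) (h x)) ∂m ∂m ≤
      C * ENNReal.ofReal (1 / (p - 1)) * N ^ (1 + θ) := by
    calc _ ≤ ∫⁻ x, C * ENNReal.ofReal (1 / (p - 1)) * N ^ θ * h x ^ p ∂m := by
          refine lintegral_mono fun x => ?_
          have hkx : Measurable (k x) := hk.of_uncurry_left
          rw [lintegral_const_mul _ (by fun_prop)]
          have := lintegral_kernel_mul_min_le hkx hθ hθ1 hp (hball x) hh hfin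
            (H := (h x).toReal) ENNReal.toReal_nonneg
          rw [ENNReal.ofReal_toReal (hfin x)] at this
          refine (mul_le_mul_right this _).trans_eq ?_
          rw [div_eq_mul_one_div, ENNReal.ofReal_mul (by positivity),
            ← ENNReal.ofReal_rpow_of_nonneg ENNReal.toReal_nonneg (by linarith),
            ENNReal.ofReal_toReal (hfin x)]
          have : h x ^ p = h x * h x ^ (p - 1) := by
            nth_rw 2 [← ENNReal.rpow_one (h x)]
            rw [← ENNReal.rpow_add_of_nonneg _ _ zero_le_one (by linarith)]
            congr 1; ring
          rw [this]; ring
      _ = _ := by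
          rw [lintegral_const_mul _ (by fun_prop), ← hN, mul_assoc]
          nth_rw 2 [← ENNReal.rpow_one N]
          rw [← ENNReal.rpow_add_of_nonneg _ _ hθ.le zero_le_one, add_comm]
  -- The smaller of h x and h y plays the role of the minimum. Symmetry of k makes both halves
  -- equal, whence the factor 2.
  calc ∫⁻ x, ∫⁻ y, h x * (k x y * h y) ∂m ∂m
      ≤ ∫⁻ x, ∫⁻ y, (h x * (k x y * min (h y) (h x)) + h y * (k y x * min (h x) (h y))) ∂m ∂m := by
        refine lintegral_mono fun x => lintegral_mono fun y => ?_
        rcases le_total (h y) (h x) with hxy | hxy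
        · rw [min_eq_left hxy]; exact le_self_add
        · rw [min_eq_left hxy, hsymm y x]
          refine le_trans (le_of_eq ?_) le_add_self
          ring
    _ = ∫⁻ x, ∫⁻ y, h x * (k x y * min (h y) (h x)) ∂m ∂m +
        ∫⁻ x, ∫⁻ y, h y * (k y x * min (h x) (h y)) ∂m ∂m := by
        rw [← lintegral_add_left hm1.lintegral_prod_right']
        exact lintegral_congr fun x => lintegral_add_left (hm1.comp measurable_prodMk_left) _
    _ = ∫⁻ x, ∫⁻ y, h x * (k x y * min (h y) (h x)) ∂m ∂m +
        ∫⁻ x, ∫⁻ y, h x * (k x y * min (h y) (h x)) ∂m ∂m := by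
        congr 1
        exact lintegral_lintegral_swap (hm1.comp measurable_swap).aemeasurable
    _ ≤ _ := by
        rw [← two_mul, mul_assoc 2]
        gcongr

end QuadraticForm

/-! ### Convexity and rearrangement inequalities with truncated subtraction. -/

theorem rpow_add_mul_sub_le_rpow {σ x y : ℝ} (hσ : 1 < σ) (hx : 0 ≤ x) (hy : 0 ≤ y) :
    x ^ σ + σ * x ^ (σ - 1) * (y - x) ≤ y ^ σ := by
  rcases hx.eq_or_lt with rfl | hx
  · rw [Real.zero_rpow (by linarith), Real.zero_rpow (by linarith)]
    simpa using Real.rpow_nonneg hy σ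
  -- The tangent line lies below the convex power: Bernoulli's inequality at y / x.
  have h := one_add_mul_self_le_rpow_one_add (s := y / x - 1) (p := σ)
    (by have := div_nonneg hy hx.le; linarith) hσ.le
  rw [add_sub_cancel, Real.div_rpow hy hx.le, le_div_iff₀ (Real.rpow_pos_of_pos hx _)] at h
  refine le_trans (le_of_eq ?_) h
  have : x ^ σ = x ^ (σ - 1) * x := by
    rw [← Real.rpow_add_one hx.ne']; congr 1; ring
  rw [this]
  field_simp

namespace ENNReal

theorem rpow_sub_rpow_le {σ : ℝ} (hσ : 1 < σ) {a b : ℝ≥0∞} (ha : a ≠ ∞) (hb : b ≠ ∞) :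
    a ^ σ - b ^ σ ≤ ENNReal.ofReal σ * (a ^ (σ - 1) * (a - b)) := by
  rcases le_total a b with hab | hab
  · rw [tsub_eq_zero_of_le (ENNReal.rpow_le_rpow hab (by linarith))]; exact zero_le
  obtain ⟨x, hx, rfl⟩ : ∃ x : ℝ, 0 ≤ x ∧ a = ENNReal.ofReal x :=
    ⟨a.toReal, ENNReal.toReal_nonneg, (ENNReal.ofReal_toReal ha).symm⟩
  obtain ⟨y, hy, rfl⟩ : ∃ y : ℝ, 0 ≤ y ∧ b = ENNReal.ofReal y :=
    ⟨b.toReal, ENNReal.toReal_nonneg, (ENNReal.ofReal_toReal hb).symm⟩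
  have hyx : y ≤ x := (ENNReal.ofReal_le_ofReal_iff hx).1 hab
  rw [tsub_le_iff_right, ENNReal.ofReal_rpow_of_nonneg hx (by linarith),
    ENNReal.ofReal_rpow_of_nonneg hy (by linarith),
    ENNReal.ofReal_rpow_of_nonneg hx (by linarith), ← ENNReal.ofReal_sub _ hy,
    ← ENNReal.ofReal_mul (by positivity), ← ENNReal.ofReal_mul (by linarith),
    ← ENNReal.ofReal_add (mul_nonneg (by linarith) (mul_nonneg (by positivity) (by linarith)))
      (by positivity)]
  refine ENNReal.ofReal_le_ofReal ?_
  have := rpow_add_mul_sub_le_rpow hσ hx hy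
  nlinarith

theorem mul_rpow_sub_le {σ : ℝ} (hσ : 1 < σ) {a b : ℝ≥0∞} (hab : a ≤ b) (hb : b ≠ ∞) :
    ENNReal.ofReal σ * (a ^ (σ - 1) * (b - a)) ≤ b ^ σ - a ^ σ := by
  have ha : a ≠ ∞ := (hab.trans_lt hb.lt_top).ne
  obtain ⟨x, hx, rfl⟩ : ∃ x : ℝ, 0 ≤ x ∧ a = ENNReal.ofReal x :=
    ⟨a.toReal, ENNReal.toReal_nonneg, (ENNReal.ofReal_toReal ha).symm⟩
  obtain ⟨y, hy, rfl⟩ : ∃ y : ℝ, 0 ≤ y ∧ b = ENNReal.ofReal y :=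
    ⟨b.toReal, ENNReal.toReal_nonneg, (ENNReal.ofReal_toReal hb).symm⟩
  rw [ENNReal.ofReal_rpow_of_nonneg hx (by linarith),
    ENNReal.ofReal_rpow_of_nonneg hy (by linarith),
    ENNReal.ofReal_rpow_of_nonneg hx (by linarith), ← ENNReal.ofReal_sub _ hx,
    ← ENNReal.ofReal_mul (by positivity), ← ENNReal.ofReal_mul (by linarith),
    ← ENNReal.ofReal_sub _ (by positivity)]
  refine ENNReal.ofReal_le_ofReal ?_
  have := rpow_add_mul_sub_le_rpow hσ hx hy
  nlinarith

/-- A rearrangement inequality with a defect. For b ≤ a the larger kernel should go with the larger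
value; otherwise the loss is (k - k')(b - a), at most k (b - a). -/
theorem mul_add_mul_le_of_le {k k' a b : ℝ≥0∞} (hk : k' ≤ k) :
    k' * a + k * b ≤ k * a + k' * b + k * (b - a) := by
  obtain ⟨d, rfl⟩ := exists_add_of_le hk
  rcases le_total b a with h | h
  · calc k' * a + (k' + d) * b = k' * a + k' * b + d * b := by ring
      _ ≤ k' * a + k' * b + d * a := by gcongr
      _ = (k' + d) * a + k' * b := by ring
      _ ≤ _ := le_self_add
  · calc k' * a + (k' + d) * b = k' * a + (k' + d) * (a + (b - a)) := by rw [add_tsub_cancel_of_le h]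
      _ = (k' + d) * a + k' * a + (k' + d) * (b - a) := by ring
      _ ≤ _ := by gcongr

theorem mul_add_mul_lt_of_lt {k k' a b : ℝ≥0∞} (hk : k' < k) (hk_top : k ≠ ∞) (hba : b < a)
    (ha : a ≠ ∞) : k' * a + k * b < k * a + k' * b := by
  have hk' : k' ≠ ∞ := hk.ne_top
  have hb : b ≠ ∞ := hba.ne_top
  lift k to NNReal using hk_top
  lift k' to NNReal using hk'
  lift a to NNReal using ha
  lift b to NNReal using hb
  norm_cast at *
  have h1 : (k' : ℝ) < k := hk
  have h2 : (b : ℝ) < a := hba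
  have : (k' * a + k * b : ℝ) < k * a + k' * b := by nlinarith
  exact_mod_cast this

end ENNReal

/-! ### Reflections, half spaces and the integral equation on S × ℝ. -/

namespace LogFrame

/-- Reflection of the real variable at `c`. -/
def reflect {S : Type*} (c : ℝ) (x : S × ℝ) : S × ℝ := (x.1, 2 * c - x.2)

theorem reflect_reflect {S : Type*} (c : ℝ) (x : S × ℝ) : reflect c (reflect c x) = x := by
  simp [reflect]

variable {S : Type*} [MeasurableSpace S]

/-- A kernel on `S × ℝ` which is translation invariant and even in the real variable, symmetric,
and strictly decreasing in the distance of the real variables. -/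
structure IsLogKernel (κ : S → S → ℝ → ℝ≥0∞) : Prop where
  measurable : Measurable fun p : S × S × ℝ => κ p.1 p.2.1 p.2.2
  symm : ∀ a b l, κ a b l = κ b a l
  even : ∀ a b l, κ a b (-l) = κ a b l
  strictAnti : ∀ a b l l', |l| < |l'| → κ a b l' < κ a b l

/-- The kernel between two points of `S × ℝ`. -/
def ker (κ : S → S → ℝ → ℝ≥0∞) (x y : S × ℝ) : ℝ≥0∞ := κ x.1 y.1 (x.2 - y.2)

/-- The half space `t > c`. -/
def upper (c : ℝ) : Set (S × ℝ) := {x | c < x.2}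

/-- Nonnegative solutions of `g = ∫ κ g ^ σ` on `S × ℝ`, in `L ^ (σ + 1)` near `-∞`. -/
structure IsLogSolution (ν : Measure S) (κ : S → S → ℝ → ℝ≥0∞) (σ : ℝ) (g : S × ℝ → ℝ≥0∞) :
    Prop where
  measurable : Measurable g
  ne_top : ∀ x, g x ≠ ∞
  lsc : ∀ a, LowerSemicontinuous fun t => g (a, t)
  eq_lintegral : ∀ x, g x = ∫⁻ y, ker κ x y * g y ^ σ ∂(ν.prod volume)
  local_ne_top : ∀ c : ℝ, ∫⁻ x in {x | x.2 < c}, g x ^ (σ + 1) ∂(ν.prod volume) ≠ ∞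

@[fun_prop]
theorem measurable_reflect (c : ℝ) : Measurable (reflect c : S × ℝ → S × ℝ) := by
  unfold reflect; fun_prop

theorem measurableSet_upper (c : ℝ) : MeasurableSet (upper c : Set (S × ℝ)) :=
  measurableSet_lt measurable_const measurable_snd

theorem measurableSet_lower (c : ℝ) : MeasurableSet {x : S × ℝ | x.2 < c} :=
  measurableSet_lt measurable_snd measurable_const

section

variable {κ : S → S → ℝ → ℝ≥0∞}

theorem measurable_uncurry_ker (hκ : IsLogKernel κ) : Measurable (Function.uncurry (ker κ)) := by
  have : Measurable fun z : (S × ℝ) × (S × ℝ) => (z.1.1, z.2.1, z.1.2 - z.2.2) := by fun_prop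
  exact hκ.measurable.comp this

theorem measurable_ker (hκ : IsLogKernel κ) (x : S × ℝ) : Measurable (ker κ x) :=
  (measurable_uncurry_ker hκ).of_uncurry_left

theorem ker_comm (hκ : IsLogKernel κ) (x y : S × ℝ) : ker κ x y = ker κ y x := by
  unfold ker
  rw [hκ.symm, ← hκ.even, neg_sub]

theorem ker_reflect (hκ : IsLogKernel κ) (c : ℝ) (x y : S × ℝ) :
    ker κ (reflect c x) (reflect c y) = ker κ x y := by
  unfold ker reflect
  rw [← hκ.even]; congr 1; simp

theorem ker_reflect_left (hκ : IsLogKernel κ) (c : ℝ) (x y : S × ℝ) :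
    ker κ (reflect c x) y = ker κ x (reflect c y) := by
  rw [← ker_reflect hκ c x, reflect_reflect]

theorem ker_reflect_lt (hκ : IsLogKernel κ) {c : ℝ} {x y : S × ℝ} (hx : x ∈ upper c)
    (hy : y ∈ upper c) : ker κ x (reflect c y) < ker κ x y := by
  refine hκ.strictAnti _ _ _ _ ?_
  have hx : c < x.2 := hx
  have hy : c < y.2 := hy
  simp only [reflect]
  -- The two squares differ by 4 (x.2 - c)(y.2 - c) > 0.
  rw [← sq_lt_sq]
  nlinarith

theorem ker_pos (hκ : IsLogKernel κ) (x y : S × ℝ) : 0 < ker κ x y := by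
  refine (zero_le).trans_lt (hκ.strictAnti x.1 y.1 (x.2 - y.2) (|x.2 - y.2| + 1) ?_)
  rw [abs_of_nonneg (a := |x.2 - y.2| + 1) (by positivity)]; linarith

theorem ker_ne_top (hκ : IsLogKernel κ) {x y : S × ℝ} (h : x.2 ≠ y.2) : ker κ x y ≠ ∞ := by
  refine (hκ.strictAnti x.1 y.1 0 (x.2 - y.2) ?_).ne_top
  simpa [sub_eq_zero] using h

end

variable {ν : Measure S}

theorem ae_snd_ne (c : ℝ) : ∀ᵐ x ∂(ν.prod (volume : Measure ℝ)), x.2 ≠ c := by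
  have : (ν.prod (volume : Measure ℝ)) (univ ×ˢ {c}) = 0 := by
    rw [Measure.prod_prod]; simp
  rw [ae_iff]
  refine measure_mono_null (fun x hx => ?_) this
  simpa using hx

variable [SFinite ν]

theorem measurePreserving_reflect (c : ℝ) :
    MeasurePreserving (reflect c) (ν.prod volume) (ν.prod (volume : Measure ℝ)) :=
  (MeasurePreserving.id ν).prod (Measure.measurePreserving_sub_left volume (2 * c))

theorem setLIntegral_upper_comp_reflect (c : ℝ) {F : S × ℝ → ℝ≥0∞} (hF : Measurable F) :
    ∫⁻ x in upper c, F (reflect c x) ∂(ν.prod volume) = ∫⁻ x in {x | x.2 < c}, F x ∂(ν.prod volume) := by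
  rw [← (measurePreserving_reflect (ν := ν) c).setLIntegral_comp_preimage (measurableSet_lower c) hF]
  congr 2
  ext x
  simp only [upper, reflect, mem_preimage, mem_ofPred_eq]
  constructor <;> intro h <;> linarith

theorem lintegral_eq_setLIntegral_upper (c : ℝ) {F : S × ℝ → ℝ≥0∞} (hF : Measurable F) :
    ∫⁻ x, F x ∂(ν.prod volume) = ∫⁻ x in upper c, (F x + F (reflect c x)) ∂(ν.prod volume) := by
  rw [lintegral_add_left hF, setLIntegral_upper_comp_reflect c hF,
    ← lintegral_add_compl F (measurableSet_upper c)]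
  congr 1
  refine setLIntegral_congr ?_
  filter_upwards [ae_snd_ne (ν := ν) c] with x hx
  refine propext ?_
  change ¬ (c < x.2) ↔ x.2 < c
  rw [not_lt]
  exact ⟨fun h => lt_of_le_of_ne h hx, le_of_lt⟩

variable {κ : S → S → ℝ → ℝ≥0∞} {σ : ℝ} {g : S × ℝ → ℝ≥0∞}

theorem IsLogSolution.eq_upper (hκ : IsLogKernel κ) (hg : IsLogSolution ν κ σ g) (c : ℝ)
    (x : S × ℝ) : g x = ∫⁻ y in upper c, (ker κ x y * g y ^ σ +
      ker κ x (reflect c y) * g (reflect c y) ^ σ) ∂(ν.prod volume) := by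
  rw [hg.eq_lintegral]
  exact lintegral_eq_setLIntegral_upper c ((measurable_ker hκ x).mul (hg.measurable.pow_const σ))

theorem IsLogSolution.reflect_eq_upper (hκ : IsLogKernel κ) (hg : IsLogSolution ν κ σ g) (c : ℝ)
    (x : S × ℝ) : g (reflect c x) = ∫⁻ y in upper c, (ker κ x (reflect c y) * g y ^ σ +
      ker κ x y * g (reflect c y) ^ σ) ∂(ν.prod volume) := by
  rw [hg.eq_upper hκ c]
  simp only [ker_reflect hκ, ker_reflect_left hκ]

/-- Fold both integrals onto the half space: g x and g (reflect c x) then differ only by exchanging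
the two kernel values, and the rearrangement inequality applies pointwise. The truncated differences
keep only the points where domination fails. -/
theorem IsLogSolution.reflect_sub_le (hκ : IsLogKernel κ) (hg : IsLogSolution ν κ σ g) {c : ℝ}
    {x : S × ℝ} (hx : x ∈ upper c) : g (reflect c x) - g x ≤
      ∫⁻ y in upper c, ker κ x y * (g (reflect c y) ^ σ - g y ^ σ) ∂(ν.prod volume) := by
  have hr : Measurable fun y => g (reflect c y) := hg.measurable.comp (measurable_reflect c)
  have hkr : Measurable fun y => ker κ x (reflect c y) :=
    (measurable_ker hκ x).comp (measurable_reflect c)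
  have hgm := hg.measurable
  have hkm := measurable_ker hκ x
  rw [tsub_le_iff_left, hg.reflect_eq_upper hκ c x, hg.eq_upper hκ c x,
    ← lintegral_add_left (by fun_prop)]
  exact setLIntegral_mono' (measurableSet_upper c) fun y hy =>
    ENNReal.mul_add_mul_le_of_le (ker_reflect_lt hκ hx hy).le

-- Strong maximum principle: since the kernel is positive, a single zero of g forces g ^ σ = 0
-- almost everywhere, and the equation then gives g = 0 at every point.
omit [SFinite ν] in
theorem IsLogSolution.eq_zero_or_pos (hκ : IsLogKernel κ) (hg : IsLogSolution ν κ σ g) :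
    (∀ x, g x = 0) ∨ ∀ x, 0 < g x := by
  by_cases h : ∀ x, 0 < g x
  · exact Or.inr h
  left
  push Not at h
  obtain ⟨x, hx⟩ := h
  have hgm := hg.measurable
  have hkm := measurable_ker hκ x
  rw [nonpos_iff_eq_zero, hg.eq_lintegral, lintegral_eq_zero_iff (by fun_prop)] at hx
  intro z
  have hkz := measurable_ker hκ z
  rw [hg.eq_lintegral, lintegral_eq_zero_iff (by fun_prop)]
  filter_upwards [hx] with y hy
  have : g y ^ σ = 0 := by simpa [(ker_pos hκ x y).ne'] using hy
  simp [this]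

end LogFrame

/-! ### The moving plane method in integral form. -/

namespace LogFrame

variable {S : Type*} [MeasurableSpace S]

/-- The Hardy–Littlewood–Sobolev inequality for the quadratic form of `κ`. -/
def HasFormBound (ν : Measure S) (κ : S → S → ℝ → ℝ≥0∞) (θ : ℝ) (C : ℝ≥0∞) : Prop :=
  ∀ h : S × ℝ → ℝ≥0∞, Measurable h → (∀ x, h x ≠ ∞) →
    ∫⁻ x, ∫⁻ y, h x * (ker κ x y * h y) ∂(ν.prod volume) ∂(ν.prod volume) ≤
      C * (∫⁻ x, h x ^ (2 / (1 + θ)) ∂(ν.prod volume)) ^ (1 + θ)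

variable {ν : Measure S} [SFinite ν] {κ : S → S → ℝ → ℝ≥0∞} {θ σ : ℝ} {g : S × ℝ → ℝ≥0∞}

/-- Hölder with weights θ/(1+θ) and 1/(1+θ) between V^(σ+1) and V^(σ-1) w². The powers of V match
exactly because θ(σ+1) = σ-1. Restricting the first factor to {w ≠ 0} is what makes it small in the
application. -/
theorem lintegral_rpow_mul_le {X : Type*} [MeasurableSpace X] {m : Measure X} {V w : X → ℝ≥0∞}
    (hV : Measurable V) (hw : Measurable w) (hθ : 0 < θ) (hθ1 : θ < 1)
    (hσ : σ * (1 - θ) = 1 + θ) :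
    (∫⁻ x, (V x ^ (σ - 1) * w x) ^ (2 / (1 + θ)) ∂m) ^ (1 + θ) ≤
      (∫⁻ x in {x | w x ≠ 0}, V x ^ (σ + 1) ∂m) ^ θ * ∫⁻ x, V x ^ (σ - 1) * w x ^ (2 : ℝ) ∂m := by
  have hσ1 : 1 < σ := by nlinarith
  have hset : MeasurableSet {x | w x ≠ 0} := hw (measurableSet_singleton 0).compl
  set a : ℝ := θ / (1 + θ) with ha
  set b : ℝ := 1 / (1 + θ) with hb
  have hab : a + b = 1 := by rw [ha, hb]; field_simp; ring
  have ha0 : 0 < a := by positivity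
  have hb0 : 0 < b := by positivity
  have key := ENNReal.lintegral_mul_norm_pow_le (μ := m)
    (f := {x | w x ≠ 0}.indicator fun x => V x ^ (σ + 1))
    (g := fun x => V x ^ (σ - 1) * w x ^ (2 : ℝ))
    ((hV.pow_const _).indicator hset).aemeasurable
    ((hV.pow_const _).mul (hw.pow_const _)).aemeasurable ha0.le hb0.le hab
  rw [lintegral_indicator hset] at key
  have heq : ∀ x, (V x ^ (σ - 1) * w x) ^ (2 / (1 + θ)) =
      ({x | w x ≠ 0}.indicator (fun x => V x ^ (σ + 1)) x) ^ a *
        (V x ^ (σ - 1) * w x ^ (2 : ℝ)) ^ b := by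
    intro x
    by_cases hx : w x = 0
    · simp [hx, ENNReal.zero_rpow_of_pos, ha0, show 0 < 2 / (1 + θ) by positivity]
    rw [indicator_of_mem (show x ∈ {x | w x ≠ 0} from hx),
      ENNReal.mul_rpow_of_nonneg _ _ hb0.le, ENNReal.mul_rpow_of_nonneg _ _ (by positivity),
      ← ENNReal.rpow_mul, ← ENNReal.rpow_mul, ← ENNReal.rpow_mul, ← ENNReal.rpow_mul, ← mul_assoc,
      ← ENNReal.rpow_add_of_nonneg _ _ (by nlinarith) (by nlinarith)]
    congr 2
    · rw [ha, hb]; field_simp; nlinarith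
    · rw [hb]; field_simp
  simp_rw [heq]
  refine (ENNReal.rpow_le_rpow key (by positivity)).trans_eq ?_
  rw [ENNReal.mul_rpow_of_nonneg _ _ (by positivity), ← ENNReal.rpow_mul, ← ENNReal.rpow_mul]
  congr 2
  · rw [ha]; field_simp
  · rw [hb]; field_simp; simp

/-- If the reflected solution has little mass where it exceeds the solution, then it does not
exceed it at all. -/
theorem exists_reflect_le_of_setLIntegral_lt (hκ : IsLogKernel κ) (hg : IsLogSolution ν κ σ g)
    (hθ : 0 < θ) (hθ1 : θ < 1) (hσ : σ * (1 - θ) = 1 + θ) {C : ℝ≥0∞} (hC : C ≠ ∞)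
    (hform : HasFormBound ν κ θ C) : ∃ ε : ℝ≥0∞, 0 < ε ∧ ∀ c : ℝ,
      ∫⁻ x in {x | x.2 < c ∧ g (reflect c x) < g x}, g x ^ (σ + 1) ∂(ν.prod volume) < ε →
      ∀ x ∈ upper c, g (reflect c x) ≤ g x := by
  have hσ1 : 1 < σ := by nlinarith
  have hgm := hg.measurable
  -- This ε makes the factor in front of J in `hJle` less than one, so that J can be absorbed.
  obtain ⟨ε, hε, hε1⟩ : ∃ ε : ℝ≥0∞, 0 < ε ∧ ENNReal.ofReal σ * C * ε ^ θ < 1 := by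
    have ht : Tendsto (fun ε : ℝ≥0∞ => ENNReal.ofReal σ * C * ε ^ θ) (𝓝[>] 0) (𝓝 0) := by
      have h1 : Tendsto (fun ε : ℝ≥0∞ => ε ^ θ) (𝓝 0) (𝓝 0) := by
        have := (ENNReal.continuous_rpow_const (y := θ)).tendsto 0
        rwa [ENNReal.zero_rpow_of_pos hθ] at this
      have := ENNReal.Tendsto.const_mul (a := ENNReal.ofReal σ * C) h1
        (Or.inr (ENNReal.mul_ne_top ENNReal.ofReal_ne_top hC))
      rw [mul_zero] at this
      exact this.mono_left nhdsWithin_le_nhds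
    obtain ⟨ε, h1, h2⟩ := ((ht.eventually (gt_mem_nhds zero_lt_one)).and self_mem_nhdsWithin).exists
    exact ⟨ε, h2, h1⟩
  refine ⟨ε, hε, fun c hc => ?_⟩
  have hr : Measurable fun x => g (reflect c x) := hgm.comp (measurable_reflect c)
  set V : S × ℝ → ℝ≥0∞ := fun x => g (reflect c x) with hV
  set w : S × ℝ → ℝ≥0∞ := (upper c).indicator fun x => V x - g x with hw
  have hwm : Measurable w := (hr.sub hgm).indicator (measurableSet_upper c)
  have hwV : ∀ x, w x ≤ V x := fun x => indicator_apply_le' (fun _ => tsub_le_self) fun _ => zero_le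
  have hVtop : ∀ x, V x ≠ ∞ := fun x => hg.ne_top _
  have hwtop : ∀ x, w x ≠ ∞ := fun x => ((hwV x).trans_lt (hVtop x).lt_top).ne
  set h : S × ℝ → ℝ≥0∞ := fun x => V x ^ (σ - 1) * w x with hh
  have hhm : Measurable h := (hr.pow_const _).mul hwm
  have hkm := measurable_uncurry_ker hκ
  -- the pointwise inequality
  have hwle : ∀ x, w x ≤ ENNReal.ofReal σ * ∫⁻ y, ker κ x y * h y ∂(ν.prod volume) := by
    intro x
    refine indicator_apply_le' (fun hx => ?_) fun _ => zero_le
    refine (hg.reflect_sub_le hκ hx).trans ?_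
    have hkx := measurable_ker hκ x
    rw [← lintegral_const_mul _ (by fun_prop), ← lintegral_indicator (measurableSet_upper c)]
    refine lintegral_mono fun y => indicator_apply_le' (fun hy => ?_) fun _ => zero_le
    have : w y = V y - g y := indicator_of_mem hy _
    calc ker κ x y * (V y ^ σ - g y ^ σ)
        ≤ ker κ x y * (ENNReal.ofReal σ * (V y ^ (σ - 1) * (V y - g y))) := by
          gcongr
          exact ENNReal.rpow_sub_rpow_le hσ1 (hVtop y) (hg.ne_top y)
      _ = _ := by simp only [hh, this]; ring
  set J := ∫⁻ x, V x ^ (σ - 1) * w x ^ (2 : ℝ) ∂(ν.prod volume) with hJ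
  set M := ∫⁻ x in {x | w x ≠ 0}, V x ^ (σ + 1) ∂(ν.prod volume) with hM
  have hsetw : MeasurableSet {x | w x ≠ 0} := hwm (measurableSet_singleton 0).compl
  have hMeq : M = ∫⁻ x in {x | x.2 < c ∧ g (reflect c x) < g x}, g x ^ (σ + 1) ∂(ν.prod volume) := by
    have hs : MeasurableSet {x : S × ℝ | x.2 < c ∧ g (reflect c x) < g x} :=
      (measurableSet_lower c).inter (measurableSet_lt hr hgm)
    rw [← (measurePreserving_reflect (ν := ν) c).setLIntegral_comp_preimage hs (hgm.pow_const _), hM]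
    congr 2
    ext x
    simp only [mem_ofPred_eq, mem_preimage, reflect_reflect, hw, indicator_apply_ne_zero, mem_inter_iff,
      Function.mem_support, ne_eq, tsub_eq_zero_iff_le, not_le]
    refine and_congr ?_ Iff.rfl
    simp only [upper, reflect, mem_ofPred_eq]
    constructor <;> intro h <;> linarith
  have hJle : J ≤ ENNReal.ofReal σ * C * M ^ θ * J := by
    calc J ≤ ∫⁻ x, ENNReal.ofReal σ * ∫⁻ y, h x * (ker κ x y * h y) ∂(ν.prod volume)
          ∂(ν.prod volume) := by
          refine lintegral_mono fun x => ?_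
          have hkx := measurable_ker hκ x
          rw [lintegral_const_mul _ (by fun_prop)]
          calc V x ^ (σ - 1) * w x ^ (2 : ℝ) = h x * w x := by
                rw [ENNReal.rpow_two, hh]; ring
            _ ≤ h x * (ENNReal.ofReal σ * ∫⁻ y, ker κ x y * h y ∂(ν.prod volume)) := by
                gcongr; exact hwle x
            _ = _ := by ring
      _ = ENNReal.ofReal σ * ∫⁻ x, ∫⁻ y, h x * (ker κ x y * h y) ∂(ν.prod volume)
          ∂(ν.prod volume) := by
          refine lintegral_const_mul' _ _ ENNReal.ofReal_ne_top
      _ ≤ ENNReal.ofReal σ * (C * (M ^ θ * J)) := by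
          gcongr
          refine (hform h hhm fun x => ENNReal.mul_ne_top
            (ENNReal.rpow_ne_top_of_nonneg (by linarith) (hVtop x)) (hwtop x)).trans ?_
          gcongr
          exact lintegral_rpow_mul_le hr hwm hθ hθ1 hσ
      _ = _ := by ring
  -- Absorption needs J finite. As w ≤ V, its integrand is at most V^(σ+1), which reflects to the
  -- mass of g^(σ+1) below c.
  have hJtop : J ≠ ∞ := by
    refine ((?_ : J ≤ ∫⁻ x in {x | x.2 < c}, g x ^ (σ + 1) ∂(ν.prod volume)).trans_lt
      (hg.local_ne_top c).lt_top).ne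
    rw [← setLIntegral_upper_comp_reflect c (hgm.pow_const _),
      ← lintegral_indicator (measurableSet_upper c)]
    refine lintegral_mono fun x => ?_
    by_cases hx : x ∈ upper c
    · rw [indicator_of_mem hx]
      calc V x ^ (σ - 1) * w x ^ (2 : ℝ) ≤ V x ^ (σ - 1) * V x ^ (2 : ℝ) := by gcongr; exact hwV x
        _ = V x ^ (σ + 1) := by
          rw [← ENNReal.rpow_add_of_nonneg _ _ (by linarith) (by norm_num)]; congr 1; ring
    · simp [hw, hx]
  have hJ0 : J = 0 := by
    by_contra hne
    have hlt : ENNReal.ofReal σ * C * M ^ θ < 1 := by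
      refine lt_of_le_of_lt ?_ hε1
      gcongr
      rw [hMeq]; exact hc.le
    have := ENNReal.mul_lt_mul_left hne hJtop hlt
    rw [one_mul] at this
    exact absurd hJle (not_le.2 this)
  have hh0 : ∀ᵐ y ∂(ν.prod volume), h y = 0 := by
    rw [hJ, lintegral_eq_zero_iff (by fun_prop)] at hJ0
    filter_upwards [hJ0] with y hy
    rcases mul_eq_zero.1 hy with h0 | h0
    · simp [hh, h0]
    · simp [hh, (ENNReal.rpow_eq_zero_iff_of_pos two_pos).1 h0]
  intro x hx
  -- The density h vanishes only almost everywhere, but the pointwise bound on w holds at every x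
  -- and gives w x = 0.
  have h1 := hwle x
  rw [lintegral_congr_ae (g := fun _ => 0) (by filter_upwards [hh0] with y hy; simp [hy])] at h1
  simp only [lintegral_zero, mul_zero, nonpos_iff_eq_zero] at h1
  rw [hw, indicator_of_mem hx] at h1
  exact tsub_eq_zero_iff_le.1 h1

end LogFrame

namespace LogFrame

variable {S : Type*} [MeasurableSpace S]
variable {ν : Measure S} [SFinite ν] {κ : S → S → ℝ → ℝ≥0∞} {θ σ : ℝ} {g : S × ℝ → ℝ≥0∞}

/-- Equality at one point would make the rearrangement inequality an equality almost everywhere. The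
kernel comparison is strict, so g would agree with its reflection almost everywhere on the half
space, and then everywhere through the equation. -/
theorem IsLogSolution.reflect_lt (hκ : IsLogKernel κ) (hσ : 0 < σ) (hg : IsLogSolution ν κ σ g)
    {c : ℝ} (hc : ∀ x ∈ upper c, g (reflect c x) ≤ g x) (hne : ¬ ∀ x, g (reflect c x) = g x) :
    ∀ x ∈ upper c, g (reflect c x) < g x := by
  intro x hx
  have hgm := hg.measurable
  have hkx := measurable_ker hκ x
  rw [hg.reflect_eq_upper hκ, hg.eq_upper hκ c x]
  refine lintegral_strict_mono_of_ae_le_of_frequently_ae_lt (by fun_prop) ?_ ?_ ?_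
  · rw [← hg.reflect_eq_upper hκ]; exact hg.ne_top _
  · refine (ae_restrict_iff' (measurableSet_upper c)).2 (.of_forall fun y hy => ?_)
    have := ENNReal.mul_add_mul_le_of_le (a := g y ^ σ) (b := g (reflect c y) ^ σ)
      (ker_reflect_lt hκ hx hy).le
    rwa [tsub_eq_zero_of_le (ENNReal.rpow_le_rpow (hc y hy) hσ.le), mul_zero, add_zero] at this
  · intro hall
    refine hne fun z => ?_
    rw [hg.reflect_eq_upper hκ, hg.eq_upper hκ c z]
    refine lintegral_congr_ae ?_
    filter_upwards [hall, ae_restrict_mem (measurableSet_upper c),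
      ae_restrict_of_ae (ae_snd_ne (ν := ν) x.2)] with y hy hyc hyx
    suffices h : g (reflect c y) = g y by rw [h, add_comm]
    by_contra hlt
    have hlt : g (reflect c y) < g y := lt_of_le_of_ne (hc y hyc) hlt
    refine hy fun heq => ?_
    -- Strictness needs a finite kernel, which is why the null slice at height x.2 was removed.
    have := ENNReal.mul_add_mul_lt_of_lt (ker_reflect_lt hκ hx hyc) (ker_ne_top hκ hyx.symm)
      (ENNReal.rpow_lt_rpow hlt hσ) (ENNReal.rpow_ne_top_of_nonneg hσ.le (hg.ne_top y))
    exact absurd heq this.ne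

omit [SFinite ν] in
theorem IsLogSolution.tendsto_setLIntegral_atBot (hg : IsLogSolution ν κ σ g) :
    Tendsto (fun c : ℝ => ∫⁻ x in {x | x.2 < c}, g x ^ (σ + 1) ∂(ν.prod volume)) atBot (𝓝 0) := by
  have hgm := hg.measurable
  simp_rw [← lintegral_indicator (measurableSet_lower _)]
  rw [← lintegral_zero (μ := ν.prod (volume : Measure ℝ))]
  refine tendsto_lintegral_filter_of_dominated_convergence
    ({x | x.2 < 0}.indicator fun x => g x ^ (σ + 1)) ?_ ?_ ?_ ?_
  · exact .of_forall fun c => (hgm.pow_const _).indicator (measurableSet_lower c)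
  · filter_upwards [eventually_le_atBot (0 : ℝ)] with c hc
    refine .of_forall fun x => indicator_le_indicator_of_subset ?_ (fun _ => zero_le) x
    exact fun y (hy : y.2 < c) => hy.trans_le hc
  · rw [lintegral_indicator (measurableSet_lower _)]; exact hg.local_ne_top 0
  · refine .of_forall fun x => tendsto_const_nhds.congr' ?_
    filter_upwards [eventually_le_atBot x.2] with c hc
    rw [indicator_of_notMem]
    exact fun h : x.2 < c => absurd hc (not_le.2 h)

-- Dominated convergence lets the plane move a little beyond a strict position: for almost every x
-- the indicator of the bad set vanishes once c' is close to c.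
omit [SFinite ν] in
theorem IsLogSolution.tendsto_setLIntegral_nhdsGT (hg : IsLogSolution ν κ σ g) {c : ℝ}
    (hc : ∀ x ∈ upper c, g (reflect c x) < g x) :
    Tendsto (fun c' : ℝ => ∫⁻ x in {x | x.2 < c' ∧ g (reflect c' x) < g x}, g x ^ (σ + 1)
      ∂(ν.prod volume)) (𝓝[>] c) (𝓝 0) := by
  have hgm := hg.measurable
  have hs : ∀ c', MeasurableSet {x : S × ℝ | x.2 < c' ∧ g (reflect c' x) < g x} := fun c' =>
    (measurableSet_lower c').inter
      (measurableSet_lt (hgm.comp (measurable_reflect c')) hgm)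
  simp_rw [← lintegral_indicator (hs _)]
  rw [← lintegral_zero (μ := ν.prod (volume : Measure ℝ))]
  refine tendsto_lintegral_filter_of_dominated_convergence
    ({x | x.2 < c + 1}.indicator fun x => g x ^ (σ + 1)) ?_ ?_ ?_ ?_
  · exact .of_forall fun c' => (hgm.pow_const _).indicator (hs c')
  · filter_upwards [Ioo_mem_nhdsGT (show c < c + 1 by linarith)] with c' hc'
    refine .of_forall fun x => indicator_le_indicator_of_subset ?_ (fun _ => zero_le) x
    exact fun y hy => hy.1.trans hc'.2
  · rw [lintegral_indicator (measurableSet_lower _)]; exact hg.local_ne_top _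
  · filter_upwards [ae_snd_ne (ν := ν) c] with x hx
    refine tendsto_const_nhds.congr' ?_
    rcases lt_or_gt_of_ne hx with hlt | hgt
    · have h1 : g x < g (x.1, 2 * c - x.2) := by
        have := hc (reflect c x) (by simp only [upper, reflect, mem_ofPred_eq]; linarith)
        rwa [reflect_reflect] at this
      -- Lower semicontinuity in t alone preserves the strict inequality when c is perturbed.
      have h2 := hg.lsc x.1 (2 * c - x.2) _ h1
      have h3 : Tendsto (fun c' : ℝ => 2 * c' - x.2) (𝓝[>] c) (𝓝 (2 * c - x.2)) :=
        ((continuous_const.mul continuous_id).sub continuous_const).continuousAt.tendsto.mono_left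
          nhdsWithin_le_nhds
      filter_upwards [h3.eventually h2] with c' hc'
      rw [indicator_of_notMem]
      exact fun h => absurd (h.2.trans hc') (lt_irrefl _)
    · filter_upwards [Ioo_mem_nhdsGT hgt] with c' hc'
      rw [indicator_of_notMem]
      exact fun h => absurd (h.1.trans hc'.2) (lt_irrefl _)

/-- The moving plane alternative: a solution is symmetric, or it dominates all its reflections. -/
theorem IsLogSolution.symmetric_or_reflect_le (hκ : IsLogKernel κ) (hg : IsLogSolution ν κ σ g)
    (hθ : 0 < θ) (hθ1 : θ < 1) (hσ : σ * (1 - θ) = 1 + θ) {C : ℝ≥0∞} (hC : C ≠ ∞)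
    (hform : HasFormBound ν κ θ C) :
    (∃ c : ℝ, ∀ x, g (reflect c x) = g x) ∨ ∀ c : ℝ, ∀ x ∈ upper c, g (reflect c x) ≤ g x := by
  have hσ1 : 1 < σ := by nlinarith
  obtain ⟨ε, hε, hsmall⟩ := exists_reflect_le_of_setLIntegral_lt hκ hg hθ hθ1 hσ hC hform
  rw [or_iff_not_imp_left]
  intro hns
  push Not at hns
  by_contra hall
  push Not at hall
  obtain ⟨c₁, x₁, hx₁, hlt₁⟩ := hall
  set P : ℝ → Prop := fun c => ∀ x ∈ upper c, g (reflect c x) ≤ g x with hP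
  -- Requiring `P` at every c' ≤ c makes A an initial segment, so all planes below its supremum are
  -- good.
  set A : Set ℝ := {c | ∀ c' ≤ c, P c'} with hA
  have hAbdd : BddAbove A := ⟨c₁, fun c hc => by
    by_contra h
    exact absurd (hc c₁ (not_le.1 h).le x₁ hx₁) (not_le.2 hlt₁)⟩
  have hAne : A.Nonempty := by
    obtain ⟨c₀, hc₀⟩ := eventually_atBot.1
      (hg.tendsto_setLIntegral_atBot.eventually (gt_mem_nhds hε))
    refine ⟨c₀, fun c hc => hsmall c (lt_of_le_of_lt ?_ (hc₀ c hc))⟩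
    exact lintegral_mono_set fun x hx => hx.1
  set c := sSup A with hcdef
  have hlow : ∀ c' < c, P c' := fun c' hc' => by
    obtain ⟨b, hb, hcb⟩ := exists_lt_of_lt_csSup hAne hc'
    exact hb c' hcb.le
  -- A failure at c would persist for c' slightly below c by lower semicontinuity.
  have hPc : P c := by
    intro x hx
    by_contra h
    have h2 := hg.lsc x.1 (2 * c - x.2) _ (not_le.1 h)
    have h3 : Tendsto (fun c' : ℝ => 2 * c' - x.2) (𝓝[<] c) (𝓝 (2 * c - x.2)) :=
      ((continuous_const.mul continuous_id).sub continuous_const).continuousAt.tendsto.mono_left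
        nhdsWithin_le_nhds
    obtain ⟨c', hc', hlt⟩ := ((h3.eventually h2).and self_mem_nhdsWithin).exists
    exact absurd (hlow c' hlt x (lt_trans hlt hx)) (not_le.2 hc')
  have hstrict := hg.reflect_lt hκ (by linarith) hPc fun h => by
    obtain ⟨x, hx⟩ := hns c
    exact hx (h x)
  have hev := (hg.tendsto_setLIntegral_nhdsGT hstrict).eventually (gt_mem_nhds hε)
  obtain ⟨d, hd, hdc⟩ := (mem_nhdsGT_iff_exists_Ioo_subset).1 hev
  have hdc' : c < d := hd
  -- Without symmetry the domination at c is strict, so the smallness criterion covers planes beyond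
  -- c, contradicting the choice of c.
  have : (c + d) / 2 ∈ A := by
    intro c' hc'
    rcases lt_trichotomy c' c with h | h | h
    · exact hlow c' h
    · rw [h]; exact hPc
    · exact hsmall c' (hdc ⟨h, by linarith⟩)
  have := le_csSup hAbdd this
  linarith

end LogFrame

/-! ### Powers of a linear cutoff. -/

theorem ENNReal.two_mul_le_sq_add_sq (a b : ℝ≥0∞) : 2 * (a * b) ≤ a * a + b * b := by
  rcases le_total a b with h | h
  · obtain ⟨d, rfl⟩ := exists_add_of_le h
    calc 2 * (a * (a + d)) ≤ 2 * (a * (a + d)) + d * d := le_self_add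
      _ = _ := by ring
  · obtain ⟨d, rfl⟩ := exists_add_of_le h
    calc 2 * ((b + d) * b) ≤ 2 * ((b + d) * b) + d * d := le_self_add
      _ = _ := by ring

/-- If a - b ≤ δa, Bernoulli gives a^m - b^m ≤ mδ a^m, which goes into the ε term; otherwise a ≤ d/δ
and a^(2m) is bounded directly. The point is the high power d^(2m), which will offset the
singularity of the kernel on the diagonal. -/
theorem sq_pow_sub_pow_le_of_le {a b d δ ε : ℝ} {m : ℕ} (hb : 0 ≤ b) (hba : b ≤ a)
    (hd : a - b ≤ d) (hδ : 0 < δ) (hδ1 : δ ≤ 1) (hε : (m * δ) ^ 2 ≤ ε) :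
    (a ^ m - b ^ m) ^ 2 ≤ ε * ((a ^ m) ^ 2 + (b ^ m) ^ 2) + (d / δ) ^ (2 * m) := by
  have ha : 0 ≤ a := hb.trans hba
  have hd0 : 0 ≤ d := by linarith
  have hε0 : 0 ≤ ε := (sq_nonneg _).trans hε
  have hpow : b ^ m ≤ a ^ m := pow_le_pow_left₀ hb hba m
  rcases le_total (a - b) (δ * a) with h | h
  · have h1 : (1 - δ) * a ≤ b := by linarith
    have h2 : ((1 - δ) * a) ^ m ≤ b ^ m :=
      pow_le_pow_left₀ (mul_nonneg (by linarith) ha) h1 m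
    have h3 : 1 + (m : ℝ) * (-δ) ≤ (1 + -δ) ^ m := one_add_mul_le_pow (by linarith) m
    have h4 : a ^ m - b ^ m ≤ m * δ * a ^ m := by
      rw [mul_pow] at h2
      have := mul_le_mul_of_nonneg_right h3 (pow_nonneg ha m)
      rw [← sub_eq_add_neg] at this
      nlinarith
    have h5 : (a ^ m - b ^ m) ^ 2 ≤ (m * δ * a ^ m) ^ 2 :=
      pow_le_pow_left₀ (by linarith) h4 2
    have h6 : (m * δ * a ^ m) ^ 2 ≤ ε * (a ^ m) ^ 2 := by
      rw [mul_pow]; exact mul_le_mul_of_nonneg_right hε (sq_nonneg _)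
    have h7 : 0 ≤ (d / δ) ^ (2 * m) := by positivity
    have h8 : 0 ≤ ε * (b ^ m) ^ 2 := by positivity
    linarith
  · have h1 : a ≤ d / δ := by rw [le_div_iff₀ hδ]; linarith
    have h2 : (a ^ m) ^ 2 ≤ (d / δ) ^ (2 * m) := by
      rw [← pow_mul, mul_comm m 2]; exact pow_le_pow_left₀ ha h1 _
    have h3 : (a ^ m - b ^ m) ^ 2 ≤ (a ^ m) ^ 2 :=
      pow_le_pow_left₀ (by linarith) (by linarith [pow_nonneg hb m]) 2
    have h4 : 0 ≤ ε * ((a ^ m) ^ 2 + (b ^ m) ^ 2) := by positivity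
    linarith

theorem sq_pow_sub_pow_le {a b d δ ε : ℝ} {m : ℕ} (ha : 0 ≤ a) (hb : 0 ≤ b)
    (hd : |a - b| ≤ d) (hδ : 0 < δ) (hδ1 : δ ≤ 1) (hε : (m * δ) ^ 2 ≤ ε) :
    (a ^ m - b ^ m) ^ 2 ≤ ε * ((a ^ m) ^ 2 + (b ^ m) ^ 2) + (d / δ) ^ (2 * m) := by
  rcases le_total b a with h | h
  · exact sq_pow_sub_pow_le_of_le hb h ((le_abs_self _).trans hd) hδ hδ1 hε
  · have := sq_pow_sub_pow_le_of_le (m := m) ha h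
      ((le_abs_self _).trans ((abs_sub_comm b a).trans_le hd)) hδ hδ1 hε
    rw [← neg_sub, neg_sq, add_comm ((a ^ m) ^ 2)]
    exact this

/-- The piecewise linear cutoff equal to `1` on `(-∞, 0]` and to `0` on `[N, ∞)`. -/
noncomputable def linearCutoff (N t : ℝ) : ℝ := max 0 (min 1 (1 - t / N))

theorem linearCutoff_nonneg (N t : ℝ) : 0 ≤ linearCutoff N t := le_max_left _ _

theorem linearCutoff_of_nonpos {N t : ℝ} (hN : 0 < N) (ht : t ≤ 0) : linearCutoff N t = 1 := by
  have : t / N ≤ 0 := div_nonpos_of_nonpos_of_nonneg ht hN.le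
  rw [linearCutoff, min_eq_left (by linarith), max_eq_right zero_le_one]

theorem linearCutoff_of_ge {N t : ℝ} (hN : 0 < N) (ht : N ≤ t) : linearCutoff N t = 0 := by
  have : 1 ≤ t / N := (one_le_div hN).2 ht
  rw [linearCutoff, max_eq_left]
  exact (min_le_right _ _).trans (by linarith)

theorem linearCutoff_le_one (N t : ℝ) : linearCutoff N t ≤ 1 :=
  max_le zero_le_one (min_le_left _ _)

theorem abs_linearCutoff_sub_le {N : ℝ} (hN : 0 < N) (t s : ℝ) :
    |linearCutoff N t - linearCutoff N s| ≤ |t - s| / N := by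
  unfold linearCutoff
  refine (abs_max_sub_max_le_max _ _ _ _).trans ?_
  rw [sub_self, abs_zero, max_eq_right (abs_nonneg _)]
  rw [min_comm 1, min_comm 1]
  refine (abs_min_sub_min_le_max _ _ _ _).trans_eq ?_
  rw [sub_self, abs_zero, max_eq_left (abs_nonneg _), sub_sub_sub_cancel_left, ← sub_div, abs_div,
    abs_of_pos hN, abs_sub_comm]

theorem continuous_linearCutoff (N : ℝ) : Continuous (linearCutoff N) := by
  unfold linearCutoff; fun_prop

/-- Expanding the square bounds a² + b² by 2ab plus an error. If t is farther than |t - s| from [0,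
N], then t and s lie on the same constant piece of the cutoff and no error occurs. -/
theorem linearCutoff_pow_sq_add_sq_le {N δ ε : ℝ} {m : ℕ} (hN : 0 < N) (hδ : 0 < δ) (hδ1 : δ ≤ 1)
    (hε : (m * δ) ^ 2 ≤ ε) (t s : ℝ) :
    (linearCutoff N t ^ m) ^ 2 + (linearCutoff N s ^ m) ^ 2 ≤
      2 * (linearCutoff N t ^ m * linearCutoff N s ^ m) +
      ε * ((linearCutoff N t ^ m) ^ 2 + (linearCutoff N s ^ m) ^ 2) +
      (Icc (-|t - s|) (N + |t - s|)).indicator (fun _ => (|t - s| / N / δ) ^ (2 * m)) t := by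
  have hε0 : 0 ≤ ε := (sq_nonneg _).trans hε
  by_cases ht : t ∈ Icc (-|t - s|) (N + |t - s|)
  · rw [indicator_of_mem ht]
    have := sq_pow_sub_pow_le (m := m) (linearCutoff_nonneg N t) (linearCutoff_nonneg N s)
      (abs_linearCutoff_sub_le hN t s) hδ hδ1 hε
    nlinarith
  · rw [indicator_of_notMem ht]
    have heq : linearCutoff N t = linearCutoff N s := by
      rw [mem_Icc, not_and_or, not_le, not_le] at ht
      have h1 := le_abs_self (t - s)
      have h2 := neg_abs_le (t - s)
      have h0 := abs_nonneg (t - s)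
      rcases ht with h | h
      · rw [linearCutoff_of_nonpos hN (by linarith), linearCutoff_of_nonpos hN (by linarith)]
      · rw [linearCutoff_of_ge hN (by linarith), linearCutoff_of_ge hN (by linarith)]
    rw [heq]
    have : 0 ≤ ε * ((linearCutoff N s ^ m) ^ 2 + (linearCutoff N s ^ m) ^ 2) := by positivity
    nlinarith

/-! ### Monotone solutions: slice bounds and the forward difference. -/

namespace LogFrame

variable {S : Type*} [MeasurableSpace S]
variable {ν : Measure S} [SFinite ν] {κ : S → S → ℝ → ℝ≥0∞} {σ : ℝ} {g : S × ℝ → ℝ≥0∞}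

omit [SFinite ν] in
theorem lintegral_mul_snd_le {A₀ : ℝ≥0∞} {f : S × ℝ → ℝ≥0∞} (hf : Measurable f) [SFinite ν]
    (hA : ∀ t, ∫⁻ a, f (a, t) ∂ν ≤ A₀) {E : ℝ → ℝ≥0∞} (hE : Measurable E) :
    ∫⁻ x, f x * E x.2 ∂(ν.prod volume) ≤ A₀ * ∫⁻ t, E t := by
  rw [lintegral_prod_symm' _ (by fun_prop), ← lintegral_const_mul _ hE]
  refine lintegral_mono fun t => ?_
  dsimp only
  rw [lintegral_mul_const _ (by fun_prop)]
  gcongr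
  exact hA t

omit [MeasurableSpace S] in
theorem monotone_of_reflect_le (hmono : ∀ c : ℝ, ∀ x : S × ℝ, c < x.2 → g (reflect c x) ≤ g x) (a : S) :
    Monotone fun t => g (a, t) := by
  intro t s hts
  rcases hts.eq_or_lt with rfl | hlt
  · exact le_rfl
  have := hmono ((t + s) / 2) (a, s) (by dsimp only; linarith)
  have h : reflect ((t + s) / 2) (a, s) = (a, t) := Prod.ext rfl (by simp only [reflect]; ring)
  rwa [h] at this

/-- A monotone solution has uniformly bounded `L ^ σ` norm on the slices. -/
theorem IsLogSolution.exists_slice_le (hκ : IsLogKernel κ) (hσ : 1 < σ)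
    (hg : IsLogSolution ν κ σ g) (hmono : ∀ a, Monotone fun t => g (a, t)) {c₀ : ℝ≥0∞}
    (hc₀ : 0 < c₀) (hlow : ∀ a b l, |l| ≤ 1 → c₀ ≤ κ a b l) :
    ∃ A₀ : ℝ≥0∞, A₀ ≠ ∞ ∧ ∀ t, ∫⁻ a, g (a, t) ^ σ ∂ν ≤ A₀ := by
  have hgm := hg.measurable
  rcases eq_or_ne ν 0 with rfl | hν
  · exact ⟨0, ENNReal.zero_ne_top, by simp⟩
  have hνu : ν univ ≠ 0 := by simpa using hν
  set K := c₀ ^ σ * ν univ with hK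
  have hK0 : K ≠ 0 := mul_ne_zero (by simp [ENNReal.rpow_eq_zero_iff, hc₀.ne', (by linarith : ¬ σ < 0)]) hνu
  refine ⟨(K⁻¹) ^ (σ - 1)⁻¹, ENNReal.rpow_ne_top_of_nonneg (inv_nonneg.2 (by linarith))
    (ENNReal.inv_ne_top.2 hK0), fun t => ?_⟩
  set A := ∫⁻ a, g (a, t) ^ σ ∂ν with hA
  -- Only the slab t ≤ s ≤ t + 1 is kept: there κ is at least c₀ and monotonicity replaces g (b, s)
  -- by g (b, t).
  have h1 : ∀ a, c₀ * A ≤ g (a, t) := by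
    intro a
    have hkx := measurable_ker hκ (a, t)
    rw [hg.eq_lintegral, lintegral_prod_symm' _ (by fun_prop)]
    calc c₀ * A = ∫⁻ s in Icc t (t + 1), c₀ * A := by
          rw [setLIntegral_const, Real.volume_Icc]; simp
      _ ≤ ∫⁻ s in Icc t (t + 1), ∫⁻ b, ker κ (a, t) (b, s) * g (b, s) ^ σ ∂ν := by
          refine setLIntegral_mono' measurableSet_Icc fun s hs => ?_
          rw [hA, ← lintegral_const_mul _ (by fun_prop)]
          refine lintegral_mono fun b => ?_
          dsimp only
          gcongr
          · exact hlow _ _ _ (by rw [abs_le]; constructor <;> linarith [hs.1, hs.2])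
          · exact hmono b hs.1
      _ ≤ _ := setLIntegral_le_lintegral _ _
  -- Raising the previous bound to the power σ and integrating over the slice makes A bound itself.
  have h2 : A ^ σ * K ≤ A := by
    calc A ^ σ * K = ∫⁻ a, (c₀ * A) ^ σ ∂ν := by
          rw [lintegral_const, ENNReal.mul_rpow_of_nonneg _ _ (by linarith), hK]; ring
      _ ≤ A := lintegral_mono fun a => ENNReal.rpow_le_rpow (h1 a) (by linarith)
  obtain ⟨a⟩ : Nonempty S := by
    by_contra h
    rw [not_nonempty_iff] at h
    exact hν (Measure.eq_zero_of_isEmpty ν)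
  have hAtop : A ≠ ∞ := by
    intro h
    have := h1 a
    rw [h, ENNReal.mul_top hc₀.ne', top_le_iff] at this
    exact hg.ne_top _ this
  rcases eq_or_ne A 0 with h0 | h0
  · rw [h0]; exact zero_le
  have h3 : A ^ (σ - 1) ≤ K⁻¹ := by
    rw [ENNReal.le_inv_iff_mul_le]
    have : A ^ σ = A ^ (σ - 1) * A := by
      nth_rw 3 [← ENNReal.rpow_one A]
      rw [← ENNReal.rpow_add _ _ h0 hAtop]; congr 1; ring
    rw [this] at h2
    rw [← ENNReal.mul_le_mul_iff_left h0 hAtop, one_mul]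
    calc _ = A ^ (σ - 1) * A * K := by ring
      _ ≤ _ := h2
  calc A = (A ^ (σ - 1)) ^ (σ - 1)⁻¹ := by
        rw [← ENNReal.rpow_mul, mul_inv_cancel₀ (by linarith), ENNReal.rpow_one]
    _ ≤ _ := ENNReal.rpow_le_rpow h3 (inv_nonneg.2 (by linarith))

/-- The forward difference of `g` in the real variable. -/
def diff (g : S × ℝ → ℝ≥0∞) (x : S × ℝ) : ℝ≥0∞ := g (x.1, x.2 + 1) - g x

theorem IsLogSolution.diff_eq (hκ : IsLogKernel κ) (hσ : 1 < σ)
    (hg : IsLogSolution ν κ σ g) (hmono : ∀ a, Monotone fun t => g (a, t)) (x : S × ℝ) :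
    diff g x = ∫⁻ y, ker κ x y * (g (y.1, y.2 + 1) ^ σ - g y ^ σ) ∂(ν.prod volume) := by
  have hgm := hg.measurable
  have hkx := measurable_ker hκ x
  have hshift : MeasurePreserving (fun y : S × ℝ => (y.1, y.2 + 1)) (ν.prod volume)
      (ν.prod volume) := (MeasurePreserving.id ν).prod (measurePreserving_add_right volume 1)
  have h1 : g (x.1, x.2 + 1) = g x +
      ∫⁻ y, ker κ x y * (g (y.1, y.2 + 1) ^ σ - g y ^ σ) ∂(ν.prod volume) := by
    have hkx' := measurable_ker hκ (x.1, x.2 + 1)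
    rw [hg.eq_lintegral (x.1, x.2 + 1), ← hshift.lintegral_comp (by fun_prop), hg.eq_lintegral x,
      ← lintegral_add_left (by fun_prop)]
    refine lintegral_congr fun y => ?_
    rw [← mul_add, add_tsub_cancel_of_le
      (ENNReal.rpow_le_rpow (hmono y.1 (show y.2 ≤ y.2 + 1 by linarith)) (by linarith))]
    congr 1
    simp [ker]
  rw [diff, h1, ENNReal.add_sub_cancel_left (hg.ne_top x)]

/-- By convexity of the power, the forward difference is a supersolution of the linearised equation;
this is the source of stability. -/
theorem IsLogSolution.lintegral_ker_diff_le (hκ : IsLogKernel κ) (hσ : 1 < σ)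
    (hg : IsLogSolution ν κ σ g) (hmono : ∀ a, Monotone fun t => g (a, t)) (x : S × ℝ) :
    ENNReal.ofReal σ * ∫⁻ y, ker κ x y * (g y ^ (σ - 1) * diff g y) ∂(ν.prod volume) ≤
      diff g x := by
  rw [hg.diff_eq hκ hσ hmono x, ← lintegral_const_mul' _ _ ENNReal.ofReal_ne_top]
  refine lintegral_mono fun y => ?_
  calc _ = ker κ x y * (ENNReal.ofReal σ * (g y ^ (σ - 1) * diff g y)) := by ring
    _ ≤ _ := by
      gcongr
      exact ENNReal.mul_rpow_sub_le hσ (hmono y.1 (show y.2 ≤ y.2 + 1 by linarith)) (hg.ne_top _)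

/-- The forward difference of a positive monotone solution is positive. -/
theorem IsLogSolution.diff_pos (hκ : IsLogKernel κ) (hσ : 1 < σ) (hν : ν ≠ 0)
    (hg : IsLogSolution ν κ σ g) (hmono : ∀ a, Monotone fun t => g (a, t)) (hpos : ∀ x, 0 < g x)
    (x : S × ℝ) : 0 < diff g x := by
  have hgm := hg.measurable
  have hkx := measurable_ker hκ x
  by_contra hx
  rw [not_lt, nonpos_iff_eq_zero, hg.diff_eq hκ hσ hmono, lintegral_eq_zero_iff (by fun_prop)] at hx
  have hzero : ∀ z, diff g z = 0 := by
    intro z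
    have hkz := measurable_ker hκ z
    rw [hg.diff_eq hκ hσ hmono, lintegral_eq_zero_iff (by fun_prop)]
    filter_upwards [hx] with y hy
    have : g (y.1, y.2 + 1) ^ σ - g y ^ σ = 0 := (mul_eq_zero.1 hy).resolve_left (ker_pos hκ x y).ne'
    simp [this]
  -- With monotonicity this keeps g (a, t) at least g (a, 0) down to -∞, so `local_ne_top` forces g
  -- (a, 0) to vanish for almost every a.
  have hper : ∀ a t, g (a, t + 1) ≤ g (a, t) := fun a t => tsub_eq_zero_iff_le.1 (hzero (a, t))
  have hnat : ∀ a (k : ℕ), g (a, 0) ≤ g (a, -(k : ℝ)) := by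
    intro a k
    induction k with
    | zero => simp
    | succ k ih =>
      refine ih.trans ?_
      have := hper a (-((k + 1 : ℕ) : ℝ))
      rwa [show -((k + 1 : ℕ) : ℝ) + 1 = -(k : ℝ) by push_cast; ring] at this
  have hle : ∀ a t, g (a, 0) ≤ g (a, t) := by
    intro a t
    obtain ⟨k, hk⟩ := exists_nat_ge (-t)
    exact (hnat a k).trans (hmono a (by linarith))
  have hlow : (∫⁻ a, g (a, 0) ^ (σ + 1) ∂ν) * ∞ ≤
      ∫⁻ x in {x | x.2 < 0}, g x ^ (σ + 1) ∂(ν.prod volume) := by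
    rw [← lintegral_indicator (measurableSet_lower _)]
    calc (∫⁻ a, g (a, 0) ^ (σ + 1) ∂ν) * ∞
        = (∫⁻ a, g (a, 0) ^ (σ + 1) ∂ν) * ∫⁻ t : ℝ, (Iio (0 : ℝ)).indicator 1 t := by
          rw [lintegral_indicator_one measurableSet_Iio, Real.volume_Iio]
      _ = ∫⁻ x : S × ℝ, g (x.1, 0) ^ (σ + 1) * (Iio (0 : ℝ)).indicator 1 x.2 ∂(ν.prod volume) := by
          exact (lintegral_prod_mul (f := fun a => g (a, 0) ^ (σ + 1))
            (g := (Iio (0 : ℝ)).indicator 1) (by fun_prop)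
            (measurable_one.indicator measurableSet_Iio).aemeasurable).symm
      _ ≤ _ := by
          refine lintegral_mono fun x => ?_
          by_cases hx0 : x.2 < 0
          · rw [indicator_of_mem (show x ∈ {x : S × ℝ | x.2 < 0} from hx0),
              indicator_of_mem (show x.2 ∈ Iio 0 from hx0), Pi.one_apply, mul_one]
            exact ENNReal.rpow_le_rpow (hle _ _) (by linarith)
          · rw [indicator_of_notMem (show x.2 ∉ Iio (0 : ℝ) from hx0), mul_zero]; exact zero_le
  have h0 : ∫⁻ a, g (a, 0) ^ (σ + 1) ∂ν = 0 := by
    by_contra h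
    rw [ENNReal.mul_top h, top_le_iff] at hlow
    exact hg.local_ne_top 0 hlow
  rw [lintegral_eq_zero_iff (by fun_prop)] at h0
  refine hν (ae_eq_bot.1 ?_)
  rw [← eventually_false_iff_eq_bot]
  filter_upwards [h0] with a ha
  simp only [Pi.zero_apply, ENNReal.rpow_eq_zero_iff] at ha
  rcases ha with ha | ha
  · exact (hpos _).ne' ha.1
  · exact hg.ne_top _ ha.1

end LogFrame

/-! ### Stability, the cutoff error, and vanishing of monotone solutions. -/

namespace LogFrame

variable {S : Type*} [MeasurableSpace S]
variable {ν : Measure S} [SFinite ν] {κ : S → S → ℝ → ℝ≥0∞} {σ : ℝ} {g : S × ℝ → ℝ≥0∞}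

theorem lintegral_lintegral_symm {X : Type*} [MeasurableSpace X] {m : Measure X} [SFinite m]
    {F : X → X → ℝ≥0∞} (hF : Measurable (Function.uncurry F)) :
    ∫⁻ x, ∫⁻ y, F x y ∂m ∂m = ∫⁻ x, ∫⁻ y, F y x ∂m ∂m :=
  lintegral_lintegral_swap hF.aemeasurable

theorem lintegral_lintegral_add {X : Type*} [MeasurableSpace X] {m : Measure X} [SFinite m]
    {F G : X → X → ℝ≥0∞} (hF : Measurable fun z : X × X => F z.1 z.2) :
    ∫⁻ x, ∫⁻ y, (F x y + G x y) ∂m ∂m =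
      ∫⁻ x, ∫⁻ y, F x y ∂m ∂m + ∫⁻ x, ∫⁻ y, G x y ∂m ∂m := by
  rw [← lintegral_add_left hF.lintegral_prod_right']
  exact lintegral_congr fun x => lintegral_add_left (hF.comp measurable_prodMk_left) _

theorem lintegral_lintegral_const_mul {X : Type*} [MeasurableSpace X] {m : Measure X}
    {F : X → X → ℝ≥0∞} {c : ℝ≥0∞} (hc : c ≠ ∞) :
    ∫⁻ x, ∫⁻ y, c * F x y ∂m ∂m = c * ∫⁻ x, ∫⁻ y, F x y ∂m ∂m := by
  simp_rw [lintegral_const_mul' _ _ hc]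

/-- The stability inequality of a positive monotone solution, tested with `g * η`. -/
theorem IsLogSolution.stability (hκ : IsLogKernel κ) (hσ : 1 < σ)
    (hg : IsLogSolution ν κ σ g) (hmono : ∀ a, Monotone fun t => g (a, t))
    (hpos : ∀ x, 0 < diff g x) {η : S × ℝ → ℝ≥0∞} (hη : Measurable η) :
    ENNReal.ofReal σ * ∫⁻ x, ∫⁻ y, (g x ^ σ * η x) * (ker κ x y * (g y ^ σ * η y))
      ∂(ν.prod volume) ∂(ν.prod volume) ≤ ∫⁻ x, g x ^ (σ + 1) * η x ^ 2 ∂(ν.prod volume) := by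
  have hgm := hg.measurable
  have hkm : Measurable fun z : (S × ℝ) × (S × ℝ) => ker κ z.1 z.2 := measurable_uncurry_ker hκ
  have hdm : Measurable (diff g) := by unfold diff; fun_prop
  have hdtop : ∀ x, diff g x ≠ ∞ := fun x => (tsub_le_self.trans_lt (hg.ne_top _).lt_top).ne
  -- Quotient of the test function by the positive supersolution, as in Picone's identity. The
  -- supersolution inequality is integrated against ψ² P.
  set ψ : S × ℝ → ℝ≥0∞ := fun x => g x * η x / diff g x with hψ
  have hψm : Measurable ψ := by fun_prop
  set P : S × ℝ → ℝ≥0∞ := fun x => g x ^ (σ - 1) * diff g x with hP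
  have hPm : Measurable P := by fun_prop
  have hψP : ∀ x, g x ^ σ * η x = ψ x * P x := by
    intro x
    have h1 : g x ^ σ = g x ^ (σ - 1) * g x := by
      nth_rw 3 [← ENNReal.rpow_one (g x)]
      rw [← ENNReal.rpow_add_of_nonneg _ _ (by linarith) zero_le_one]; congr 1; ring
    have h2 : g x * η x / diff g x * diff g x = g x * η x :=
      ENNReal.div_mul_cancel (hpos x).ne' (hdtop x)
    calc g x ^ σ * η x = g x ^ (σ - 1) * (g x * η x) := by rw [h1]; ring
      _ = g x ^ (σ - 1) * (g x * η x / diff g x * diff g x) := by rw [h2]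
      _ = _ := by simp only [hψ, hP]; ring
  have hψP2 : ∀ x, ψ x * ψ x * P x * diff g x = g x ^ (σ + 1) * η x ^ 2 := by
    intro x
    have h2 : ψ x * diff g x = g x * η x :=
      ENNReal.div_mul_cancel (hpos x).ne' (hdtop x)
    have h1 : g x ^ (σ + 1) = g x ^ (σ - 1) * (g x * g x) := by
      rw [← pow_two, ← ENNReal.rpow_two,
        ← ENNReal.rpow_add_of_nonneg _ _ (by linarith) zero_le_two]; congr 1; ring
    calc _ = g x ^ (σ - 1) * ((ψ x * diff g x) * (ψ x * diff g x)) := by simp only [hP]; ring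
      _ = _ := by rw [h2, h1]; ring
  simp_rw [hψP]
  set I := ∫⁻ x, ∫⁻ y, ψ x * ψ x * (P x * (ker κ x y * P y)) ∂(ν.prod volume) ∂(ν.prod volume)
    with hI
  have hIle : ENNReal.ofReal σ * I ≤ ∫⁻ x, g x ^ (σ + 1) * η x ^ 2 ∂(ν.prod volume) := by
    rw [hI, ← lintegral_const_mul' _ _ ENNReal.ofReal_ne_top]
    refine lintegral_mono fun x => ?_
    have hkx := measurable_ker hκ x
    rw [lintegral_const_mul _ (by fun_prop), lintegral_const_mul _ (by fun_prop), ← hψP2]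
    calc _ = ψ x * ψ x * P x * (ENNReal.ofReal σ * ∫⁻ y, ker κ x y * P y ∂(ν.prod volume)) := by ring
      _ ≤ _ := by
        gcongr
        exact hg.lintegral_ker_diff_le hκ hσ hmono x
  refine le_trans ?_ hIle
  gcongr
  -- Symmetrise in x and y, then use 2 ψ x ψ y ≤ ψ x² + ψ y².
  have hdouble : 2 * ∫⁻ x, ∫⁻ y, ψ x * P x * (ker κ x y * (ψ y * P y)) ∂(ν.prod volume)
      ∂(ν.prod volume) ≤ 2 * I := by
    have hsw : I = ∫⁻ x, ∫⁻ y, ψ y * ψ y * (P y * (ker κ y x * P x)) ∂(ν.prod volume)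
        ∂(ν.prod volume) :=
      lintegral_lintegral_symm (F := fun x y => ψ x * ψ x * (P x * (ker κ x y * P y)))
        (by unfold Function.uncurry; fun_prop)
    rw [two_mul I]
    nth_rw 2 [hsw]
    rw [hI, ← lintegral_lintegral_add (by fun_prop),
      ← lintegral_lintegral_const_mul ENNReal.ofNat_ne_top]
    refine lintegral_mono fun x => lintegral_mono fun y => ?_
    rw [ker_comm hκ y x]
    calc 2 * (ψ x * P x * (ker κ x y * (ψ y * P y)))
        = 2 * (ψ x * ψ y) * (P x * P y * ker κ x y) := by ring
      _ ≤ (ψ x * ψ x + ψ y * ψ y) * (P x * P y * ker κ x y) := by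
        gcongr
        exact ENNReal.two_mul_le_sq_add_sq _ _
      _ = _ := by ring
  exact (ENNReal.mul_le_mul_iff_right two_ne_zero ENNReal.ofNat_ne_top).1 hdouble

/-- The factor by which the linear cutoff fails to be invariant under a translation by `l`. -/
noncomputable def cutoffError (m : ℕ) (N δ t l : ℝ) : ℝ≥0∞ := ENNReal.ofReal
  ((Icc (-|l|) (N + |l|)).indicator (fun _ => (|l| / N / δ) ^ (2 * m)) t)

theorem measurable_cutoffError (m : ℕ) (N δ : ℝ) :
    Measurable fun z : ℝ × ℝ => cutoffError m N δ z.1 z.2 := by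
  refine ENNReal.measurable_ofReal.comp ?_
  have hs : MeasurableSet {z : ℝ × ℝ | z.1 ∈ Icc (-|z.2|) (N + |z.2|)} :=
    (measurableSet_le (f := fun z : ℝ × ℝ => -|z.2|) (g := fun z => z.1)
      (by fun_prop) (by fun_prop)).inter
      (measurableSet_le (f := fun z : ℝ × ℝ => z.1) (g := fun z => N + |z.2|)
      (by fun_prop) (by fun_prop))
  exact Measurable.indicator (f := fun z : ℝ × ℝ => (|z.2| / N / δ) ^ (2 * m)) (by fun_prop) hs

theorem lintegral_cutoffError {m : ℕ} {N δ : ℝ} (hN : 0 < N) (hδ : 0 < δ) (l : ℝ) :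
    ∫⁻ t, cutoffError m N δ t l = ENNReal.ofReal ((|l| / N / δ) ^ (2 * m) * (N + 2 * |l|)) := by
  have : ∀ t, cutoffError m N δ t l = (Icc (-|l|) (N + |l|)).indicator
      (fun _ => ENNReal.ofReal ((|l| / N / δ) ^ (2 * m))) t := by
    intro t
    by_cases ht : t ∈ Icc (-|l|) (N + |l|)
    · simp only [cutoffError, indicator_of_mem ht]
    · simp only [cutoffError, indicator_of_notMem ht, ENNReal.ofReal_zero]
  simp_rw [this]
  rw [lintegral_indicator_const measurableSet_Icc, Real.volume_Icc,
    ← ENNReal.ofReal_mul (by positivity)]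
  congr 2; ring

theorem cutoffError_factor_le {m : ℕ} (hm : 1 ≤ m) {N δ : ℝ} (hN : 1 ≤ N) (hδ : 0 < δ) (l : ℝ) :
    (|l| / N / δ) ^ (2 * m) * (N + 2 * |l|) ≤
      (δ ^ (2 * m))⁻¹ * N⁻¹ * (|l| ^ (2 * m) * (1 + 2 * |l|)) := by
  have hN0 : 0 < N := by linarith
  have h1 : N + 2 * |l| ≤ N * (1 + 2 * |l|) := by nlinarith [abs_nonneg l]
  -- Here m ≥ 1 matters: the gain N^(-2m) beats the length of order N of the interval and leaves
  -- 1/N.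
  have h2 : (N ^ (2 * m))⁻¹ * N ≤ N⁻¹ := by
    rw [inv_mul_le_iff₀ (by positivity), ← div_eq_mul_inv, le_div_iff₀ hN0, ← pow_two]
    exact pow_le_pow_right₀ hN (by omega)
  have h3 : 0 ≤ (δ ^ (2 * m))⁻¹ * (|l| ^ (2 * m) * (1 + 2 * |l|)) := by positivity
  calc (|l| / N / δ) ^ (2 * m) * (N + 2 * |l|)
      ≤ (|l| / N / δ) ^ (2 * m) * (N * (1 + 2 * |l|)) := by gcongr
    _ = ((N ^ (2 * m))⁻¹ * N) * ((δ ^ (2 * m))⁻¹ * (|l| ^ (2 * m) * (1 + 2 * |l|))) := by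
      rw [div_pow, div_pow]; field_simp
    _ ≤ N⁻¹ * ((δ ^ (2 * m))⁻¹ * (|l| ^ (2 * m) * (1 + 2 * |l|))) := by gcongr
    _ = _ := by ring

theorem lintegral_lintegral_cutoffError_le {κmax : ℝ → ℝ≥0∞} (hκmax : Measurable κmax) {m : ℕ}
    (hm : 1 ≤ m) {N δ : ℝ} (hN : 1 ≤ N) (hδ : 0 < δ) :
    ∫⁻ t, ∫⁻ l, κmax l * cutoffError m N δ t l ≤ ENNReal.ofReal ((δ ^ (2 * m))⁻¹ * N⁻¹) *
        ∫⁻ l, κmax l * ENNReal.ofReal (|l| ^ (2 * m) * (1 + 2 * |l|)) := by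
  have hN0 : 0 < N := by linarith
  have hDm := measurable_cutoffError m N δ
  rw [lintegral_lintegral_swap (f := fun t l => κmax l * cutoffError m N δ t l)
    (by unfold Function.uncurry; fun_prop), ← lintegral_const_mul _ (by fun_prop)]
  refine lintegral_mono fun l => ?_
  have hDl : Measurable fun t => cutoffError m N δ t l :=
    hDm.comp (measurable_id.prodMk measurable_const)
  dsimp only
  rw [lintegral_const_mul _ hDl, lintegral_cutoffError hN0 hδ]
  calc κmax l * ENNReal.ofReal ((|l| / N / δ) ^ (2 * m) * (N + 2 * |l|))
      ≤ κmax l * (ENNReal.ofReal ((δ ^ (2 * m))⁻¹ * N⁻¹) *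
        ENNReal.ofReal (|l| ^ (2 * m) * (1 + 2 * |l|))) := by
        gcongr
        rw [← ENNReal.ofReal_mul (by positivity)]
        exact ENNReal.ofReal_le_ofReal (cutoffError_factor_le hm hN hδ l)
    _ = _ := by ring

/-- Once κ is majorised by a function of the real variable, each of x and y contributes a slice
integral bounded by A₀, and only a double integral over t and l remains. -/
theorem IsLogSolution.lintegral_weight_le (hκ : IsLogKernel κ)
    (hg : IsLogSolution ν κ σ g) {A₀ : ℝ≥0∞} (hA : ∀ t, ∫⁻ a, g (a, t) ^ σ ∂ν ≤ A₀)
    {κmax : ℝ → ℝ≥0∞} (hκmax : Measurable κmax) (hle : ∀ a b l, κ a b l ≤ κmax l)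
    {D : ℝ → ℝ → ℝ≥0∞} (hD : Measurable fun z : ℝ × ℝ => D z.1 z.2) :
    ∫⁻ x, ∫⁻ y, g x ^ σ * (ker κ x y * (g y ^ σ * D x.2 (x.2 - y.2)))
      ∂(ν.prod volume) ∂(ν.prod volume) ≤ A₀ * (A₀ * ∫⁻ t, ∫⁻ l, κmax l * D t l) := by
  have hfm : Measurable fun x => g x ^ σ := hg.measurable.pow_const σ
  have hmul : Measurable fun z : ℝ × ℝ => κmax z.2 * D z.1 z.2 := by fun_prop
  have hEm : Measurable fun t => ∫⁻ l, κmax l * D t l := hmul.lintegral_prod_right'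
  have inner : ∀ x : S × ℝ, ∫⁻ y, g x ^ σ * (ker κ x y * (g y ^ σ * D x.2 (x.2 - y.2)))
      ∂(ν.prod volume) ≤ g x ^ σ * (A₀ * ∫⁻ l, κmax l * D x.2 l) := by
    intro x
    have hF : Measurable fun s : ℝ => κmax (x.2 - s) * D x.2 (x.2 - s) :=
      hmul.comp (measurable_const.prodMk (measurable_const.sub measurable_id))
    have hkx := measurable_ker hκ x
    have hDx : Measurable fun y : S × ℝ => D x.2 (x.2 - y.2) :=
      hD.comp (measurable_const.prodMk (measurable_const.sub measurable_snd))
    have h1 := lintegral_mul_snd_le (ν := ν) hfm hA hF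
    rw [lintegral_sub_left_eq_self (fun l => κmax l * D x.2 l) x.2] at h1
    have hall : Measurable fun y => ker κ x y * (g y ^ σ * D x.2 (x.2 - y.2)) :=
      hkx.mul (hfm.mul hDx)
    rw [lintegral_const_mul _ hall]
    refine mul_le_mul_right (le_trans (lintegral_mono fun y => ?_) h1) _
    calc ker κ x y * (g y ^ σ * D x.2 (x.2 - y.2))
        ≤ κmax (x.2 - y.2) * (g y ^ σ * D x.2 (x.2 - y.2)) := mul_le_mul_left (hle _ _ _) _
      _ = g y ^ σ * (κmax (x.2 - y.2) * D x.2 (x.2 - y.2)) := by ring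
  refine (lintegral_mono inner).trans ?_
  refine (lintegral_mul_snd_le hfm hA (hEm.const_mul A₀)).trans_eq ?_
  rw [lintegral_const_mul _ hEm]

/-- The error term of the cutoff is small. -/
theorem IsLogSolution.lintegral_cutoff_error_le (hκ : IsLogKernel κ)
    (hg : IsLogSolution ν κ σ g) {A₀ : ℝ≥0∞} (hA : ∀ t, ∫⁻ a, g (a, t) ^ σ ∂ν ≤ A₀)
    {κmax : ℝ → ℝ≥0∞} (hκmax : Measurable κmax) (hle : ∀ a b l, κ a b l ≤ κmax l) {m : ℕ}
    (hm : 1 ≤ m) {N δ : ℝ} (hN : 1 ≤ N) (hδ : 0 < δ) :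
    ∫⁻ x, ∫⁻ y, g x ^ σ * (ker κ x y * (g y ^ σ * cutoffError m N δ x.2 (x.2 - y.2)))
      ∂(ν.prod volume) ∂(ν.prod volume) ≤
      A₀ * (A₀ * (ENNReal.ofReal ((δ ^ (2 * m))⁻¹ * N⁻¹) *
        ∫⁻ l, κmax l * ENNReal.ofReal (|l| ^ (2 * m) * (1 + 2 * |l|)))) := by
  refine (hg.lintegral_weight_le hκ hA hκmax hle (measurable_cutoffError m N δ)).trans ?_
  gcongr
  exact lintegral_lintegral_cutoffError_le hκmax hm hN hδ

/-- Solutions dominating all their reflections vanish. -/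
theorem IsLogSolution.eq_zero_of_monotone (hκ : IsLogKernel κ) (hσ : 1 < σ)
    (hg : IsLogSolution ν κ σ g) (hmono : ∀ a, Monotone fun t => g (a, t)) {c₀ : ℝ≥0∞}
    (hc₀ : 0 < c₀) (hlow : ∀ a b l, |l| ≤ 1 → c₀ ≤ κ a b l)
    {κmax : ℝ → ℝ≥0∞} (hκmax : Measurable κmax) (hle : ∀ a b l, κ a b l ≤ κmax l) {m : ℕ}
    (hm : 1 ≤ m) (hint : ∫⁻ l, κmax l * ENNReal.ofReal (|l| ^ (2 * m) * (1 + 2 * |l|)) ≠ ∞) :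
    ∀ x, g x = 0 := by
  have hgm := hg.measurable
  have hkm : Measurable fun z : (S × ℝ) × (S × ℝ) => ker κ z.1 z.2 := measurable_uncurry_ker hκ
  rcases hg.eq_zero_or_pos hκ with h | hpos
  · exact h
  rcases eq_or_ne ν 0 with rfl | hν
  · intro x; rw [hg.eq_lintegral]; simp
  exfalso
  have hdpos := hg.diff_pos hκ hσ hν hmono hpos
  obtain ⟨A₀, hA₀, hA⟩ := hg.exists_slice_le hκ hσ hmono hc₀ hlow
  -- Stability leaves 2(1 - 1/σ) Y on the left; this ε spends exactly half of it on the term 2εY.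
  set ε : ℝ := (1 - 1 / σ) / 2 with hε
  have hσinv : 1 / σ < 1 := by rw [div_lt_one (by linarith)]; exact hσ
  have hε0 : 0 < ε := by rw [hε]; linarith
  obtain ⟨δ, hδ, hδ1, hδε⟩ : ∃ δ : ℝ, 0 < δ ∧ δ ≤ 1 ∧ (m * δ) ^ 2 ≤ ε := by
    have ht : Tendsto (fun δ : ℝ => ((m : ℝ) * δ) ^ 2) (𝓝[>] 0) (𝓝 0) := by
      have : Continuous fun δ : ℝ => ((m : ℝ) * δ) ^ 2 := by fun_prop
      have := this.tendsto 0
      rw [mul_zero, zero_pow two_ne_zero] at this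
      exact this.mono_left nhdsWithin_le_nhds
    obtain ⟨δ, h1, h2⟩ := ((ht.eventually (gt_mem_nhds hε0)).and
      (Ioc_mem_nhdsGT zero_lt_one)).exists
    exact ⟨δ, h2.1, h2.2, h1.le⟩
  set I := ∫⁻ l, κmax l * ENNReal.ofReal (|l| ^ (2 * m) * (1 + 2 * |l|)) with hI
  set Y₀ := ∫⁻ x in {x | x.2 < 0}, g x ^ (σ + 1) ∂(ν.prod volume) with hY₀
  have main : ∀ N : ℝ, 1 ≤ N → ENNReal.ofReal (1 - 1 / σ) * Y₀ ≤
      A₀ * (A₀ * (ENNReal.ofReal ((δ ^ (2 * m))⁻¹ * N⁻¹) * I)) := by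
    intro N hN
    have hN0 : 0 < N := by linarith
    set η : S × ℝ → ℝ≥0∞ := fun x => ENNReal.ofReal (linearCutoff N x.2 ^ m) with hη
    have hηm : Measurable η := by
      have := (continuous_linearCutoff N).measurable
      fun_prop
    have hpn : ∀ t, 0 ≤ linearCutoff N t ^ m := fun t => pow_nonneg (linearCutoff_nonneg N t) m
    have hη1 : ∀ x, η x ≤ 1 := fun x =>
      ENNReal.ofReal_le_one.2 (pow_le_one₀ (linearCutoff_nonneg _ _) (linearCutoff_le_one _ _))
    set Y := ∫⁻ x, g x ^ (σ + 1) * η x ^ 2 ∂(ν.prod volume) with hY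
    have hYtop : Y ≠ ∞ := by
      refine ((?_ : Y ≤ ∫⁻ x in {x | x.2 < N}, g x ^ (σ + 1) ∂(ν.prod volume)).trans_lt
        (hg.local_ne_top N).lt_top).ne
      rw [← lintegral_indicator (measurableSet_lower _)]
      refine lintegral_mono fun x => ?_
      by_cases hx : x.2 < N
      · rw [indicator_of_mem (show x ∈ {x : S × ℝ | x.2 < N} from hx)]
        exact mul_le_of_le_one_right' (pow_le_one₀ zero_le (hη1 x))
      · have : η x = 0 := by
          simp only [hη, linearCutoff_of_ge hN0 (not_lt.1 hx)]
          rw [zero_pow (by omega), ENNReal.ofReal_zero]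
        simp [this]
    have hY0Y : Y₀ ≤ Y := by
      rw [hY₀, ← lintegral_indicator (measurableSet_lower _)]
      refine lintegral_mono fun x => indicator_apply_le' (fun hx => ?_) fun _ => zero_le
      have : η x = 1 := by
        simp only [hη, linearCutoff_of_nonpos hN0 (le_of_lt hx), one_pow, ENNReal.ofReal_one]
      simp [this]
    have hYeq : Y = ∫⁻ x, ∫⁻ y, g x ^ σ * (ker κ x y * g y ^ σ) * η x ^ 2 ∂(ν.prod volume)
        ∂(ν.prod volume) := by
      refine lintegral_congr fun x => ?_
      have hkx := measurable_ker hκ x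
      rw [lintegral_mul_const _ (by fun_prop), lintegral_const_mul _ (by fun_prop),
        ← hg.eq_lintegral, ENNReal.rpow_add_of_nonneg _ _ (by linarith) zero_le_one,
        ENNReal.rpow_one]
    have hYeq' : Y = ∫⁻ x, ∫⁻ y, g x ^ σ * (ker κ x y * g y ^ σ) * η y ^ 2 ∂(ν.prod volume)
        ∂(ν.prod volume) := by
      rw [hYeq, lintegral_lintegral_symm
        (F := fun x y => g x ^ σ * (ker κ x y * g y ^ σ) * η x ^ 2)
        (by unfold Function.uncurry; fun_prop)]
      refine lintegral_congr fun x => lintegral_congr fun y => ?_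
      rw [ker_comm hκ y x]; ring
    -- The equation tested with g η² and symmetrised. Stability controls the same form with 2 η x η
    -- y in place of η x² + η y².
    have hsum : 2 * Y = ∫⁻ x, ∫⁻ y, g x ^ σ * (ker κ x y * g y ^ σ) * (η x ^ 2 + η y ^ 2)
        ∂(ν.prod volume) ∂(ν.prod volume) := by
      rw [two_mul]
      nth_rw 1 [hYeq]
      rw [hYeq', ← lintegral_lintegral_add (by fun_prop)]
      exact lintegral_congr fun x => lintegral_congr fun y => (mul_add _ _ _).symm
    set Z := A₀ * (A₀ * (ENNReal.ofReal ((δ ^ (2 * m))⁻¹ * N⁻¹) * I)) with hZ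
    set B := ∫⁻ x, ∫⁻ y, (g x ^ σ * η x) * (ker κ x y * (g y ^ σ * η y))
      ∂(ν.prod volume) ∂(ν.prod volume) with hB
    have hBY : ENNReal.ofReal σ * B ≤ Y := hg.stability hκ hσ hmono hdpos hηm
    have hηD : ∀ x y, η x ^ 2 + η y ^ 2 ≤
        2 * (η x * η y) + ENNReal.ofReal ε * (η x ^ 2 + η y ^ 2) + cutoffError m N δ x.2 (x.2 - y.2) := by
      intro x y
      have h := linearCutoff_pow_sq_add_sq_le (m := m) hN0 hδ hδ1 hδε x.2 y.2
      have hi : 0 ≤ (Icc (-|x.2 - y.2|) (N + |x.2 - y.2|)).indicator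
          (fun _ => (|x.2 - y.2| / N / δ) ^ (2 * m)) x.2 :=
        indicator_nonneg (fun _ _ => by positivity) _
      have hp1 := hpn x.2
      have hp2 := hpn y.2
      simp only [hη, cutoffError]
      rw [← ENNReal.ofReal_pow hp1, ← ENNReal.ofReal_pow hp2,
        ← ENNReal.ofReal_add (by positivity) (by positivity), ← ENNReal.ofReal_mul hp1,
        ← ENNReal.ofReal_mul hε0.le, ← ENNReal.ofReal_ofNat 2, ← ENNReal.ofReal_mul zero_le_two,
        ← ENNReal.ofReal_add (by positivity) (by positivity),
        ← ENNReal.ofReal_add (by positivity) hi]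
      exact ENNReal.ofReal_le_ofReal h
    have hfinal : 2 * Y ≤ 2 * B + ENNReal.ofReal ε * (2 * Y) + Z := by
      have herr := hg.lintegral_cutoff_error_le hκ hA hκmax hle hm hN hδ
      rw [← hI, ← hZ] at herr
      calc 2 * Y ≤ ∫⁻ x, ∫⁻ y, (2 * ((g x ^ σ * η x) * (ker κ x y * (g y ^ σ * η y))) +
            ENNReal.ofReal ε * (g x ^ σ * (ker κ x y * g y ^ σ) * (η x ^ 2 + η y ^ 2)) +
            g x ^ σ * (ker κ x y * (g y ^ σ * cutoffError m N δ x.2 (x.2 - y.2)))) ∂(ν.prod volume) ∂(ν.prod volume) := by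
            rw [hsum]
            refine lintegral_mono fun x => lintegral_mono fun y => ?_
            calc _ ≤ g x ^ σ * (ker κ x y * g y ^ σ) *
                  (2 * (η x * η y) + ENNReal.ofReal ε * (η x ^ 2 + η y ^ 2) + cutoffError m N δ x.2 (x.2 - y.2)) := by
                  exact mul_le_mul_right (hηD x y) _
              _ = _ := by ring
        _ = 2 * B + ENNReal.ofReal ε * (2 * Y) +
            ∫⁻ x, ∫⁻ y, g x ^ σ * (ker κ x y * (g y ^ σ * cutoffError m N δ x.2 (x.2 - y.2))) ∂(ν.prod volume)
              ∂(ν.prod volume) := by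
            have m1 : Measurable fun z : (S × ℝ) × (S × ℝ) =>
              (g z.1 ^ σ * η z.1) * (ker κ z.1 z.2 * (g z.2 ^ σ * η z.2)) := by fun_prop
            have m2 : Measurable fun z : (S × ℝ) × (S × ℝ) =>
              g z.1 ^ σ * (ker κ z.1 z.2 * g z.2 ^ σ) * (η z.1 ^ 2 + η z.2 ^ 2) := by fun_prop
            rw [hB, hsum, ← lintegral_lintegral_const_mul ENNReal.ofNat_ne_top,
              ← lintegral_lintegral_const_mul ENNReal.ofReal_ne_top,
              ← lintegral_lintegral_add (m1.const_mul _),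
              ← lintegral_lintegral_add ((m1.const_mul _).add (m2.const_mul _))]
        _ ≤ _ := by gcongr
    have hZY : ENNReal.ofReal (1 - 1 / σ) * Y ≤ Z := by
      rcases eq_or_ne Z ∞ with hZt | hZt
      · rw [hZt]; exact le_top
      have hBtop : B ≠ ∞ := by
        intro h
        rw [h, ENNReal.mul_top (by simp; linarith), top_le_iff] at hBY
        exact hYtop hBY
      obtain ⟨y, hy0, hy⟩ : ∃ y : ℝ, 0 ≤ y ∧ Y = ENNReal.ofReal y :=
        ⟨Y.toReal, ENNReal.toReal_nonneg, (ENNReal.ofReal_toReal hYtop).symm⟩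
      obtain ⟨b, hb0, hb⟩ : ∃ y : ℝ, 0 ≤ y ∧ B = ENNReal.ofReal y :=
        ⟨B.toReal, ENNReal.toReal_nonneg, (ENNReal.ofReal_toReal hBtop).symm⟩
      obtain ⟨z, hz0, hz⟩ : ∃ y : ℝ, 0 ≤ y ∧ Z = ENNReal.ofReal y :=
        ⟨Z.toReal, ENNReal.toReal_nonneg, (ENNReal.ofReal_toReal hZt).symm⟩
      rw [hy, hb, ← ENNReal.ofReal_mul (by linarith), ENNReal.ofReal_le_ofReal_iff hy0] at hBY
      rw [hy, hb, hz, ← ENNReal.ofReal_ofNat 2, ← ENNReal.ofReal_mul zero_le_two,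
        ← ENNReal.ofReal_mul zero_le_two, ← ENNReal.ofReal_mul hε0.le,
        ← ENNReal.ofReal_add (by positivity) (by positivity),
        ← ENNReal.ofReal_add (by positivity) hz0,
        ENNReal.ofReal_le_ofReal_iff (by positivity)] at hfinal
      rw [hy, hz, ← ENNReal.ofReal_mul (by linarith)]
      refine ENNReal.ofReal_le_ofReal ?_
      have hb' : b ≤ 1 / σ * y := by
        rw [one_div, inv_mul_eq_div, le_div_iff₀ (by linarith)]; linarith
      have : ε * (2 * y) = (1 - 1 / σ) * y := by rw [hε]; ring
      linarith
    calc _ ≤ ENNReal.ofReal (1 - 1 / σ) * Y := by gcongr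
      _ ≤ Z := hZY
  -- The left side of `main` does not depend on N, while the right side tends to 0.
  have hY₀0 : ENNReal.ofReal (1 - 1 / σ) * Y₀ = 0 := by
    have ht : Tendsto (fun N : ℝ => A₀ * (A₀ * (ENNReal.ofReal ((δ ^ (2 * m))⁻¹ * N⁻¹) * I))) atTop
        (𝓝 (A₀ * (A₀ * (0 * I)))) := by
      refine ENNReal.Tendsto.const_mul (ENNReal.Tendsto.const_mul
        (ENNReal.Tendsto.mul_const ?_ (Or.inr hint)) (Or.inr hA₀)) (Or.inr hA₀)
      have : Tendsto (fun N : ℝ => (δ ^ (2 * m))⁻¹ * N⁻¹) atTop (𝓝 ((δ ^ (2 * m))⁻¹ * 0)) :=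
        tendsto_inv_atTop_zero.const_mul _
      simpa using ENNReal.tendsto_ofReal this
    simp only [zero_mul, mul_zero] at ht
    refine le_antisymm (ge_of_tendsto ht ?_) zero_le
    filter_upwards [eventually_ge_atTop 1] with N hN using main N hN
  have hY₀z : Y₀ = 0 := by
    refine (mul_eq_zero.1 hY₀0).resolve_left ?_
    simp only [ENNReal.ofReal_eq_zero, not_le]; linarith
  rw [hY₀, setLIntegral_eq_zero_iff (measurableSet_lower _) (by fun_prop)] at hY₀z
  have hnull : (ν.prod (volume : Measure ℝ)) (univ ×ˢ Iio 0) = 0 := by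
    rw [← nonpos_iff_eq_zero, ← ae_iff.1 hY₀z]
    refine measure_mono fun x hx => ?_
    simp only [mem_ofPred_eq, Classical.not_imp]
    refine ⟨hx.2, fun h => ?_⟩
    rw [ENNReal.rpow_eq_zero_iff] at h
    rcases h with h | h
    · exact (hpos x).ne' h.1
    · exact hg.ne_top x h.1
  rw [Measure.prod_prod, Real.volume_Iio, ENNReal.mul_top (by simpa using hν)] at hnull
  exact ENNReal.top_ne_zero hnull

/-- Solutions of the integral equation are symmetric under a reflection of the real variable. -/
theorem IsLogSolution.exists_reflect_eq (hκ : IsLogKernel κ) (hg : IsLogSolution ν κ σ g)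
    {θ : ℝ} (hθ : 0 < θ) (hθ1 : θ < 1) (hσ : σ * (1 - θ) = 1 + θ) {C : ℝ≥0∞} (hC : C ≠ ∞)
    (hform : HasFormBound ν κ θ C) {c₀ : ℝ≥0∞}
    (hc₀ : 0 < c₀) (hlow : ∀ a b l, |l| ≤ 1 → c₀ ≤ κ a b l)
    {κmax : ℝ → ℝ≥0∞} (hκmax : Measurable κmax) (hle : ∀ a b l, κ a b l ≤ κmax l) {m : ℕ}
    (hm : 1 ≤ m) (hint : ∫⁻ l, κmax l * ENNReal.ofReal (|l| ^ (2 * m) * (1 + 2 * |l|)) ≠ ∞) :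
    ∃ c : ℝ, ∀ x, g (reflect c x) = g x := by
  rcases hg.symmetric_or_reflect_le hκ hθ hθ1 hσ hC hform with h | h
  · exact h
  · have h0 := hg.eq_zero_of_monotone hκ (by nlinarith) (monotone_of_reflect_le h) hc₀ hlow hκmax
      hle hm hint
    exact ⟨0, fun x => by rw [h0, h0]⟩

end LogFrame

/-! ### Dilations, gauge and polar coordinates on the Heisenberg group. -/

namespace Heisenberg

variable {n : ℕ}

/-- The anisotropic dilation `(z, t) ↦ (r z, r² t)`. -/
noncomputable def dil (r : ℝ) (ξ : Heis n) : Heis n := (r • ξ.1, r ^ 2 * ξ.2)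

theorem dil_dil (r s : ℝ) (ξ : Heis n) : dil r (dil s ξ) = dil (r * s) ξ := by
  refine Prod.ext ?_ ?_
  · simp only [dil, smul_smul]
  · simp only [dil]; ring

theorem dil_one (ξ : Heis n) : dil 1 ξ = ξ := by
  simp [dil]

theorem radius_nonneg (z : Fin n → ℂ) : 0 ≤ radius z := Real.sqrt_nonneg _

theorem radius_sq (z : Fin n → ℂ) : radius z ^ 2 = ∑ j, ‖z j‖ ^ 2 :=
  Real.sq_sqrt (Finset.sum_nonneg fun _ _ => sq_nonneg _)

theorem radius_smul (c : ℂ) (z : Fin n → ℂ) : radius (c • z) = ‖c‖ * radius z := by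
  rw [← sq_eq_sq₀ (radius_nonneg _) (mul_nonneg (norm_nonneg _) (radius_nonneg _)), mul_pow,
    radius_sq, radius_sq, Finset.mul_sum]
  simp [mul_pow]

theorem continuous_radius : Continuous (radius : (Fin n → ℂ) → ℝ) := by
  unfold radius; fun_prop

theorem gauge_nonneg (ξ : Heis n) : 0 ≤ gauge ξ := by
  unfold gauge; positivity

theorem gauge_pow_four (ξ : Heis n) : gauge ξ ^ 4 = radius ξ.1 ^ 4 + ξ.2 ^ 2 := by
  rw [gauge, ← Real.rpow_natCast, ← Real.rpow_mul (by positivity)]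
  norm_num

theorem continuous_gauge : Continuous (gauge : Heis n → ℝ) := by
  have := continuous_radius (n := n)
  exact Continuous.rpow_const (by fun_prop) fun _ => Or.inr (by norm_num)

@[fun_prop]
theorem measurable_gauge : Measurable (gauge : Heis n → ℝ) := continuous_gauge.measurable

theorem gauge_eq_of_pow_four {ξ : Heis n} {a : ℝ} (ha : 0 ≤ a)
    (h : radius ξ.1 ^ 4 + ξ.2 ^ 2 = a ^ 4) : gauge ξ = a := by
  rw [← gauge_pow_four] at h
  exact (pow_left_inj₀ (gauge_nonneg _) ha (by norm_num)).1 h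

theorem gauge_dil {r : ℝ} (hr : 0 ≤ r) (ξ : Heis n) : gauge (dil r ξ) = r * gauge ξ := by
  refine gauge_eq_of_pow_four (mul_nonneg hr (gauge_nonneg _)) ?_
  have h : radius (r • ξ.1) = r * radius ξ.1 := by
    have := radius_smul (r : ℂ) ξ.1
    rw [Complex.norm_real, Real.norm_of_nonneg hr] at this
    rw [← this]; congr 1
  rw [mul_pow, gauge_pow_four]
  simp only [dil, h]; ring

theorem norm_apply_le_radius (z : Fin n → ℂ) (j : Fin n) : ‖z j‖ ≤ radius z := by
  refine Real.le_sqrt_of_sq_le ?_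
  exact Finset.single_le_sum (f := fun j => ‖z j‖ ^ 2) (fun _ _ => sq_nonneg _) (Finset.mem_univ j)

theorem radius_le_gauge (ξ : Heis n) : radius ξ.1 ≤ gauge ξ := by
  refine le_of_pow_le_pow_left₀ (n := 4) (by norm_num) (gauge_nonneg _) ?_
  rw [gauge_pow_four]; nlinarith [sq_nonneg ξ.2]

theorem abs_snd_le_gauge_sq (ξ : Heis n) : |ξ.2| ≤ gauge ξ ^ 2 := by
  refine abs_le_of_sq_le_sq ?_ (sq_nonneg _)
  rw [← pow_mul, gauge_pow_four]
  have := pow_nonneg (radius_nonneg ξ.1) 4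
  linarith

theorem gauge_eq_zero {ξ : Heis n} : gauge ξ = 0 ↔ ξ = 0 := by
  constructor
  · intro h
    have h1 : radius ξ.1 ≤ 0 := h ▸ radius_le_gauge ξ
    have h2 : |ξ.2| ≤ 0 := by have := abs_snd_le_gauge_sq ξ; rwa [h, zero_pow two_ne_zero] at this
    refine Prod.ext (funext fun j => ?_) (abs_nonpos_iff.1 h2)
    exact norm_le_zero_iff.1 ((norm_apply_le_radius ξ.1 j).trans h1)
  · rintro rfl
    refine gauge_eq_of_pow_four le_rfl ?_
    simp [radius]

theorem gauge_pos {ξ : Heis n} : 0 < gauge ξ ↔ ξ ≠ 0 := by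
  rw [(gauge_nonneg ξ).lt_iff_ne', ne_eq, gauge_eq_zero]

theorem isCompact_gauge_le (R : ℝ) : IsCompact {ξ : Heis n | gauge ξ ≤ R} := by
  refine ((isCompact_closedBall (0 : Fin n → ℂ) R).prod
    (isCompact_Icc (a := -R ^ 2) (b := R ^ 2))).of_isClosed_subset
    (isClosed_le continuous_gauge continuous_const) ?_
  intro ξ hξ
  have hξ : gauge ξ ≤ R := hξ
  have hR : 0 ≤ R := (gauge_nonneg ξ).trans hξ
  refine ⟨?_, ?_⟩
  · rw [mem_closedBall_zero_iff, pi_norm_le_iff_of_nonneg hR]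
    exact fun j => (norm_apply_le_radius _ j).trans ((radius_le_gauge ξ).trans hξ)
  · rw [mem_Icc, ← abs_le]
    exact (abs_snd_le_gauge_sq ξ).trans (pow_le_pow_left₀ (gauge_nonneg ξ) hξ 2)

/-- The point of gauge `1` on the dilation orbit of `ξ`. -/
noncomputable def unit (ξ : Heis n) : Heis n :=
  -- The default at the origin also has gauge 1, so the kernel estimates hold for every pair of
  -- points without exception.
  open scoped Classical in if ξ = 0 then (0, 1) else dil (gauge ξ)⁻¹ ξ

theorem unit_of_ne_zero {ξ : Heis n} (h : ξ ≠ 0) : unit ξ = dil (gauge ξ)⁻¹ ξ := if_neg h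

theorem gauge_unit (ξ : Heis n) : gauge (unit ξ) = 1 := by
  by_cases h : ξ = 0
  · rw [unit, if_pos h]
    refine gauge_eq_of_pow_four zero_le_one ?_
    simp [radius]
  · have := gauge_pos.2 h
    rw [unit_of_ne_zero h, gauge_dil (by positivity), inv_mul_cancel₀ this.ne']

theorem dil_gauge_unit {ξ : Heis n} (h : ξ ≠ 0) : dil (gauge ξ) (unit ξ) = ξ := by
  rw [unit_of_ne_zero h, dil_dil, mul_inv_cancel₀ (gauge_pos.2 h).ne', dil_one]

theorem continuous_dil : Continuous fun p : ℝ × Heis n => dil p.1 p.2 := by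
  unfold dil; fun_prop

@[fun_prop]
theorem measurable_unit : Measurable (unit : Heis n → Heis n) := by
  classical
  unfold unit
  refine Measurable.ite (measurableSet_singleton 0) measurable_const ?_
  exact continuous_dil.measurable.comp (measurable_gauge.inv.prodMk measurable_id)

theorem homDim_pos (n : ℕ) : 0 < homDim n := by unfold homDim; positivity

theorem ae_ne_zero : ∀ᵐ ξ : Heis n, ξ ≠ 0 := by
  have hvol : (volume : Measure (Heis n)) = (volume : Measure (Fin n → ℂ)).prod volume := rfl
  have : (volume : Measure (Heis n)) (univ ×ˢ {0}) = 0 := by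
    rw [hvol, Measure.prod_prod]; simp
  rw [ae_iff]
  refine measure_mono_null (fun x hx => ?_) this
  have : x = 0 := not_not.1 hx
  simp [this]

/-- Behaviour of the Lebesgue measure under dilations. -/
theorem lintegral_comp_dil {r : ℝ} (hr : 0 < r) {F : Heis n → ℝ≥0∞} (hF : Measurable F) :
    ∫⁻ ξ, F ξ = ENNReal.ofReal (r ^ homDim n) * ∫⁻ ξ, F (dil r ξ) := by
  have h1 : Measure.map (fun z : Fin n → ℂ => r • z) volume =
      ENNReal.ofReal ((r ^ (2 * n))⁻¹) • volume := by
    rw [Measure.map_addHaar_smul _ hr.ne', Module.finrank_pi_fintype,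
      abs_of_nonneg (by positivity)]
    simp [Complex.finrank_real_complex, mul_comm]
  have h2 : Measure.map (fun t : ℝ => r ^ 2 * t) volume =
      ENNReal.ofReal ((r ^ 2)⁻¹) • volume := by
    have := Measure.map_addHaar_smul (volume : Measure ℝ) (r := r ^ 2) (by positivity)
    rw [Module.finrank_self, pow_one, abs_of_nonneg (by positivity)] at this
    exact this
  have h3 : Measurable (dil r : Heis n → Heis n) :=
    continuous_dil.measurable.comp (measurable_const.prodMk measurable_id)
  have hi : ∀ z : Fin n → ℂ, ∀ G : ℝ → ℝ≥0∞, Measurable G →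
      ∫⁻ t, G (r ^ 2 * t) = ENNReal.ofReal ((r ^ 2)⁻¹) * ∫⁻ t, G t := by
    intro z G hG
    rw [← lintegral_map hG (by fun_prop), h2, lintegral_smul_measure, smul_eq_mul]
  have ho : ∀ G : (Fin n → ℂ) → ℝ≥0∞, Measurable G →
      ∫⁻ z, G (r • z) = ENNReal.ofReal ((r ^ (2 * n))⁻¹) * ∫⁻ z, G z := by
    intro G hG
    rw [← lintegral_map hG (by fun_prop), h1, lintegral_smul_measure, smul_eq_mul]
  have hvol : (volume : Measure (Heis n)) = (volume : Measure (Fin n → ℂ)).prod volume := rfl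
  have hFd : Measurable fun ξ => F (dil r ξ) := hF.comp h3
  rw [hvol, lintegral_prod _ hFd.aemeasurable, lintegral_prod _ hF.aemeasurable]
  have e1 : ∀ z : Fin n → ℂ, ∫⁻ t, F (dil r (z, t)) =
      ENNReal.ofReal ((r ^ 2)⁻¹) * ∫⁻ t, F (r • z, t) := fun z =>
    hi z (fun t => F (r • z, t)) (by fun_prop)
  simp_rw [e1]
  rw [lintegral_const_mul' _ _ ENNReal.ofReal_ne_top,
    ho (fun z => ∫⁻ t, F (z, t)) hF.lintegral_prod_right', ← mul_assoc, ← mul_assoc,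
    ← ENNReal.ofReal_mul (by positivity), ← ENNReal.ofReal_mul (by positivity)]
  have : r ^ homDim n * (r ^ 2)⁻¹ * (r ^ (2 * n))⁻¹ = 1 := by
    have h : homDim n = ((2 * n + 2 : ℕ) : ℝ) := by unfold homDim; push_cast; ring
    rw [h, Real.rpow_natCast, pow_add]; field_simp
  rw [this, ENNReal.ofReal_one, one_mul]

/-- Left translations preserve the Lebesgue measure. -/
theorem measurePreserving_mul (ζ : Heis n) : MeasurePreserving (mul ζ) := by
  have hvol : (volume : Measure (Heis n)) = (volume : Measure (Fin n → ℂ)).prod volume := rfl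
  rw [hvol]
  -- Left translation is a translation in z followed, on each fibre, by a translation in t.
  refine MeasurePreserving.skew_product (f := fun z => ζ.1 + z)
    (g := fun z t => ζ.2 + t + 2 * (herm ζ.1 z).im) (measurePreserving_add_left volume ζ.1) ?_ ?_
  · unfold Function.uncurry herm; fun_prop
  · refine .of_forall fun z => ?_
    have : (fun t : ℝ => ζ.2 + t + 2 * (herm ζ.1 z).im) =
        fun t => (ζ.2 + 2 * (herm ζ.1 z).im) + t := by funext t; ring
    rw [this]
    exact (measurePreserving_add_left volume _).map_eq

/-- The rotation `(z, t) ↦ (c z, t)`. -/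
noncomputable def rot (c : Circle) (ξ : Heis n) : Heis n := ((c : ℂ) • ξ.1, ξ.2)

/-- A fundamental domain of the dilations. -/
def shell (n : ℕ) : Set (Heis n) := {ξ | 1 ≤ gauge ξ ∧ gauge ξ < Real.exp 1}

/-- The measure `ρ ^ (-Q) dξ` on the shell `1 ≤ ρ < e`, a fundamental domain of the dilations. -/
noncomputable def shellMeasure (n : ℕ) : Measure (Heis n) :=
  volume.withDensity ((shell n).indicator
    fun ξ => ENNReal.ofReal (gauge ξ ^ (-homDim n)))

theorem measurableSet_shell : MeasurableSet (shell n) :=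
  (measurableSet_le measurable_const measurable_gauge).inter
    (measurableSet_lt measurable_gauge measurable_const)

instance : SFinite (shellMeasure n) := by
  unfold shellMeasure; infer_instance

theorem lintegral_shellMeasure {F : Heis n → ℝ≥0∞} (hF : Measurable F) :
    ∫⁻ ξ, F ξ ∂(shellMeasure n) =
      ∫⁻ ξ, (shell n).indicator
        (fun ξ => ENNReal.ofReal (gauge ξ ^ (-homDim n)) * F ξ) ξ := by
  rw [shellMeasure, lintegral_withDensity_eq_lintegral_mul _
    (Measurable.indicator (by fun_prop) measurableSet_shell) hF]
  refine lintegral_congr fun ξ => ?_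
  rw [Pi.mul_apply, indicator_mul_left]

theorem shellMeasure_univ_ne_top : shellMeasure n univ ≠ ∞ := by
  rw [← lintegral_one, lintegral_shellMeasure measurable_const]
  refine ((?_ : _ ≤ volume {ξ : Heis n | gauge ξ ≤ Real.exp 1}).trans_lt
    (isCompact_gauge_le _).measure_lt_top).ne
  rw [← lintegral_indicator_one (measurableSet_le measurable_gauge measurable_const)]
  refine lintegral_mono fun ξ => indicator_apply_le' (fun hξ => ?_) fun _ => zero_le
  rw [indicator_of_mem (show ξ ∈ {ξ : Heis n | gauge ξ ≤ Real.exp 1} from hξ.2.le), mul_one,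
    Pi.one_apply, ENNReal.ofReal_le_one]
  exact Real.rpow_le_one_of_one_le_of_nonpos hξ.1 (by linarith [homDim_pos n])

/-- Every dilation orbit spends logarithmic time exactly one in the shell. This lets the weighted
shell stand in for a surface measure on the unit sphere. -/
theorem lintegral_indicator_shell {ξ : Heis n} (hξ : ξ ≠ 0) :
    ∫⁻ τ : ℝ, (shell n).indicator (1 : Heis n → ℝ≥0∞)
      (dil (Real.exp (-τ)) ξ) = 1 := by
  have hρ := gauge_pos.2 hξ
  have : ∀ τ : ℝ, (shell n).indicator
      (1 : Heis n → ℝ≥0∞) (dil (Real.exp (-τ)) ξ) =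
      (Ioc (Real.log (gauge ξ) - 1) (Real.log (gauge ξ))).indicator 1 τ := by
    intro τ
    have hiff : dil (Real.exp (-τ)) ξ ∈ shell n ↔
        τ ∈ Ioc (Real.log (gauge ξ) - 1) (Real.log (gauge ξ)) := by
      rw [shell, mem_ofPred_eq, gauge_dil (Real.exp_pos _).le, mem_Ioc, and_comm]
      refine and_congr ?_ ?_
      · nth_rw 1 [← Real.exp_log hρ]
        rw [← Real.exp_add, Real.exp_lt_exp]
        constructor <;> intro h <;> linarith
      · nth_rw 1 [← Real.exp_log hρ]
        rw [← Real.exp_add, Real.one_le_exp_iff]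
        constructor <;> intro h <;> linarith
    by_cases h : τ ∈ Ioc (Real.log (gauge ξ) - 1) (Real.log (gauge ξ))
    · rw [indicator_of_mem h, indicator_of_mem (hiff.2 h)]; rfl
    · rw [indicator_of_notMem h, indicator_of_notMem (fun h' => h (hiff.1 h'))]
  simp_rw [this]
  rw [lintegral_indicator_one measurableSet_Ioc, Real.volume_Ioc]
  simp

/-- Polar coordinates: integration over the orbits of the dilations. -/
theorem lintegral_polar {F : Heis n → ℝ≥0∞} (hF : Measurable F) :
    ∫⁻ ξ, F ξ = ∫⁻ x, ENNReal.ofReal (Real.exp (homDim n * x.2)) *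
      F (dil (Real.exp x.2) (unit x.1)) ∂((shellMeasure n).prod volume) := by
  have hd : Measurable fun p : ℝ × Heis n => dil p.1 p.2 := continuous_dil.measurable
  have hm1 : Measurable fun p : Heis n × ℝ => F p.1 *
      (shell n).indicator (1 : Heis n → ℝ≥0∞)
        (dil (Real.exp (-p.2)) p.1) :=
    (hF.comp measurable_fst).mul ((measurable_one.indicator measurableSet_shell).comp
      (hd.comp ((Real.measurable_exp.comp measurable_snd.neg).prodMk measurable_fst)))
  have hm2 : Measurable fun x : Heis n × ℝ => ENNReal.ofReal (Real.exp (homDim n * x.2)) *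
      F (dil (Real.exp x.2) (unit x.1)) := by
    refine Measurable.mul (by fun_prop) (hF.comp (hd.comp (Measurable.prodMk (by fun_prop) ?_)))
    exact measurable_unit.comp measurable_fst
  have hm3 : Measurable fun x : Heis n × ℝ => ENNReal.ofReal (Real.exp (homDim n * x.2)) *
      F (dil (Real.exp x.2) x.1) := by
    refine Measurable.mul (by fun_prop) (hF.comp (hd.comp (Measurable.prodMk (by fun_prop) ?_)))
    exact measurable_fst
  -- Moving the base point of the orbit from ξ to `unit ξ` shifts τ by log (gauge ξ), which produces
  -- the density of `shellMeasure`.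
  have horbit : ∀ ξ : Heis n, ξ ∈ shell n →
      ∫⁻ τ, ENNReal.ofReal (Real.exp (homDim n * τ)) * F (dil (Real.exp τ) ξ) =
      ENNReal.ofReal (gauge ξ ^ (-homDim n)) *
        ∫⁻ τ, ENNReal.ofReal (Real.exp (homDim n * τ)) * F (dil (Real.exp τ) (unit ξ)) := by
    intro ξ hξ
    have hρ : 0 < gauge ξ := lt_of_lt_of_le one_pos hξ.1
    have hne := gauge_pos.1 hρ
    rw [← lintegral_sub_right_eq_self _ (Real.log (gauge ξ)),
      ← lintegral_const_mul' _ _ ENNReal.ofReal_ne_top]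
    refine lintegral_congr fun τ => ?_
    rw [unit_of_ne_zero hne, dil_dil, ← mul_assoc, ← ENNReal.ofReal_mul (by positivity)]
    congr 2
    · rw [mul_sub, Real.exp_sub, Real.rpow_neg hρ.le, Real.rpow_def_of_pos hρ,
        mul_comm (Real.log _)]
      field_simp
    · rw [Real.exp_sub, Real.exp_log hρ, div_eq_mul_inv]
  calc ∫⁻ ξ, F ξ = ∫⁻ ξ, (∫⁻ τ : ℝ, F ξ *
        (shell n).indicator (1 : Heis n → ℝ≥0∞)
        (dil (Real.exp (-τ)) ξ)) := by
        refine lintegral_congr_ae ?_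
        filter_upwards [ae_ne_zero] with ξ hξ
        have hi : Measurable fun τ : ℝ =>
            (shell n).indicator (1 : Heis n → ℝ≥0∞) (dil (Real.exp (-τ)) ξ) :=
          (measurable_one.indicator measurableSet_shell).comp
            (hd.comp ((Real.measurable_exp.comp measurable_neg).prodMk measurable_const))
        rw [lintegral_const_mul _ hi, lintegral_indicator_shell hξ, mul_one]
    _ = ∫⁻ τ : ℝ, ∫⁻ ξ, F ξ *
        (shell n).indicator (1 : Heis n → ℝ≥0∞)
        (dil (Real.exp (-τ)) ξ) := lintegral_lintegral_swap hm1.aemeasurable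
    _ = ∫⁻ τ : ℝ, ∫⁻ ξ, (shell n).indicator
        (fun ξ => ENNReal.ofReal (Real.exp (homDim n * τ)) * F (dil (Real.exp τ) ξ)) ξ := by
        refine lintegral_congr fun τ => ?_
        have hi : Measurable fun ξ : Heis n => F ξ *
            (shell n).indicator (1 : Heis n → ℝ≥0∞) (dil (Real.exp (-τ)) ξ) :=
          hm1.comp (measurable_id.prodMk measurable_const)
        rw [lintegral_comp_dil (Real.exp_pos τ) hi,
          ← lintegral_const_mul' _ _ ENNReal.ofReal_ne_top]
        refine lintegral_congr fun ξ => ?_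
        rw [dil_dil, ← Real.exp_add, neg_add_cancel, Real.exp_zero, dil_one,
          ← Real.exp_mul, mul_comm τ]
        by_cases h : ξ ∈ shell n
        · rw [indicator_of_mem h, indicator_of_mem h, Pi.one_apply, mul_one]
        · rw [indicator_of_notMem h, indicator_of_notMem h, mul_zero, mul_zero]
    _ = ∫⁻ ξ, ∫⁻ τ : ℝ, (shell n).indicator
        (fun ξ => ENNReal.ofReal (Real.exp (homDim n * τ)) * F (dil (Real.exp τ) ξ)) ξ := by
        refine lintegral_lintegral_swap (Measurable.aemeasurable ?_)
        have := (hm3.comp measurable_swap).indicator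
          (measurable_snd (measurableSet_shell (n := n)) :
            MeasurableSet ((Prod.snd : ℝ × Heis n → Heis n) ⁻¹' _))
        exact this
    _ = ∫⁻ ξ, ∫⁻ τ, ENNReal.ofReal (Real.exp (homDim n * τ)) * F (dil (Real.exp τ) (unit ξ))
        ∂(volume : Measure ℝ) ∂(shellMeasure n) := by
        rw [lintegral_shellMeasure hm2.lintegral_prod_right']
        refine lintegral_congr fun ξ => ?_
        by_cases h : ξ ∈ shell n
        · simp only [indicator_of_mem h]; exact horbit ξ h
        · simp only [indicator_of_notMem h, lintegral_zero]
    _ = _ := (lintegral_prod _ hm2.aemeasurable).symm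

end Heisenberg

/-! ### Averages over the circle. -/

noncomputable instance : MeasurableSpace Circle := borel Circle

instance : BorelSpace Circle := ⟨rfl⟩

/-- The Haar probability measure of the circle. -/
noncomputable def circleMeasure : Measure Circle := Measure.haarMeasure ⊤

instance : IsProbabilityMeasure circleMeasure :=
  ⟨Measure.haarMeasure_self (K₀ := (⊤ : TopologicalSpace.PositiveCompacts Circle))⟩

instance : circleMeasure.IsMulLeftInvariant := by
  unfold circleMeasure; infer_instance

/-- The average of `‖A - W c‖ ^ (-q)` over the unit circle. -/
noncomputable def phaseAvg (q A W : ℝ) : ℝ≥0∞ :=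
  ∫⁻ c : Circle, ENNReal.ofReal ‖(A : ℂ) - (c : ℂ) * W‖ ^ (-q) ∂circleMeasure

theorem Circle.continuous_coe : Continuous fun c : Circle => (c : ℂ) :=
  continuous_induced_dom

@[fun_prop]
theorem Circle.measurable_coe : Measurable fun c : Circle => (c : ℂ) :=
  Circle.continuous_coe.measurable

theorem measurable_phaseAvg (q : ℝ) : Measurable fun p : ℝ × ℝ => phaseAvg q p.1 p.2 := by
  unfold phaseAvg
  have : Measurable fun z : (ℝ × ℝ) × Circle =>
      ENNReal.ofReal ‖((z.1.1 : ℝ) : ℂ) - (z.2 : ℂ) * (z.1.2 : ℝ)‖ ^ (-q) := by fun_prop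
  exact this.lintegral_prod_right'

theorem exists_circle_mul_norm (w : ℂ) : ∃ a : Circle, (a : ℂ) * ‖w‖ = w :=
  ⟨Circle.exp w.arg, by rw [Circle.coe_exp, mul_comm]; exact Complex.norm_mul_exp_arg_mul_I w⟩

/-- Invariance of Haar measure absorbs the phases of B and w, so that only their moduli survive the
averaging. -/
theorem lintegral_circle_norm_sub (q : ℝ) (B w : ℂ) :
    ∫⁻ c : Circle, ENNReal.ofReal ‖B - (c : ℂ) * w‖ ^ (-q) ∂circleMeasure =
      phaseAvg q ‖B‖ ‖w‖ := by
  obtain ⟨a, ha⟩ := exists_circle_mul_norm B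
  obtain ⟨b, hb⟩ := exists_circle_mul_norm w
  refine Eq.trans (lintegral_congr fun c => ?_) (lintegral_mul_left_eq_self
    (fun c : Circle => ENNReal.ofReal ‖(‖B‖ : ℂ) - (c : ℂ) * ‖w‖‖ ^ (-q)) (a⁻¹ * b))
  congr 2
  have : B - c * w = a * ((‖B‖ : ℂ) - ((a⁻¹ * b * c : Circle) : ℂ) * ‖w‖) := by
    nth_rw 1 [← ha, ← hb]
    rw [mul_sub, ← mul_assoc (a : ℂ) ((a⁻¹ * b * c : Circle) : ℂ), ← Circle.coe_mul]
    rw [show a * (a⁻¹ * b * c) = b * c by group, Circle.coe_mul]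
    ring
  rw [this, norm_mul, Circle.norm_coe, one_mul]

theorem phaseAvg_mul (q : ℝ) {r : ℝ} (hr : 0 < r) (A W : ℝ) :
    phaseAvg q (r * A) (r * W) = ENNReal.ofReal (r ^ (-q)) * phaseAvg q A W := by
  unfold phaseAvg
  rw [← lintegral_const_mul' _ _ ENNReal.ofReal_ne_top]
  refine lintegral_congr fun c => ?_
  have : ((r * A : ℝ) : ℂ) - c * ((r * W : ℝ) : ℂ) = (r : ℂ) * ((A : ℂ) - c * W) := by
    push_cast; ring
  rw [this, norm_mul, Complex.norm_real, Real.norm_of_nonneg hr.le, ENNReal.ofReal_mul hr.le,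
    ENNReal.mul_rpow_of_ne_top ENNReal.ofReal_ne_top ENNReal.ofReal_ne_top,
    ENNReal.ofReal_rpow_of_pos hr]

theorem le_phaseAvg {q A W K : ℝ} (hq : 0 < q) (hA : 0 ≤ A) (hW : 0 ≤ W) (hK : A + W ≤ K) :
    ENNReal.ofReal K ^ (-q) ≤ phaseAvg q A W := by
  calc ENNReal.ofReal K ^ (-q) = ∫⁻ _ : Circle, ENNReal.ofReal K ^ (-q) ∂circleMeasure := by simp
    _ ≤ _ := by
      refine lintegral_mono fun c => ?_
      rw [ENNReal.rpow_neg, ENNReal.rpow_neg, ENNReal.inv_le_inv]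
      refine ENNReal.rpow_le_rpow (ENNReal.ofReal_le_ofReal ?_) hq.le
      refine (norm_sub_le _ _).trans ?_
      rw [norm_mul, Circle.norm_coe, Complex.norm_real, Complex.norm_real, one_mul,
        Real.norm_of_nonneg hA, Real.norm_of_nonneg hW]
      exact hK

theorem phaseAvg_le {q A W d : ℝ} (hq : 0 < q) (hA : 0 ≤ A) (hW : 0 ≤ W) (hd : d ≤ A - W) :
    phaseAvg q A W ≤ ENNReal.ofReal d ^ (-q) := by
  calc phaseAvg q A W ≤ ∫⁻ _ : Circle, ENNReal.ofReal d ^ (-q) ∂circleMeasure := by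
        refine lintegral_mono fun c => ?_
        rw [ENNReal.rpow_neg, ENNReal.rpow_neg, ENNReal.inv_le_inv]
        refine ENNReal.rpow_le_rpow (ENNReal.ofReal_le_ofReal (hd.trans ?_)) hq.le
        have := norm_sub_norm_le (A : ℂ) ((c : ℂ) * W)
        rwa [norm_mul, Circle.norm_coe, Complex.norm_real, Complex.norm_real, one_mul,
          Real.norm_of_nonneg hA, Real.norm_of_nonneg hW] at this
    _ = _ := by simp

/-- As Re (cW) ≤ W ≤ A, moving from A to A' along the real axis goes away from cW. -/
theorem norm_sub_circle_mul_lt {A A' W : ℝ} (hW : 0 ≤ W) (hWA : W ≤ A) (hA : A < A') (c : Circle) :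
    ‖(A : ℂ) - (c : ℂ) * W‖ < ‖(A' : ℂ) - (c : ℂ) * W‖ := by
  have hre : (c : ℂ).re ≤ 1 := (Complex.re_le_norm _).trans_eq (Circle.norm_coe c)
  rw [← sq_lt_sq₀ (norm_nonneg _) (norm_nonneg _), ← Complex.normSq_eq_norm_sq,
    ← Complex.normSq_eq_norm_sq, Complex.normSq_apply, Complex.normSq_apply]
  simp only [Complex.sub_re, Complex.sub_im, Complex.ofReal_re, Complex.ofReal_im,
    Complex.mul_re, Complex.mul_im, mul_zero, sub_zero, zero_sub, zero_add]
  have : (c : ℂ).re * W ≤ W := by nlinarith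
  nlinarith

theorem phaseAvg_lt {q A A' W : ℝ} (hq : 0 < q) (hW : 0 ≤ W) (hWA : W ≤ A) (hA : A < A') :
    phaseAvg q A' W < phaseAvg q A W := by
  refine lintegral_strict_mono (IsProbabilityMeasure.ne_zero _) ?_ ?_ ?_
  · exact Measurable.aemeasurable (by fun_prop)
  · refine ((phaseAvg_le (d := A' - W) hq (by linarith) hW le_rfl).trans_lt ?_).ne
    rw [ENNReal.rpow_neg, ENNReal.inv_lt_top]
    exact ENNReal.rpow_pos (by simp; linarith) ENNReal.ofReal_ne_top
  · refine .of_forall fun c => ?_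
    have h := norm_sub_circle_mul_lt hW hWA hA c
    rw [ENNReal.rpow_neg, ENNReal.rpow_neg, ENNReal.inv_lt_inv]
    exact ENNReal.rpow_lt_rpow ((ENNReal.ofReal_lt_ofReal_iff ((norm_nonneg _).trans_lt h)).2 h) hq

/-! ### The rotation-averaged Green kernel in logarithmic coordinates. -/

namespace Heisenberg

variable {n : ℕ}

theorem herm_smul_left (c : ℂ) (z p : Fin n → ℂ) : herm (c • z) p = c * herm z p := by
  simp [herm, Finset.mul_sum, mul_assoc]

theorem herm_smul_right (c : ℂ) (z p : Fin n → ℂ) :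
    herm z (c • p) = (starRingEnd ℂ) c * herm z p := by
  simp only [herm, Finset.mul_sum, Pi.smul_apply, smul_eq_mul, map_mul]
  exact Finset.sum_congr rfl fun j _ => by ring

theorem herm_conj (z p : Fin n → ℂ) : (starRingEnd ℂ) (herm z p) = herm p z := by
  simp only [herm, map_sum, map_mul, Complex.conj_conj]
  exact Finset.sum_congr rfl fun j _ => mul_comm _ _

theorem norm_herm_comm (z p : Fin n → ℂ) : ‖herm z p‖ = ‖herm p z‖ := by
  rw [← herm_conj, Complex.norm_conj]

theorem norm_herm_le (z p : Fin n → ℂ) : ‖herm z p‖ ≤ radius z * radius p := by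
  have h1 : ‖herm z p‖ ≤ ∑ j, ‖z j‖ * ‖p j‖ := by
    refine (norm_sum_le _ _).trans_eq ?_
    simp
  refine h1.trans ?_
  refine (sq_le_sq₀ (Finset.sum_nonneg fun _ _ => by positivity)
    (mul_nonneg (radius_nonneg _) (radius_nonneg _))).1 ?_
  rw [mul_pow, radius_sq, radius_sq]
  exact Finset.sum_mul_sq_le_sq_mul_sq _ _ _

theorem radius_add_sq (z p : Fin n → ℂ) :
    radius (-z + p) ^ 2 = radius z ^ 2 + radius p ^ 2 - 2 * (herm z p).re := by
  simp only [radius_sq, herm, Complex.re_sum, Finset.mul_sum, ← Finset.sum_add_distrib,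
    ← Finset.sum_sub_distrib]
  refine Finset.sum_congr rfl fun j _ => ?_
  simp only [← Complex.normSq_eq_norm_sq, Complex.normSq_apply, Pi.add_apply, Pi.neg_apply,
    Complex.add_re, Complex.add_im, Complex.neg_re, Complex.neg_im, Complex.mul_re,
    Complex.conj_re, Complex.conj_im]
  ring

/-- The part `|z|² + |z'|² + i (t' - t)` of the complex distance of two points which is invariant
under rotations. -/
noncomputable def baseTerm (ζ ξ : Heis n) : ℂ :=
  ⟨radius ζ.1 ^ 2 + radius ξ.1 ^ 2, ξ.2 - ζ.2⟩

theorem norm_baseTerm_sq (ζ ξ : Heis n) :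
    ‖baseTerm ζ ξ‖ ^ 2 = (radius ζ.1 ^ 2 + radius ξ.1 ^ 2) ^ 2 + (ξ.2 - ζ.2) ^ 2 := by
  rw [← Complex.normSq_eq_norm_sq, Complex.normSq_apply, baseTerm]; ring

theorem norm_baseTerm_comm (ζ ξ : Heis n) : ‖baseTerm ζ ξ‖ = ‖baseTerm ξ ζ‖ := by
  rw [← sq_eq_sq₀ (norm_nonneg _) (norm_nonneg _), norm_baseTerm_sq, norm_baseTerm_sq]; ring

/-- The squared distance is the modulus of a complex number in which a rotation of ζ changes only
the phase of the Hermitian product. This reduces the averaged kernel to `phaseAvg`. -/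
theorem gauge_mul_inv_sq (ζ ξ : Heis n) :
    gauge (mul (inv ζ) ξ) ^ 2 = ‖baseTerm ζ ξ - 2 * herm ζ.1 ξ.1‖ := by
  have h : herm (-ζ.1) ξ.1 = -herm ζ.1 ξ.1 := by
    have := herm_smul_left (-1) ζ.1 ξ.1
    simpa using this
  rw [← sq_eq_sq₀ (sq_nonneg _) (norm_nonneg _), ← pow_mul, gauge_pow_four,
    ← Complex.normSq_eq_norm_sq, Complex.normSq_apply]
  have h4 : radius (mul (inv ζ) ξ).1 ^ 4 = (radius (-ζ.1 + ξ.1) ^ 2) ^ 2 := by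
    rw [← pow_mul]; rfl
  rw [h4, radius_add_sq]
  simp only [mul, inv, h, baseTerm, Complex.sub_re, Complex.sub_im, Complex.mul_re, Complex.mul_im,
    Complex.neg_im, Complex.re_ofNat, Complex.im_ofNat]
  ring

/-- The kernel `|ζ⁻¹ ξ| ^ (-2 q)` with values in `[0, ∞]`. -/
noncomputable def greenKernel (q : ℝ) (ζ ξ : Heis n) : ℝ≥0∞ :=
  ENNReal.ofReal (gauge (mul (inv ζ) ξ)) ^ (-(2 * q))

theorem greenKernel_eq (q : ℝ) (ζ ξ : Heis n) : greenKernel q ζ ξ =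
    ENNReal.ofReal ‖baseTerm ζ ξ - 2 * herm ζ.1 ξ.1‖ ^ (-q) := by
  rw [← gauge_mul_inv_sq, ENNReal.ofReal_pow (gauge_nonneg _), greenKernel, ← ENNReal.rpow_natCast,
    ← ENNReal.rpow_mul]
  congr 1; push_cast; ring

theorem baseTerm_rot (c : Circle) (ζ ξ : Heis n) : baseTerm (rot c ζ) ξ = baseTerm ζ ξ := by
  simp only [baseTerm, rot, radius_smul, Circle.norm_coe, one_mul]

theorem lintegral_greenKernel_rot (q : ℝ) (ζ ξ : Heis n) :
    ∫⁻ c, greenKernel q (rot c ζ) ξ ∂circleMeasure =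
      phaseAvg q ‖baseTerm ζ ξ‖ (2 * ‖herm ζ.1 ξ.1‖) := by
  have h : (2 * ‖herm ζ.1 ξ.1‖ : ℝ) = ‖2 * herm ζ.1 ξ.1‖ := by simp
  rw [h, ← lintegral_circle_norm_sub]
  refine lintegral_congr fun c => ?_
  rw [greenKernel_eq, baseTerm_rot]
  congr 4
  simp only [rot, herm_smul_left]; ring

/-- The kernel in logarithmic polar coordinates. -/
noncomputable def logKernel (q : ℝ) (a b : Heis n) (l : ℝ) : ℝ≥0∞ :=
  phaseAvg q (√(4 * Real.sinh l ^ 2 + ‖baseTerm (unit a) (unit b)‖ ^ 2))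
    (2 * ‖herm (unit a).1 (unit b).1‖)

theorem norm_baseTerm_sq_of_gauge {x y : Heis n} (hx : gauge x = 1) (hy : gauge y = 1) :
    ‖baseTerm x y‖ ^ 2 = 2 + 2 * (radius x.1 ^ 2 * radius y.1 ^ 2 - x.2 * y.2) := by
  have h1 := gauge_pow_four x
  have h2 := gauge_pow_four y
  rw [hx] at h1
  rw [hy] at h2
  rw [norm_baseTerm_sq]
  nlinarith

/-- After Cauchy–Schwarz the gap between the squares is (|z|² - |z'|²)² + (t - t')². The bound gives
the hypothesis W ≤ A of `phaseAvg_lt`. -/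
theorem two_mul_norm_herm_le {x y : Heis n} (hx : gauge x = 1) (hy : gauge y = 1) :
    2 * ‖herm x.1 y.1‖ ≤ ‖baseTerm x y‖ := by
  have h1 := gauge_pow_four x
  have h2 := gauge_pow_four y
  rw [hx] at h1
  rw [hy] at h2
  refine (sq_le_sq₀ (by positivity) (norm_nonneg _)).1 ?_
  rw [norm_baseTerm_sq_of_gauge hx hy]
  have h3 : (2 * ‖herm x.1 y.1‖) ^ 2 ≤ (2 * (radius x.1 * radius y.1)) ^ 2 := by
    gcongr
    exact norm_herm_le _ _
  nlinarith [sq_nonneg (radius x.1 ^ 2 - radius y.1 ^ 2), sq_nonneg (x.2 - y.2)]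

theorem norm_baseTerm_le_two {x y : Heis n} (hx : gauge x = 1) (hy : gauge y = 1) :
    ‖baseTerm x y‖ ≤ 2 := by
  have h1 := gauge_pow_four x
  have h2 := gauge_pow_four y
  rw [hx] at h1
  rw [hy] at h2
  refine (sq_le_sq₀ (norm_nonneg _) (by norm_num)).1 ?_
  rw [norm_baseTerm_sq_of_gauge hx hy]
  nlinarith [sq_nonneg (radius x.1 ^ 2 - radius y.1 ^ 2), sq_nonneg (x.2 + y.2)]

theorem radius_dil {r : ℝ} (hr : 0 ≤ r) (ξ : Heis n) : radius (dil r ξ).1 = r * radius ξ.1 := by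
  have := radius_smul (r : ℂ) ξ.1
  rw [Complex.norm_real, Real.norm_of_nonneg hr] at this
  rw [← this]; rfl

theorem norm_herm_dil {r s : ℝ} (hr : 0 ≤ r) (hs : 0 ≤ s) (x y : Heis n) :
    ‖herm (dil r x).1 (dil s y).1‖ = r * s * ‖herm x.1 y.1‖ := by
  have h : herm (dil r x).1 (dil s y).1 = (r : ℂ) * ((s : ℂ) * herm x.1 y.1) := by
    have h1 := herm_smul_right (s : ℂ) x.1 y.1
    rw [Complex.conj_ofReal] at h1
    rw [← h1, ← herm_smul_left]; rfl
  rw [h, norm_mul, norm_mul, Complex.norm_real, Complex.norm_real, Real.norm_of_nonneg hr,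
    Real.norm_of_nonneg hs, mul_assoc]

/-- Expanding the square gives e^(4t) + e^(4s) plus a cross term of weight e^(2(t+s)), and e^(4t) +
e^(4s) = e^(2(t+s)) (4 sinh²(t - s) + 2). Evenness in t - s appears here. -/
theorem norm_baseTerm_dil {x y : Heis n} (hx : gauge x = 1) (hy : gauge y = 1) (t s : ℝ) :
    ‖baseTerm (dil (Real.exp t) x) (dil (Real.exp s) y)‖ =
      Real.exp (t + s) * √(4 * Real.sinh (t - s) ^ 2 + ‖baseTerm x y‖ ^ 2) := by
  have h1 := gauge_pow_four x
  have h2 := gauge_pow_four y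
  rw [hx] at h1
  rw [hy] at h2
  rw [← sq_eq_sq₀ (norm_nonneg _) (by positivity), mul_pow, Real.sq_sqrt (by positivity),
    norm_baseTerm_sq_of_gauge hx hy, norm_baseTerm_sq, radius_dil (Real.exp_pos _).le,
    radius_dil (Real.exp_pos _).le, Real.sinh_eq, neg_sub, Real.exp_add, Real.exp_sub, Real.exp_sub]
  simp only [dil]
  have ht := Real.exp_pos t
  have hs := Real.exp_pos s
  field_simp
  linear_combination (-4 * Real.exp t ^ 4) * h1 + (-4 * Real.exp s ^ 4) * h2

theorem lintegral_greenKernel_dil (q : ℝ) (a b : Heis n) (t s : ℝ) :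
    ∫⁻ c, greenKernel q (rot c (dil (Real.exp t) (unit a))) (dil (Real.exp s) (unit b))
      ∂circleMeasure = ENNReal.ofReal (Real.exp (-q * (t + s))) * logKernel q a b (t - s) := by
  rw [lintegral_greenKernel_rot, norm_baseTerm_dil (gauge_unit a) (gauge_unit b),
    norm_herm_dil (Real.exp_pos _).le (Real.exp_pos _).le, ← Real.exp_add, mul_left_comm 2,
    phaseAvg_mul q (Real.exp_pos _), ← Real.exp_mul, mul_comm (t + s)]
  rfl

theorem _root_.Measurable.norm_baseTerm_sq {X : Type*} [MeasurableSpace X] {f g : X → Heis n}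
    (hf : Measurable f) (hg : Measurable g) : Measurable fun x => ‖baseTerm (f x) (g x)‖ ^ 2 := by
  have hr := (continuous_radius (n := n)).measurable
  simp_rw [Heisenberg.norm_baseTerm_sq]
  exact (((hr.comp hf.fst).pow_const 2).add ((hr.comp hg.fst).pow_const 2)).pow_const 2 |>.add
    ((hg.snd.sub hf.snd).pow_const 2)

theorem _root_.Measurable.herm {X : Type*} [MeasurableSpace X] {f g : X → Fin n → ℂ}
    (hf : Measurable f) (hg : Measurable g) : Measurable fun x => herm (f x) (g x) := by
  unfold Heisenberg.herm
  refine Finset.measurable_sum _ fun j _ => ?_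
  exact ((measurable_pi_apply j).comp hf).mul
    (Complex.continuous_conj.measurable.comp ((measurable_pi_apply j).comp hg))

theorem measurable_logKernel (q : ℝ) :
    Measurable fun p : Heis n × Heis n × ℝ => logKernel q p.1 p.2.1 p.2.2 := by
  have h1 : Measurable fun p : Heis n × Heis n × ℝ => unit p.1 :=
    measurable_unit.comp measurable_fst
  have h2 : Measurable fun p : Heis n × Heis n × ℝ => unit p.2.1 :=
    measurable_unit.comp measurable_snd.fst
  have h3 : Measurable fun p : Heis n × Heis n × ℝ => Real.sinh p.2.2 :=
    Real.measurable_sinh.comp measurable_snd.snd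
  have h4 := (((h3.pow_const 2).const_mul 4).add (h1.norm_baseTerm_sq h2)).sqrt
  exact (measurable_phaseAvg q).comp (h4.prodMk ((h1.fst.herm h2.fst).norm.const_mul 2))

theorem isLogKernel_logKernel {q : ℝ} (hq : 0 < q) :
    LogFrame.IsLogKernel (logKernel q : Heis n → Heis n → ℝ → ℝ≥0∞) where
  measurable := measurable_logKernel q
  symm a b l := by
    rw [logKernel, logKernel, norm_baseTerm_comm, norm_herm_comm]
  even a b l := by
    rw [logKernel, logKernel, Real.sinh_neg, neg_sq]
  strictAnti a b l l' h := by
    refine phaseAvg_lt hq (by positivity) ?_ ?_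
    · refine (two_mul_norm_herm_le (gauge_unit a) (gauge_unit b)).trans ?_
      refine Real.le_sqrt_of_sq_le ?_
      nlinarith [sq_nonneg (Real.sinh l)]
    · refine Real.sqrt_lt_sqrt (by positivity) ?_
      have : |Real.sinh l| < |Real.sinh l'| := by
        rw [Real.abs_sinh, Real.abs_sinh, Real.sinh_lt_sinh]; exact h
      have := sq_lt_sq.2 this
      linarith

theorem exists_le_logKernel {q : ℝ} (hq : 0 < q) : ∃ c₀ : ℝ≥0∞, 0 < c₀ ∧
    ∀ (a b : Heis n) (l : ℝ), |l| ≤ 1 → c₀ ≤ logKernel q a b l := by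
  refine ⟨ENNReal.ofReal (√(4 * Real.sinh 1 ^ 2 + 2 ^ 2) + 2) ^ (-q), ?_, fun a b l hl => ?_⟩
  · exact ENNReal.rpow_pos (by simp; positivity) ENNReal.ofReal_ne_top
  · refine le_phaseAvg hq (Real.sqrt_nonneg _) (by positivity) ?_
    have h1 := norm_baseTerm_le_two (gauge_unit a) (gauge_unit b)
    have h2 := two_mul_norm_herm_le (gauge_unit a) (gauge_unit b)
    refine add_le_add (Real.sqrt_le_sqrt ?_) (h2.trans h1)
    have h3 : Real.sinh l ^ 2 ≤ Real.sinh 1 ^ 2 := by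
      rw [← sq_abs, Real.abs_sinh]
      exact pow_le_pow_left₀ (Real.sinh_nonneg_iff.2 (abs_nonneg l)) (Real.sinh_le_sinh.2 hl) 2
    have h4 : ‖baseTerm (unit a) (unit b)‖ ^ 2 ≤ 2 ^ 2 := pow_le_pow_left₀ (norm_nonneg _) h1 2
    linarith

/-- A lower bound for 4x²/(2x+4) at x = sinh l, quadratic near 0 and exponential at infinity. It
comes from sinh l = 2 sinh (l/2) cosh (l/2) ≥ l e^(l/2)/2. -/
theorem sq_mul_exp_le {x l : ℝ} (hl : 0 ≤ l) (hx : Real.sinh l = x) :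
    l ^ 2 * Real.exp (l / 4) / 4 * (2 * x + 4) ≤ 4 * x ^ 2 := by
  set e := Real.exp (l / 4) with he
  have he1 : l / 4 + 1 ≤ e := Real.add_one_le_exp _
  have he0 : 0 < e := Real.exp_pos _
  have hy : l * e ^ 2 / 2 ≤ x := by
    have h1 : Real.sinh l = 2 * Real.sinh (l / 2) * Real.cosh (l / 2) := by
      rw [← Real.sinh_two_mul]; congr 1; ring
    have h2 : l / 2 ≤ Real.sinh (l / 2) := Real.self_le_sinh_iff.2 (by linarith)
    have h3 : e ^ 2 / 2 ≤ Real.cosh (l / 2) := by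
      have h4 : e ^ 2 = Real.exp (l / 2) := by
        rw [he, ← Real.exp_nat_mul]; congr 1; push_cast; ring
      rw [Real.cosh_eq, h4]
      have := Real.exp_pos (-(l / 2))
      linarith
    rw [← hx, h1]
    have := mul_le_mul h2 h3 (by positivity) (Real.sinh_nonneg_iff.2 (by linarith))
    linarith
  have hy0 : 0 ≤ l * e ^ 2 / 2 := by positivity
  -- `x ↦ x² / (x + 2)` is increasing
  set y := l * e ^ 2 / 2 with hydef
  have hmono : y ^ 2 * (x + 2) ≤ x ^ 2 * (y + 2) := by
    nlinarith [mul_nonneg hy0 (sub_nonneg.2 hy), mul_nonneg (mul_nonneg hy0 (hy0.trans hy)) (sub_nonneg.2 hy)]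
  have hbase : l ^ 2 * e / 8 * (y + 2) ≤ y ^ 2 := by
    have h5 : 1 ≤ e := by linarith
    have h6 : y + 2 ≤ 2 * e ^ 3 := by
      have : l ≤ 4 * e - 4 := by linarith
      rw [hydef]
      nlinarith [mul_nonneg (sq_nonneg e) (sub_nonneg.2 this)]
    have h7 : y ^ 2 = l ^ 2 * e / 8 * (2 * e ^ 3) := by rw [hydef]; ring
    rw [h7]
    gcongr
  have hfin : l ^ 2 * e / 8 * (x + 2) ≤ x ^ 2 := by
    have h8 : 0 < y + 2 := by linarith
    have h9 : 0 ≤ x + 2 := by linarith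
    refine le_of_mul_le_mul_right ?_ h8
    calc l ^ 2 * e / 8 * (x + 2) * (y + 2) = l ^ 2 * e / 8 * (y + 2) * (x + 2) := by ring
      _ ≤ y ^ 2 * (x + 2) := by gcongr
      _ ≤ _ := hmono
  linarith

/-- A majorant of the kernel, depending on the real variable only. -/
noncomputable def logMajorant (q l : ℝ) : ℝ≥0∞ :=
  ENNReal.ofReal (|l| ^ 2 * Real.exp (|l| / 4) / 4) ^ (-q)

theorem measurable_logMajorant (q : ℝ) : Measurable (logMajorant q) := by
  unfold logMajorant; fun_prop

/-- With W ≤ G ≤ 2, A - W = (A² - W²)/(A + W) is at least 4 sinh² l divided by 2 sinh |l| + 4,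
uniformly in a and b. -/
theorem logKernel_le {q : ℝ} (hq : 0 < q) (a b : Heis n) (l : ℝ) :
    logKernel q a b l ≤ logMajorant q l := by
  refine phaseAvg_le hq (Real.sqrt_nonneg _) (by positivity) ?_
  set W := 2 * ‖herm (unit a).1 (unit b).1‖
  set G := ‖baseTerm (unit a) (unit b)‖
  set x := Real.sinh |l| with hx
  have hx0 : 0 ≤ x := Real.sinh_nonneg_iff.2 (abs_nonneg l)
  have hG : G ≤ 2 := norm_baseTerm_le_two (gauge_unit a) (gauge_unit b)
  have hWG : W ≤ G := two_mul_norm_herm_le (gauge_unit a) (gauge_unit b)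
  have hW0 : 0 ≤ W := by positivity
  have hsq : Real.sinh l ^ 2 = x ^ 2 := by rw [hx, ← Real.abs_sinh, sq_abs]
  rw [hsq]
  set A := √(4 * x ^ 2 + G ^ 2) with hA
  have hA2 : A ^ 2 = 4 * x ^ 2 + G ^ 2 := Real.sq_sqrt (by positivity)
  have hA0 : 0 ≤ A := Real.sqrt_nonneg _
  have hAle : A ≤ 2 * x + G := by
    refine Real.sqrt_le_iff.2 ⟨by positivity, ?_⟩
    nlinarith [mul_nonneg hx0 (hW0.trans hWG)]
  have key := sq_mul_exp_le (abs_nonneg l) hx.symm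
  have h1 : (A - W) * (2 * x + 4) ≥ 4 * x ^ 2 := by
    have h2 : W ≤ A := hWG.trans (Real.le_sqrt_of_sq_le (by nlinarith))
    have h3 : (A - W) * (A + W) ≥ 4 * x ^ 2 := by nlinarith
    nlinarith [mul_nonneg (sub_nonneg.2 h2) (show 0 ≤ 2 * x + 4 - (A + W) by linarith)]
  exact le_of_mul_le_mul_right (key.trans h1) (by linarith)

end Heisenberg

/-! ### Integrability of the majorant and the form bound for the averaged kernel. -/

namespace Heisenberg

variable {n : ℕ}

theorem exists_lintegral_logMajorant_ne_top {q : ℝ} (hq : 0 < q) : ∃ m : ℕ, 1 ≤ m ∧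
    ∫⁻ l : ℝ, logMajorant q l * ENNReal.ofReal (|l| ^ (2 * m) * (1 + 2 * |l|)) ≠ ∞ := by
  -- Any m > q offsets the singularity |l|^(-2q) of the majorant; its exponential decay handles
  -- infinity.
  refine ⟨⌈q⌉₊ + 1, by omega, ?_⟩
  set m := ⌈q⌉₊ + 1 with hm
  have hqm : q < m := by rw [hm]; push_cast; linarith [Nat.le_ceil q]
  set R : ℝ → ℝ := fun x => 4 ^ q * (x ^ (2 * m - 2 * q) * Real.exp (-(q / 4) * x ^ (1 : ℝ)) +
    2 * (x ^ (2 * m - 2 * q + 1) * Real.exp (-(q / 4) * x ^ (1 : ℝ)))) with hR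
  have hRint : IntegrableOn R (Ioi 0) := by
    refine Integrable.const_mul (Integrable.add ?_ (Integrable.const_mul ?_ 2)) _
    · exact integrableOn_rpow_mul_exp_neg_mul_rpow (by linarith) one_pos (by positivity)
    · exact integrableOn_rpow_mul_exp_neg_mul_rpow (by linarith) one_pos (by positivity)
  have hle : ∀ x : ℝ, 0 < x → logMajorant q x * ENNReal.ofReal (|x| ^ (2 * m) * (1 + 2 * |x|)) =
      ENNReal.ofReal (R x) := by
    intro x hx
    rw [logMajorant, abs_of_pos hx, ENNReal.ofReal_rpow_of_pos (by positivity),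
      ← ENNReal.ofReal_mul (by positivity)]
    congr 1
    rw [hR, Real.div_rpow (by positivity) (by norm_num), Real.mul_rpow (by positivity) (by positivity),
      ← Real.exp_mul, ← Real.rpow_natCast, ← Real.rpow_mul hx.le, ← Real.rpow_natCast,
      Real.rpow_neg (by norm_num : (0:ℝ) ≤ 4)]
    simp only [Real.rpow_add hx, Real.rpow_sub hx, Real.rpow_one]
    rw [show ((2 : ℕ) : ℝ) * -q = -(2 * q) by push_cast; ring, Real.rpow_neg hx.le,
      show x / 4 * -q = -(q / 4) * x by ring]
    push_cast
    field_simp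
  have hpos : ∫⁻ l in Ioi (0 : ℝ), logMajorant q l *
      ENNReal.ofReal (|l| ^ (2 * m) * (1 + 2 * |l|)) ≠ ∞ := by
    rw [setLIntegral_congr_fun measurableSet_Ioi fun x hx => hle x hx]
    exact hRint.lintegral_lt_top.ne
  have hneg : ∫⁻ l in Iio (0 : ℝ), logMajorant q l *
      ENNReal.ofReal (|l| ^ (2 * m) * (1 + 2 * |l|)) =
      ∫⁻ l in Ioi (0 : ℝ), logMajorant q l *
      ENNReal.ofReal (|l| ^ (2 * m) * (1 + 2 * |l|)) := by
    have h := (Measure.measurePreserving_neg (volume : Measure ℝ)).setLIntegral_comp_preimage_emb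
      (MeasurableEquiv.neg ℝ).measurableEmbedding
      (fun l => logMajorant q l * ENNReal.ofReal (|l| ^ (2 * m) * (1 + 2 * |l|))) (Ioi 0)
    rw [← h]
    have hs : (Neg.neg : ℝ → ℝ) ⁻¹' Ioi 0 = Iio 0 := by ext; simp
    rw [hs]
    simp only [logMajorant, abs_neg]
  rw [← lintegral_add_compl _ (measurableSet_Ioi (a := (0 : ℝ))), compl_Ioi,
    ← setLIntegral_congr (Iio_ae_eq_Iic (a := (0 : ℝ))), hneg]
  exact ENNReal.add_ne_top.2 ⟨hpos, hpos⟩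

/-- Logarithmic polar coordinates. -/
noncomputable def polarMap (x : Heis n × ℝ) : Heis n := dil (Real.exp x.2) (unit x.1)

@[fun_prop]
theorem measurable_polarMap : Measurable (polarMap : Heis n × ℝ → Heis n) :=
  continuous_dil.measurable.comp
    ((Real.measurable_exp.comp measurable_snd).prodMk (measurable_unit.comp measurable_fst))

/-- The Lebesgue measure in logarithmic polar coordinates. -/
noncomputable def polarMeasure (n : ℕ) : Measure (Heis n × ℝ) :=
  ((shellMeasure n).prod volume).withDensity fun x => ENNReal.ofReal (Real.exp (homDim n * x.2))

instance : SFinite (polarMeasure n) := by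
  unfold polarMeasure; infer_instance

theorem lintegral_polarMeasure {F : Heis n × ℝ → ℝ≥0∞} (hF : Measurable F) :
    ∫⁻ x, F x ∂(polarMeasure n) =
      ∫⁻ x, ENNReal.ofReal (Real.exp (homDim n * x.2)) * F x ∂((shellMeasure n).prod volume) := by
  rw [polarMeasure, lintegral_withDensity_eq_lintegral_mul _ (by fun_prop) hF]
  rfl

theorem lintegral_eq_polarMap {F : Heis n → ℝ≥0∞} (hF : Measurable F) :
    ∫⁻ ξ, F ξ = ∫⁻ x, ENNReal.ofReal (Real.exp (homDim n * x.2)) * F (polarMap x)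
      ∂((shellMeasure n).prod volume) :=
  lintegral_polar hF

theorem measurePreserving_polarMap :
    MeasurePreserving (polarMap : Heis n × ℝ → Heis n) (polarMeasure n) volume := by
  refine ⟨measurable_polarMap, Measure.ext_of_lintegral _ fun F hF => ?_⟩
  rw [lintegral_map hF measurable_polarMap, lintegral_polar hF,
    lintegral_polarMeasure (F := fun x => F (polarMap x)) (hF.comp measurable_polarMap)]
  rfl

theorem gauge_polarMap (x : Heis n × ℝ) : gauge (polarMap x) = Real.exp x.2 := by
  rw [polarMap, gauge_dil (Real.exp_pos _).le, gauge_unit, mul_one]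

theorem lintegral_gauge_lt {q : ℝ} (hq : 2 * q < homDim n) {r : ℝ} (hr : 0 < r) :
    ∫⁻ ξ : Heis n, ({ξ | gauge ξ < r}.indicator fun ξ => ENNReal.ofReal (gauge ξ) ^ (-(2 * q))) ξ =
      shellMeasure n univ * ENNReal.ofReal (r ^ (homDim n - 2 * q) / (homDim n - 2 * q)) := by
  have hm : Measurable ({ξ : Heis n | gauge ξ < r}.indicator
      fun ξ => ENNReal.ofReal (gauge ξ) ^ (-(2 * q))) :=
    Measurable.indicator (by fun_prop) (measurableSet_lt measurable_gauge measurable_const)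
  have hpt : ∀ x : Heis n × ℝ, ENNReal.ofReal (Real.exp (homDim n * x.2)) *
      ({ξ : Heis n | gauge ξ < r}.indicator
      fun ξ => ENNReal.ofReal (gauge ξ) ^ (-(2 * q))) (polarMap x) =
      1 * (Iio (Real.log r)).indicator
        (fun t => ENNReal.ofReal (Real.exp ((homDim n - 2 * q) * t))) x.2 := by
    intro x
    rw [one_mul]
    have hiff : polarMap x ∈ {ξ : Heis n | gauge ξ < r} ↔ x.2 ∈ Iio (Real.log r) := by
      rw [mem_ofPred_eq, gauge_polarMap, mem_Iio, Real.lt_log_iff_exp_lt hr]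
    by_cases h : x.2 ∈ Iio (Real.log r)
    · rw [indicator_of_mem h, indicator_of_mem (hiff.2 h), gauge_polarMap,
        ENNReal.ofReal_rpow_of_pos (Real.exp_pos _), ← Real.exp_mul,
        ← ENNReal.ofReal_mul (Real.exp_pos _).le, ← Real.exp_add]
      congr 2; ring
    · rw [indicator_of_notMem h, indicator_of_notMem (fun h' => h (hiff.1 h')), mul_zero]
  rw [← measurePreserving_polarMap.lintegral_comp hm,
    lintegral_polarMeasure (F := fun x => ({ξ : Heis n | gauge ξ < r}.indicator
      fun ξ => ENNReal.ofReal (gauge ξ) ^ (-(2 * q))) (polarMap x)) (hm.comp measurable_polarMap)]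
  simp_rw [hpt]
  rw [lintegral_prod_mul (f := fun _ => 1) (g := (Iio (Real.log r)).indicator
        (fun t => ENNReal.ofReal (Real.exp ((homDim n - 2 * q) * t)))) aemeasurable_const
      (Measurable.aemeasurable (Measurable.indicator (by fun_prop) measurableSet_Iio)),
    lintegral_one, lintegral_indicator measurableSet_Iio, setLIntegral_congr Iio_ae_eq_Iic]
  have hpos : 0 < homDim n - 2 * q := by linarith
  rw [← ofReal_integral_eq_lintegral_ofReal (integrableOn_exp_mul_Iic hpos _)
    (.of_forall fun _ => (Real.exp_pos _).le), integral_exp_mul_Iic hpos,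
    mul_comm _ (Real.log r), Real.exp_mul, Real.exp_log hr]

theorem _root_.Measurable.greenKernel {X : Type*} [MeasurableSpace X] (q : ℝ) {f g : X → Heis n}
    (hf : Measurable f) (hg : Measurable g) : Measurable fun x => greenKernel q (f x) (g x) :=
  (ENNReal.measurable_ofReal.comp (measurable_gauge.comp ((hf.fst.neg.add hg.fst).prodMk
    ((hf.snd.neg.add hg.snd).add ((Complex.measurable_im.comp
      (hf.fst.neg.herm hg.fst)).const_mul 2))))).pow_const _

theorem _root_.Measurable.rot {X : Type*} [MeasurableSpace X] {f : X → Circle} {g : X → Heis n}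
    (hf : Measurable f) (hg : Measurable g) : Measurable fun x => rot (f x) (g x) :=
  ((Circle.measurable_coe.comp hf).smul hg.fst).prodMk hg.snd

/-- The Green kernel is of weak type: its integral over a set is controlled by a power of the
measure of the set. -/
theorem setLIntegral_greenKernel_le {q : ℝ} (hq : 0 < q) (hqQ : 2 * q < homDim n) (ζ : Heis n)
    (B : Set (Heis n × ℝ)) :
    ∫⁻ y in B, greenKernel q ζ (polarMap y) ∂(polarMeasure n) ≤
      (shellMeasure n univ * ENNReal.ofReal (1 / (homDim n - 2 * q)) + 1) *
        polarMeasure n B ^ ((homDim n - 2 * q) / homDim n) := by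
  have hQ := homDim_pos n
  have hα : 0 < homDim n - 2 * q := by linarith
  by_cases h0 : polarMeasure n B = 0
  · rw [Measure.restrict_eq_zero.2 h0, lintegral_zero_measure]; exact zero_le
  by_cases htop : polarMeasure n B = ∞
  -- The summand 1 keeps the constant nonzero, so the bound is trivial here.
  · rw [htop, ENNReal.top_rpow_of_pos (by positivity), ENNReal.mul_top (by simp)]
    exact le_top
  set V := (polarMeasure n B).toReal with hV
  have hVB : polarMeasure n B = ENNReal.ofReal V := (ENNReal.ofReal_toReal htop).symm
  have hV0 : 0 < V := ENNReal.toReal_pos h0 htop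
  -- With r^Q = V, the near part and the far part of the kernel both scale as V^((Q - 2q)/Q).
  set r := V ^ (1 / homDim n) with hr
  have hr0 : 0 < r := by positivity
  have hsplit : ∀ ξ : Heis n, greenKernel q ζ ξ ≤ ({ξ : Heis n | gauge ξ < r}.indicator
      fun ξ => ENNReal.ofReal (gauge ξ) ^ (-(2 * q))) (mul (inv ζ) ξ) +
      ENNReal.ofReal r ^ (-(2 * q)) := by
    intro ξ
    by_cases h : mul (inv ζ) ξ ∈ {ξ : Heis n | gauge ξ < r}
    · rw [indicator_of_mem h]; exact le_self_add
    · rw [indicator_of_notMem h, zero_add, greenKernel, ENNReal.rpow_neg, ENNReal.rpow_neg,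
        ENNReal.inv_le_inv]
      exact ENNReal.rpow_le_rpow (ENNReal.ofReal_le_ofReal (not_lt.1 h)) (by positivity)
  have hm : Measurable ({ξ : Heis n | gauge ξ < r}.indicator
      fun ξ => ENNReal.ofReal (gauge ξ) ^ (-(2 * q))) :=
    Measurable.indicator (by fun_prop) (measurableSet_lt measurable_gauge measurable_const)
  have hm' := hm.comp (measurePreserving_mul (inv ζ)).measurable
  calc ∫⁻ y in B, greenKernel q ζ (polarMap y) ∂(polarMeasure n)
      ≤ ∫⁻ y in B, (({ξ : Heis n | gauge ξ < r}.indicator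
      fun ξ => ENNReal.ofReal (gauge ξ) ^ (-(2 * q))) (mul (inv ζ) (polarMap y)) +
      ENNReal.ofReal r ^ (-(2 * q))) ∂(polarMeasure n) := lintegral_mono fun y => hsplit _
    _ = ∫⁻ y in B, ({ξ : Heis n | gauge ξ < r}.indicator
      fun ξ => ENNReal.ofReal (gauge ξ) ^ (-(2 * q))) (mul (inv ζ) (polarMap y))
        ∂(polarMeasure n) + ENNReal.ofReal r ^ (-(2 * q)) * polarMeasure n B := by
      rw [lintegral_add_right _ measurable_const, setLIntegral_const]
    _ ≤ ∫⁻ y, ({ξ : Heis n | gauge ξ < r}.indicator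
      fun ξ => ENNReal.ofReal (gauge ξ) ^ (-(2 * q))) (mul (inv ζ) (polarMap y))
        ∂(polarMeasure n) + ENNReal.ofReal r ^ (-(2 * q)) * polarMeasure n B := by
      exact add_le_add (setLIntegral_le_lintegral _ _) le_rfl
    _ = shellMeasure n univ * ENNReal.ofReal (r ^ (homDim n - 2 * q) / (homDim n - 2 * q)) +
        ENNReal.ofReal r ^ (-(2 * q)) * polarMeasure n B := by
      rw [← lintegral_gauge_lt hqQ hr0, ← (measurePreserving_mul (inv ζ)).lintegral_comp hm,
        ← measurePreserving_polarMap.lintegral_comp (f := fun ξ => ({ξ : Heis n | gauge ξ < r}.indicator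
          fun ξ => ENNReal.ofReal (gauge ξ) ^ (-(2 * q))) (mul (inv ζ) ξ)) hm']
    _ = _ := by
      rw [hVB, ENNReal.ofReal_rpow_of_pos hr0, ENNReal.ofReal_rpow_of_pos hV0,
        ← ENNReal.ofReal_mul (by positivity), add_mul, one_mul, mul_assoc,
        ← ENNReal.ofReal_mul (by positivity)]
      have e1 : r ^ (homDim n - 2 * q) = V ^ ((homDim n - 2 * q) / homDim n) := by
        rw [hr, ← Real.rpow_mul hV0.le]; congr 1; field_simp
      have e2 : r ^ (-(2 * q)) * V = V ^ ((homDim n - 2 * q) / homDim n) := by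
        rw [hr, ← Real.rpow_mul hV0.le, ← Real.rpow_add_one hV0.ne']; congr 1; field_simp; ring
      rw [e1, e2, one_div_mul_eq_div]

theorem continuous_gauge_mul_inv :
    Continuous fun p : Heis n × Heis n => gauge (mul (inv p.1) p.2) := by
  refine continuous_gauge.comp ?_
  have h : Continuous fun p : Heis n × Heis n => herm (-p.1.1) p.2.1 := by
    unfold herm; fun_prop
  unfold mul inv
  fun_prop

theorem continuous_greenKernel_left (q : ℝ) (ξ : Heis n) :
    Continuous fun ζ => greenKernel q ζ ξ := by
  have h : Continuous fun ζ : Heis n => gauge (mul (inv ζ) ξ) :=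
    continuous_gauge_mul_inv.comp (f := fun ζ : Heis n => (ζ, ξ))
      (continuous_id.prodMk continuous_const)
  exact ENNReal.continuous_rpow_const.comp (ENNReal.continuous_ofReal.comp h)

/-- The average of the Green kernel over the rotations, in logarithmic polar coordinates. -/
theorem lintegral_greenKernel_polarMap (q : ℝ) (x y : Heis n × ℝ) :
    ∫⁻ c, greenKernel q (rot c (polarMap x)) (polarMap y) ∂circleMeasure =
      ENNReal.ofReal (Real.exp (-q * (x.2 + y.2))) * LogFrame.ker (logKernel q) x y :=
  lintegral_greenKernel_dil q x.1 y.1 x.2 y.2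

/-- The Hardy–Littlewood–Sobolev inequality in logarithmic polar coordinates. -/
theorem exists_hasFormBound_logKernel {q : ℝ} (hq : 0 < q) (hqQ : 2 * q < homDim n) :
    ∃ C : ℝ≥0∞, C ≠ ∞ ∧ LogFrame.HasFormBound (shellMeasure n) (logKernel q)
      ((homDim n - 2 * q) / homDim n) C := by
  have hQ := homDim_pos n
  set θ := (homDim n - 2 * q) / homDim n with hθ
  have hθ0 : 0 < θ := div_pos (by linarith) hQ
  have hθ1 : θ < 1 := by rw [hθ, div_lt_one hQ]; linarith
  have hθQ : homDim n * (1 + θ) = 2 * (homDim n - q) := by rw [hθ]; field_simp; ring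
  set p := 2 / (1 + θ) with hp
  have hpθ : p * (1 + θ) = 2 := by rw [hp]; field_simp
  set C₁ := shellMeasure n univ * ENNReal.ofReal (1 / (homDim n - 2 * q)) + 1 with hC₁
  refine ⟨2 * (C₁ * ENNReal.ofReal (1 / (p - 1))), ?_, fun h hh hfin => ?_⟩
  · exact ENNReal.mul_ne_top (by simp) (ENNReal.mul_ne_top (ENNReal.add_ne_top.2
      ⟨ENNReal.mul_ne_top shellMeasure_univ_ne_top ENNReal.ofReal_ne_top, by simp⟩)
      ENNReal.ofReal_ne_top)
  have hκm := LogFrame.measurable_uncurry_ker (isLogKernel_logKernel (n := n) hq)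
  set k : Heis n × ℝ → Heis n × ℝ → ℝ≥0∞ := fun x y =>
    ENNReal.ofReal (Real.exp (-q * (x.2 + y.2))) * LogFrame.ker (logKernel q) x y with hk
  have hkm : Measurable (Function.uncurry k) :=
    Measurable.mul (by fun_prop) hκm
  -- The exponent Q - q cancels both the Jacobian and the factor of k in the quadratic form. Since
  -- (Q - q) p = Q, it also cancels the Jacobian in the L^p norm.
  set w : Heis n × ℝ → ℝ≥0∞ := fun x =>
    ENNReal.ofReal (Real.exp (-(homDim n - q) * x.2)) * h x with hw
  have hwm : Measurable w := Measurable.mul (by fun_prop) hh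
  have key := lintegral_quadratic_form_le (m := polarMeasure n) hkm (fun x y => ?_) hθ0 hθ1 hpθ
    (C := C₁) (fun x B _ => ?_) hwm
    (fun x => ENNReal.mul_ne_top ENNReal.ofReal_ne_top (hfin x))
  · convert key using 1
    · have hin : ∀ x, ∫⁻ y, w x * (k x y * w y) ∂(polarMeasure n) =
          ENNReal.ofReal (Real.exp (-homDim n * x.2)) *
            ∫⁻ y, h x * (LogFrame.ker (logKernel q) x y * h y) ∂((shellMeasure n).prod volume) := by
        intro x
        have hm : Measurable fun y => w x * (k x y * w y) :=
          Measurable.mul measurable_const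
            ((hkm.comp (measurable_const.prodMk measurable_id)).mul hwm)
        rw [lintegral_polarMeasure hm, ← lintegral_const_mul' _ _ ENNReal.ofReal_ne_top]
        refine lintegral_congr fun y => ?_
        have e : ENNReal.ofReal (Real.exp (-homDim n * x.2)) =
            ENNReal.ofReal (Real.exp (homDim n * y.2)) *
            (ENNReal.ofReal (Real.exp (-(homDim n - q) * x.2)) *
            (ENNReal.ofReal (Real.exp (-q * (x.2 + y.2))) *
            ENNReal.ofReal (Real.exp (-(homDim n - q) * y.2)))) := by
          rw [← ENNReal.ofReal_mul (Real.exp_pos _).le, ← ENNReal.ofReal_mul (Real.exp_pos _).le,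
            ← ENNReal.ofReal_mul (Real.exp_pos _).le, ← Real.exp_add, ← Real.exp_add,
            ← Real.exp_add]
          congr 2; ring
        rw [e, hw, hk]; ring
      simp_rw [hin]
      have hker : Measurable fun z : (Heis n × ℝ) × (Heis n × ℝ) =>
          h z.1 * (LogFrame.ker (logKernel q) z.1 z.2 * h z.2) :=
        (hh.comp measurable_fst).mul (hκm.mul (hh.comp measurable_snd))
      have hm : Measurable fun x : Heis n × ℝ => ENNReal.ofReal (Real.exp (-homDim n * x.2)) *
          ∫⁻ y, h x * (LogFrame.ker (logKernel q) x y * h y) ∂((shellMeasure n).prod volume) :=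
        Measurable.mul (by fun_prop) hker.lintegral_prod_right'
      rw [lintegral_polarMeasure hm]
      refine lintegral_congr fun x => ?_
      rw [← mul_assoc, ← ENNReal.ofReal_mul (Real.exp_pos _).le, ← Real.exp_add, neg_mul,
        add_neg_cancel, Real.exp_zero, ENNReal.ofReal_one, one_mul]
    · congr 2
      rw [lintegral_polarMeasure (hwm.pow_const p)]
      refine lintegral_congr fun x => ?_
      rw [hw, ENNReal.mul_rpow_of_nonneg _ _ (by positivity),
        ENNReal.ofReal_rpow_of_pos (Real.exp_pos _), ← mul_assoc,
        ← ENNReal.ofReal_mul (Real.exp_pos _).le, ← Real.exp_mul, ← Real.exp_add]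
      have : homDim n * x.2 + -(homDim n - q) * x.2 * p = 0 := by
        have : (homDim n - q) * p = homDim n := by
          linear_combination (-p / 2) * hθQ + homDim n / 2 * hpθ
        linear_combination (-x.2) * this
      rw [this, Real.exp_zero, ENNReal.ofReal_one, one_mul]
  · simp only [hk]
    rw [add_comm, LogFrame.ker_comm (isLogKernel_logKernel hq)]
  · have hm : Measurable fun z : (Heis n × ℝ) × Circle =>
        greenKernel q (rot z.2 (polarMap x)) (polarMap z.1) :=
      (measurable_snd.rot measurable_const).greenKernel q
        (measurable_polarMap.comp measurable_fst)
    -- The weak-type bound for the Green kernel is uniform in its pole, so it passes to the average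
    -- over rotations.
    calc ∫⁻ y in B, k x y ∂(polarMeasure n) = ∫⁻ y in B, (∫⁻ c,
          greenKernel q (rot c (polarMap x)) (polarMap y) ∂circleMeasure) ∂(polarMeasure n) := by
          simp_rw [lintegral_greenKernel_polarMap]
          rfl
      _ = ∫⁻ c, (∫⁻ y in B, greenKernel q (rot c (polarMap x)) (polarMap y) ∂(polarMeasure n))
          ∂circleMeasure := lintegral_lintegral_swap hm.aemeasurable
      _ ≤ ∫⁻ _, C₁ * polarMeasure n B ^ θ ∂circleMeasure :=
          lintegral_mono fun c => setLIntegral_greenKernel_le hq hqQ _ B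
      _ = _ := by simp

end Heisenberg

/-! ### From the critical equation to the equation on S × ℝ, and back. -/

namespace Heisenberg

variable {n : ℕ} {α : ℝ} {u : Heis n → ℝ}

theorem ae_gauge_mul_inv_pos (ζ : Heis n) : ∀ᵐ ξ : Heis n, 0 < gauge (mul (inv ζ) ξ) := by
  filter_upwards [(measurePreserving_mul (inv ζ)).quasiMeasurePreserving.ae ae_ne_zero] with ξ hξ
  exact gauge_pos.2 hξ

/-- Equality can only be claimed off the diagonal: for a negative exponent the real power is 0 there
by convention, while `greenKernel` is ∞. -/
theorem ofReal_kernel_mul_ae (hu : IsCriticalSolution α u) (hσ : 0 ≤ critExp n α) (ζ : Heis n) :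
    (fun ξ => ENNReal.ofReal (kernel α ζ ξ * u ξ ^ critExp n α)) =ᵐ[volume]
      fun ξ => greenKernel ((homDim n - α) / 2) ζ ξ * ENNReal.ofReal (u ξ) ^ critExp n α := by
  filter_upwards [ae_gauge_mul_inv_pos ζ] with ξ hξ
  rw [kernel, greenKernel, ENNReal.ofReal_mul (by positivity), ENNReal.ofReal_rpow_of_pos hξ,
    ENNReal.ofReal_rpow_of_nonneg (hu.nonneg ξ) hσ]
  congr 3; ring_nf

theorem IsCriticalSolution.aemeasurable (hu : IsCriticalSolution α u) (hσ : 0 ≤ critExp n α)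
    (ζ : Heis n) : AEMeasurable fun ξ =>
      greenKernel ((homDim n - α) / 2) ζ ξ * ENNReal.ofReal (u ξ) ^ critExp n α :=
  (hu.integrable ζ).aestronglyMeasurable.aemeasurable.ennreal_ofReal.congr
    (ofReal_kernel_mul_ae hu hσ ζ)

theorem IsCriticalSolution.ofReal_eq_lintegral (hu : IsCriticalSolution α u)
    (hσ : 0 ≤ critExp n α) (ζ : Heis n) : ENNReal.ofReal (u ζ) =
      ∫⁻ ξ, greenKernel ((homDim n - α) / 2) ζ ξ * ENNReal.ofReal (u ξ) ^ critExp n α := by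
  rw [hu.eq_integral ζ, ofReal_integral_eq_lintegral_ofReal (hu.integrable ζ),
    lintegral_congr_ae (ofReal_kernel_mul_ae hu hσ ζ)]
  refine .of_forall fun ξ => mul_nonneg ?_ ?_
  · exact Real.rpow_nonneg (gauge_nonneg _) _
  · exact Real.rpow_nonneg (hu.nonneg ξ) _

/-- Fatou's lemma, using that the [0, ∞]-valued Green kernel is continuous in its pole, diagonal
included. It also yields Borel measurability of u. -/
theorem IsCriticalSolution.lowerSemicontinuous (hu : IsCriticalSolution α u)
    (hσ : 0 ≤ critExp n α) : LowerSemicontinuous fun ξ => ENNReal.ofReal (u ξ) := by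
  rw [lowerSemicontinuous_iff_le_liminf]
  intro ζ
  calc ENNReal.ofReal (u ζ) = ∫⁻ ξ, liminf (fun ζ' => greenKernel ((homDim n - α) / 2) ζ' ξ *
        ENNReal.ofReal (u ξ) ^ critExp n α) (𝓝 ζ) := by
        rw [hu.ofReal_eq_lintegral hσ ζ]
        refine lintegral_congr fun ξ => (Tendsto.liminf_eq ?_).symm
        refine ENNReal.Tendsto.mul_const ?_
          (Or.inr (ENNReal.rpow_ne_top_of_nonneg hσ ENNReal.ofReal_ne_top))
        exact (continuous_greenKernel_left _ ξ).tendsto ζ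
    _ ≤ liminf (fun ζ' => ∫⁻ ξ, greenKernel ((homDim n - α) / 2) ζ' ξ *
        ENNReal.ofReal (u ξ) ^ critExp n α) (𝓝 ζ) :=
        lintegral_liminf_le' fun ζ' => hu.aemeasurable hσ ζ'
    _ = _ := by simp_rw [← hu.ofReal_eq_lintegral hσ]

theorem IsCylindrical.comp_rot (hcyl : IsCylindrical u) (c : Circle) (ξ : Heis n) :
    u (rot c ξ) = u ξ := by
  obtain ⟨f, hf⟩ := hcyl
  rw [rot, hf, radius_smul, Circle.norm_coe, one_mul, ← hf]

theorem continuous_polarMap_right (a : Heis n) : Continuous fun t : ℝ => polarMap (a, t) :=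
  continuous_dil.comp (f := fun t : ℝ => (Real.exp t, unit a))
    (Real.continuous_exp.prodMk continuous_const)

theorem homDim_mul_critExp (hαQ : α < homDim n) :
    (homDim n - α) / 2 * critExp n α = (homDim n + α) / 2 := by
  have : homDim n - α ≠ 0 := by linarith
  rw [critExp]; field_simp

/-- A solution in logarithmic polar coordinates, rescaled by its homogeneity. -/
noncomputable def logProfile (α : ℝ) (u : Heis n → ℝ) (x : Heis n × ℝ) : ℝ≥0∞ :=
  ENNReal.ofReal (Real.exp ((homDim n - α) / 2 * x.2)) * ENNReal.ofReal (u (polarMap x))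

theorem IsCriticalSolution.setLIntegral_ne_top (hu : IsCriticalSolution α u)
    (hσ : 0 ≤ critExp n α) (R : ℝ) :
    ∫⁻ ξ in {ξ | gauge ξ ≤ R}, ENNReal.ofReal (u ξ) ^ (critExp n α + 1) ≠ ∞ := by
  have h := lintegral_rpow_enorm_lt_top_of_eLpNorm_lt_top (by simp; linarith) ENNReal.ofReal_ne_top
    (hu.locLp _ (isCompact_gauge_le R)).eLpNorm_lt_top
  rw [ENNReal.toReal_ofReal (by linarith)] at h
  simp_rw [Real.enorm_of_nonneg (hu.nonneg _)] at h
  exact h.ne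

/-- Cylindrical symmetry enters through invariance under the rotations `rot c`: averaging the
equation over c replaces the Green kernel by its average. The exponential weights balance because q
+ qσ = Q. -/
theorem IsCriticalSolution.isLogSolution (hα : 0 < α) (hαQ : α < homDim n)
    (hu : IsCriticalSolution α u) (hcyl : IsCylindrical u) :
    LogFrame.IsLogSolution (shellMeasure n) (logKernel ((homDim n - α) / 2)) (critExp n α)
      (logProfile α u) := by
  have hQ := homDim_pos n
  have hσ : 0 ≤ critExp n α := div_nonneg (by linarith) (by linarith)
  have hqσ := homDim_mul_critExp hαQ
  set q := (homDim n - α) / 2 with hq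
  set σ := critExp n α with hσdef
  have hlsc := hu.lowerSemicontinuous hσ
  have hU : Measurable fun ξ => ENNReal.ofReal (u ξ) := hlsc.measurable
  have hUp : Measurable fun x => ENNReal.ofReal (u (polarMap x)) := hU.comp measurable_polarMap
  have hpow : ∀ (x : Heis n × ℝ) {τ : ℝ}, 0 ≤ τ → logProfile α u x ^ τ =
      ENNReal.ofReal (Real.exp (q * τ * x.2)) * ENNReal.ofReal (u (polarMap x)) ^ τ := by
    intro x τ hτ
    rw [logProfile, ENNReal.mul_rpow_of_nonneg _ _ hτ, ENNReal.ofReal_rpow_of_pos (Real.exp_pos _),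
      ← Real.exp_mul, mul_right_comm]
  refine ⟨Measurable.mul (by fun_prop) hUp,
    fun x => ENNReal.mul_ne_top ENNReal.ofReal_ne_top ENNReal.ofReal_ne_top, fun a => ?_,
    fun x => ?_, fun c => ?_⟩
  · rw [lowerSemicontinuous_iff_le_liminf]
    intro t
    have h1 : Continuous fun t : ℝ => ENNReal.ofReal (Real.exp (q * t)) :=
      ENNReal.continuous_ofReal.comp (by fun_prop)
    have h2 := (hlsc.comp (continuous_polarMap_right a)).le_liminf t
    exact (mul_le_mul' (h1.tendsto t).liminf_eq.ge h2).trans ENNReal.le_liminf_mul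
  · have hG : Measurable fun z : Circle × Heis n => greenKernel q (rot z.1 (polarMap x)) z.2 *
        ENNReal.ofReal (u z.2) ^ σ :=
      ((measurable_fst.rot measurable_const).greenKernel q measurable_snd).mul
        ((hU.comp measurable_snd).pow_const σ)
    have hG' : ∀ ξ, Measurable fun c : Circle => greenKernel q (rot c (polarMap x)) ξ := fun ξ =>
      (measurable_id.rot measurable_const).greenKernel q measurable_const
    have havg : ENNReal.ofReal (u (polarMap x)) = ∫⁻ ξ,
        (∫⁻ c, greenKernel q (rot c (polarMap x)) ξ ∂circleMeasure) * ENNReal.ofReal (u ξ) ^ σ := by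
      calc ENNReal.ofReal (u (polarMap x))
          = ∫⁻ c, ENNReal.ofReal (u (rot c (polarMap x))) ∂circleMeasure := by
            simp [hcyl.comp_rot]
        _ = ∫⁻ c, (∫⁻ ξ, greenKernel q (rot c (polarMap x)) ξ * ENNReal.ofReal (u ξ) ^ σ)
            ∂circleMeasure := by simp_rw [hu.ofReal_eq_lintegral hσ (rot _ _)]; rfl
        _ = ∫⁻ ξ, (∫⁻ c, greenKernel q (rot c (polarMap x)) ξ * ENNReal.ofReal (u ξ) ^ σ
            ∂circleMeasure) := lintegral_lintegral_swap hG.aemeasurable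
        _ = _ := lintegral_congr fun ξ => lintegral_mul_const _ (hG' ξ)
    have hA : Measurable fun ξ => (∫⁻ c, greenKernel q (rot c (polarMap x)) ξ ∂circleMeasure) *
        ENNReal.ofReal (u ξ) ^ σ := by
      refine Measurable.mul ?_ (hU.pow_const σ)
      exact Measurable.lintegral_prod_right' (f := fun z : Heis n × Circle =>
        greenKernel q (rot z.2 (polarMap x)) z.1)
        ((measurable_snd.rot measurable_const).greenKernel q measurable_fst)
    rw [logProfile, havg, lintegral_eq_polarMap hA,
      ← lintegral_const_mul' _ _ ENNReal.ofReal_ne_top]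
    refine lintegral_congr fun y => ?_
    rw [lintegral_greenKernel_polarMap, hpow y hσ, hqσ]
    have e : ENNReal.ofReal (Real.exp ((homDim n + α) / 2 * y.2)) =
        ENNReal.ofReal (Real.exp (q * x.2)) * (ENNReal.ofReal (Real.exp (homDim n * y.2)) *
          ENNReal.ofReal (Real.exp (-q * (x.2 + y.2)))) := by
      rw [← ENNReal.ofReal_mul (Real.exp_pos _).le, ← ENNReal.ofReal_mul (Real.exp_pos _).le,
        ← Real.exp_add, ← Real.exp_add]
      congr 2
      rw [hq]; ring
    rw [e]; ring
  -- The weight of the profile to the power σ + 1 is exactly the Jacobian, so the integral over t <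
  -- c is dominated by that of u^(σ+1) over a gauge ball.
  · have hτ : q * (σ + 1) = homDim n := by rw [mul_add, hqσ, hq]; ring
    have hm : Measurable fun ξ => ({ξ : Heis n | gauge ξ ≤ Real.exp c}.indicator
        fun ξ => ENNReal.ofReal (u ξ) ^ (σ + 1)) ξ :=
      (hU.pow_const _).indicator (measurableSet_le measurable_gauge measurable_const)
    refine ((?_ : _ ≤ ∫⁻ ξ in {ξ | gauge ξ ≤ Real.exp c}, ENNReal.ofReal (u ξ) ^ (σ + 1)).trans_lt
      (hu.setLIntegral_ne_top hσ _).lt_top).ne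
    rw [← lintegral_indicator (measurableSet_le measurable_gauge measurable_const),
      lintegral_eq_polarMap hm,
      ← lintegral_indicator (LogFrame.measurableSet_lower c)]
    refine lintegral_mono fun x => indicator_apply_le' (fun hx => ?_) fun _ => zero_le
    rw [hpow x (by linarith), hτ, indicator_of_mem]
    rw [mem_ofPred_eq, gauge_polarMap]
    exact Real.exp_le_exp.2 (le_of_lt hx)

/-- The inversion stays on the dilation orbit of ξ and reflects log (gauge ξ) at c, the logarithm of
the radius. -/
theorem sphereInv_exp (c : ℝ) {ξ : Heis n} (hξ : ξ ≠ 0) :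
    sphereInv (Real.exp c) ξ = polarMap (LogFrame.reflect c (ξ, Real.log (gauge ξ))) := by
  have hρ := gauge_pos.2 hξ
  have he : Real.exp (2 * c - Real.log (gauge ξ)) * (gauge ξ)⁻¹ =
      Real.exp c ^ 2 / gauge ξ ^ 2 := by
    rw [Real.exp_sub, Real.exp_log hρ, ← Real.exp_nat_mul]
    push_cast; field_simp
  rw [LogFrame.reflect, polarMap, unit_of_ne_zero hξ, dil_dil, he]
  refine Prod.ext ?_ ?_
  · funext j
    simp [sphereInv, dil]
  · simp only [sphereInv, dil]
    field_simp

/-- Cylindrical critical solutions are invariant under the inversion in a sphere. -/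
theorem IsCriticalSolution.exists_sphereInv_eq (hα : 0 < α) (hαQ : α < homDim n)
    (hu : IsCriticalSolution α u) (hcyl : IsCylindrical u) :
    ∃ s : ℝ, 0 < s ∧ ∀ ξ : Heis n, ξ ≠ 0 →
      u ξ = s ^ (homDim n - α) / gauge ξ ^ (homDim n - α) * u (sphereInv s ξ) := by
  have hQ := homDim_pos n
  have hq : 0 < (homDim n - α) / 2 := by linarith
  obtain ⟨C, hC, hform⟩ := exists_hasFormBound_logKernel (n := n) hq (by linarith)
  obtain ⟨c₀, hc₀, hlow⟩ := exists_le_logKernel (n := n) hq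
  obtain ⟨m, hm, hint⟩ := exists_lintegral_logMajorant_ne_top hq
  have hθ : (homDim n - 2 * ((homDim n - α) / 2)) / homDim n = α / homDim n := by ring
  rw [hθ] at hform
  have hσ : critExp n α * (1 - α / homDim n) = 1 + α / homDim n := by
    have : homDim n - α ≠ 0 := by linarith
    rw [critExp]; field_simp
  obtain ⟨c, hc⟩ := (hu.isLogSolution hα hαQ hcyl).exists_reflect_eq (isLogKernel_logKernel hq)
    (div_pos hα hQ) ((div_lt_one hQ).2 hαQ) hσ hC hform hc₀ hlow (measurable_logMajorant _)
    (logKernel_le hq) hm hint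
  refine ⟨Real.exp c, Real.exp_pos c, fun ξ hξ => ?_⟩
  have hρ := gauge_pos.2 hξ
  have hpm : polarMap (ξ, Real.log (gauge ξ)) = ξ := by
    rw [polarMap, Real.exp_log hρ, dil_gauge_unit hξ]
  have h := hc (ξ, Real.log (gauge ξ))
  rw [logProfile, logProfile, ← sphereInv_exp c hξ, hpm, ← ENNReal.ofReal_mul (Real.exp_pos _).le,
    ← ENNReal.ofReal_mul (Real.exp_pos _).le,
    ENNReal.ofReal_eq_ofReal_iff (mul_nonneg (Real.exp_pos _).le (hu.nonneg _))
      (mul_nonneg (Real.exp_pos _).le (hu.nonneg _))] at h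
  have h1 : ∀ a b : ℝ, a * u (sphereInv (Real.exp c) ξ) = b * u ξ → 0 < b →
      u ξ = a / b * u (sphereInv (Real.exp c) ξ) := by
    intro a b hab hb
    rw [div_mul_eq_mul_div, hab]; field_simp
  rw [h1 _ _ h (Real.exp_pos _), ← Real.exp_sub, ← Real.exp_mul, Real.rpow_def_of_pos hρ,
    ← Real.exp_sub]
  congr 2
  simp only [LogFrame.reflect]; ring

end Heisenberg

theorem theorem1p4 (n : ℕ) (hn : 1 ≤ n) (α : ℝ) (hα : 0 < α) (hαQ : α < Heisenberg.homDim n)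
    (u : Heisenberg.Heis n → ℝ) (hu : Heisenberg.IsCriticalSolution α u)
    (hcyl : Heisenberg.IsCylindrical u) :
    ∃ s : ℝ, 0 < s ∧ ∀ ξ : Heisenberg.Heis n, ξ ≠ 0 →
      u ξ = s ^ (Heisenberg.homDim n - α) / Heisenberg.gauge ξ ^ (Heisenberg.homDim n - α) *
        u (Heisenberg.sphereInv s ξ) :=
  hu.exists_sphereInv_eq hα hαQ hcyl
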